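/- Let $d$ be a dimension, $1<p<\infty$, $p'=p/(p-1)$. A Banach space $F$ is UMD if there is a finite constant $C$ with $\|\sum_{n=1}^N\epsilon_n d_n\|_{L^p(F)}\le C\,\|\sum_{n=1}^N d_n\|_{L^p(F)}$ for all $F$-valued $L^p$-martingale difference sequences $(d_n)_{n=1}^N$ on probability spaces and all signs $\epsilon_n\in\{-1,+1\}$; $\beta_p(F)$ denotes the least such $C$. Let $\mathcal D$ be the standard dyadic system of half-open cubes $2^{-k}(m+[0,1)^d)$, $k\in\mathbb Z$, $m\in\mathbb Z^d$, or, more generally, one of its translates $\mathcal D^\omega$, $\omega\in(\{0,1\}^d)^{\mathbb Z}$, in which each cube of side length $2^{-k}$ is translated by $\sum_{j>k}2^{-j}\omega_j$. For $Q\in\mathcal D$ write $\langle f\rangle_Q=|Q|^{-1}\int_Q f\,dx$ and $D_Qb=\sum_{Q'}\langle b\rangle_{Q'}1_{Q'}-\langle b\rangle_Q1_Q$, where $Q'$ runs over the $2^d$ dyadic children of $Q$. **Theorem.** Let $E$ be a (real) UMD Banach space, and let $\mathcal T\subseteq\mathcal L(E)$ be a closed subspace of the space of bounded linear operators on $E$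 (with the operator norm) which is itself a UMD space. Let $b:\mathbb R^d\to\mathcal T$ be a locally Bochner integrable function with $$\|b\|_{\mathrm{BMO}_p(\mathbb R^d;\mathcal T)}:=\sup_{Q\in\mathcal D}\Big(\frac1{|Q|}\int_Q\|b(x)-\langle b\rangle_Q\|_{\mathcal T}^p\,dx\Big)^{1/p}<\infty ,$$ and let $f\in L^p(\mathbb R^d;E)$. Then the dyadic paraproduct $$\Pi_bf=\sum_{Q\in\mathcal D}D_Qb\,\langle f\rangle_Q$$ converges unconditionally in $L^p(\mathbb R^d;E)$, and $$\|\Pi_bf\|_{L^p(\mathbb R^d;E)}\le 6\cdot2^d\,p\,p'\,\beta_p(E)^2\,\beta_p(\mathcal T)\,\|b\|_{\mathrm{BMO}_p(\mathbb R^d;\mathcal T)}\,\|f\|_{L^p(\mathbb R^d;E)} .$$ -/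

import Mathlib

open MeasureTheory Filter Topology
open scoped ENNReal

noncomputable section

namespace DyadicParaproduct

/-! ### UMD constants -/

/-- `C` is an admissible constant in the `L^p` inequality defining the UMD property of `E`:
`‖∑_{n < N} ε_n d_n‖_{L^p(E)} ≤ C ‖∑_{n < N} d_n‖_{L^p(E)}` for every `E`-valued `L^p`-martingale
difference sequence `d` (i.e. the partial sums of `d` form a martingale) on every probability
space, and for all choices of signs `ε_n ∈ {-1, 1}`. -/
def IsUMDBound (p : ℝ) (E : Type*) [NormedAddCommGroup E] [NormedSpace ℝ E] (C : ℝ≥0∞) : Prop :=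
  ∀ (Ω : Type) (m : MeasurableSpace Ω) (μ : Measure Ω), IsProbabilityMeasure μ →
    ∀ (ℱ : Filtration ℕ m) (δ : ℕ → Ω → E),
      Martingale (fun n => ∑ k ∈ Finset.range (n + 1), δ k) ℱ μ →
      (∀ n, MemLp (δ n) (ENNReal.ofReal p) μ) →
      ∀ (N : ℕ) (ε : ℕ → ℝ), (∀ n, ε n = 1 ∨ ε n = -1) →
        eLpNorm (∑ n ∈ Finset.range N, ε n • δ n) (ENNReal.ofReal p) μ
          ≤ C * eLpNorm (∑ n ∈ Finset.range N, δ n) (ENNReal.ofReal p) μ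

/-- The UMD constant `β_p(E)`: the least constant in the UMD inequality (`⊤` if there is none). -/
def umdConst (p : ℝ) (E : Type*) [NormedAddCommGroup E] [NormedSpace ℝ E] : ℝ≥0∞ :=
  sInf {C : ℝ≥0∞ | IsUMDBound p E C}

/-- `E` is UMD, with respect to the exponent `p`: some finite constant is admissible. -/
def IsUMD (p : ℝ) (E : Type*) [NormedAddCommGroup E] [NormedSpace ℝ E] : Prop :=
  ∃ C : ℝ≥0∞, C ≠ ⊤ ∧ IsUMDBound p E C

/-! ### Dyadic systems -/

/-- The label of a dyadic cube in `ℝ^d`: the cube has side length `2 ^ (-scale)`, and its lower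
corner is the (possibly shifted) lattice point with index `corner`. -/
structure DyadicCube (d : ℕ) where
  scale : ℤ
  corner : Fin d → ℤ

/-- A parameter `ω ∈ ({0,1}^d)^ℤ` of a translated dyadic system; `ω = 0` gives the standard one. -/
abbrev Shift (d : ℕ) : Type := ℤ → Fin d → Fin 2

variable {d : ℕ}

/-- The translation `∑_{j : 2^{-j} < 2^{-k}} 2^{-j} ω_j` of the cubes of side length `2^{-k}`. -/
def Shift.offset (ω : Shift d) (k : ℤ) (i : Fin d) : ℝ :=
  ∑' j : ℕ, (2 : ℝ) ^ (-(k + 1 + (j : ℤ))) * ((ω (k + 1 + (j : ℤ)) i).val : ℝ)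

/-- The half-open cube `2^{-k} (m + [0,1)^d) + ∑_{j : 2^{-j} < 2^{-k}} 2^{-j} ω_j` of the dyadic
system `𝒟^ω`, where `k` is the scale and `m` the corner of the label `Q`. -/
def cube (ω : Shift d) (Q : DyadicCube d) : Set (Fin d → ℝ) :=
  {x | ∀ i, (2 : ℝ) ^ (-Q.scale) * (Q.corner i : ℝ) + ω.offset Q.scale i ≤ x i ∧
    x i < (2 : ℝ) ^ (-Q.scale) * ((Q.corner i : ℝ) + 1) + ω.offset Q.scale i}

/-- The `2^d` dyadic children of `Q`, labelled by `η ∈ {0,1}^d`. As the offset at scale `k` exceeds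
the one at scale `k + 1` by `2^{-(k+1)} ω_{k+1}`, these are the cubes of `𝒟^ω` of half the side
length of `Q` that are contained in `Q`. -/
def child (ω : Shift d) (Q : DyadicCube d) (η : Fin d → Fin 2) : DyadicCube d where
  scale := Q.scale + 1
  corner := fun i => 2 * Q.corner i + ((ω (Q.scale + 1) i).val : ℤ) + ((η i).val : ℤ)

section Operators

variable {F : Type*} [NormedAddCommGroup F] [NormedSpace ℝ F]

/-- The average `⟨f⟩_Q = |Q|⁻¹ ∫_Q f dx`. -/
def avg (ω : Shift d) (Q : DyadicCube d) (f : (Fin d → ℝ) → F) : F :=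
  ⨍ x in cube ω Q, f x

/-- The Haar projection `D_Q f = ∑_{Q' ∈ child(Q)} ⟨f⟩_{Q'} 1_{Q'} - ⟨f⟩_Q 1_Q`. -/
def haarProj (ω : Shift d) (Q : DyadicCube d) (f : (Fin d → ℝ) → F) (x : Fin d → ℝ) : F :=
  (∑ η : Fin d → Fin 2, (cube ω (child ω Q η)).indicator (fun _ => avg ω (child ω Q η) f) x)
    - (cube ω Q).indicator (fun _ => avg ω Q f) x

/-- The norm `‖b‖_{BMO_p} = sup_{Q ∈ 𝒟^ω} (|Q|⁻¹ ∫_Q |b(x) - ⟨b⟩_Q|^p dx)^{1/p}`. -/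
def bmoNorm (ω : Shift d) (p : ℝ) (b : (Fin d → ℝ) → F) : ℝ≥0∞ :=
  ⨆ Q : DyadicCube d, ((volume (cube ω Q))⁻¹ * ∫⁻ x in cube ω Q, ‖b x - avg ω Q b‖ₑ ^ p) ^ (1 / p)

/-- The space `BMO_p(ℝ^d; F)`: locally (Bochner) integrable functions with finite `BMO_p`-norm. -/
def MemBMO (ω : Shift d) (p : ℝ) (b : (Fin d → ℝ) → F) : Prop :=
  LocallyIntegrable b volume ∧ bmoNorm ω p b < ⊤

end Operators

variable {E : Type*} [NormedAddCommGroup E] [NormedSpace ℝ E]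

/-- The term `D_Q b ⟨f⟩_Q` of the paraproduct, for an operator-valued function `b` with values in a
subspace `𝒯` of `ℒ(E)`. -/
def paraproductTerm (ω : Shift d) {𝒯 : Submodule ℝ (E →L[ℝ] E)} (b : (Fin d → ℝ) → 𝒯)
    (f : (Fin d → ℝ) → E) (Q : DyadicCube d) (x : Fin d → ℝ) : E :=
  ((haarProj ω Q b x : 𝒯) : E →L[ℝ] E) (avg ω Q f)

/-- `g = Π_b f = ∑_{Q ∈ 𝒟^ω} D_Q b ⟨f⟩_Q` in `L^p(ℝ^d; E)`: the function `g` is in `L^p`, and the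
finite partial sums of the series over all dyadic cubes converge to `g` unconditionally in `L^p`
(along the net of all finite sets of cubes). -/
def IsParaproduct (ω : Shift d) (p : ℝ) {𝒯 : Submodule ℝ (E →L[ℝ] E)} (b : (Fin d → ℝ) → 𝒯)
    (f g : (Fin d → ℝ) → E) : Prop :=
  MemLp g (ENNReal.ofReal p) volume ∧
    Tendsto (fun s : Finset (DyadicCube d) =>
      eLpNorm ((∑ Q ∈ s, paraproductTerm ω b f Q) - g) (ENNReal.ofReal p) volume) atTop (𝓝 0)

end DyadicParaproduct

end

set_option linter.unusedSectionVars false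

/-! The estimate is proved for martingales on a finite tree and then summed over cubes. The
descendants of a cube `R`, `n` generations deep, correspond to prefixes of words `Fin n → Fin d →
Fin 2` with the uniform distribution. Averages over cubes become conditional averages `condAvg k`,
Haar projections become martingale differences, and a finite set of cubes becomes a predictable 0-1
multiplier. `sum_norm_paraproduct_le` is the estimate on the tree; its constant depends neither on
`n` nor on the multiplier.

On the tree a new stopping time (`lastStop`) occurs whenever the average of `‖f‖` more than doubles
since the last one. Between the stop `j` and the next one, the averages of `f` are those of a
function `stopped` that is bounded by `2 * 2 ^ d` times the average of `‖f‖` at time `j`. In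
`sum_norm_paraproduct_stop_le` the differences are decoupled (one UMD constant of `E`), after which
a Stein-type inequality replaces the averages of `f` by that function itself (a second one). As it
no longer depends on the summation index, it leaves the sum and is bounded pointwise. Undoing the
decoupling for `b` alone costs the UMD constant of `𝒯`, and the BMO condition finishes this part.

The parts are summed by an `L^p` Pythagoras inequality (`sum_rpow_sum_le`, giving `3 ^ (p - 1) * p ^
p`) and by the Carleson embedding (`carleson_embedding`, giving `2 * p' ^ p`). Together with `2 * 2
^ d` this stays below `6 * 2 ^ d * p * p'` to the power `p`.

This bounds all finite partial sums uniformly. For convergence, step functions are dense, so it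
suffices to treat the indicator of a cube `R` times a vector `v`. On cubes not larger than `R` its
paraproduct is the Haar expansion of an `L^p`-function, whose tails are small by UMD and density
(`smallTails_haarProj`). On larger cubes the terms decay geometrically
(`smallTails_bilinTerm_coarse`). -/

namespace DyadicParaproduct

/-! ### Martingale differences on finite probability spaces -/

/-- `g` is constant along the relation `r`. -/
def Sat {Ω X : Type*} (r : Ω → Ω → Prop) (g : Ω → X) : Prop := ∀ w w', r w w' → g w = g w'

/-- The σ-algebra of sets that are invariant under the relation `r`. -/
@[reducible] def satSpace {Ω : Type*} (r : Ω → Ω → Prop) : MeasurableSpace Ω where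
  MeasurableSet' s := ∀ w w', r w w' → (w ∈ s ↔ w' ∈ s)
  measurableSet_empty := by simp
  measurableSet_compl s hs w w' h := by simp [hs w w' h]
  measurableSet_iUnion s hs w w' h := by
    simp only [Set.mem_iUnion]
    exact exists_congr fun i => hs i w w' h

theorem measurableSet_satSpace {Ω : Type*} {r : Ω → Ω → Prop} {s : Set Ω} :
    MeasurableSet[satSpace r] s ↔ ∀ w w', r w w' → (w ∈ s ↔ w' ∈ s) := Iff.rfl

/-- Martingale differences on a finite set with the uniform distribution, with respect to the
filtration in which the `k`-th σ-algebra consists of the sets that are invariant under `r k`. -/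
structure IsMartingaleDiff {Ω F : Type*} [Fintype Ω] [AddCommGroup F] [Module ℝ F]
    (r : ℕ → Ω → Ω → Prop) (δ : ℕ → Ω → F) : Prop where
  mono : ∀ k w w', r (k + 1) w w' → r k w w'
  adapted : ∀ k, Sat (r (k + 1)) (δ k)
  orth : ∀ k (φ : Ω → ℝ), Sat (r k) φ → ∑ w, φ w • δ k w = 0

theorem Sat.stronglyMeasurable {Ω F : Type*} [Finite Ω] [TopologicalSpace F] {r : Ω → Ω → Prop}
    {g : Ω → F} (hg : Sat r g) : StronglyMeasurable[satSpace r] g := by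
  let _ : MeasurableSpace Ω := satSpace r
  exact SimpleFunc.stronglyMeasurable
    { toFun := g
      measurableSet_fiber' := fun x w w' h => by simp [hg w w' h]
      finite_range' := Set.finite_range g }

theorem integral_smul_count {Ω F : Type*} [Fintype Ω] [MeasurableSpace Ω]
    [MeasurableSingletonClass Ω] [NormedAddCommGroup F] [NormedSpace ℝ F] [CompleteSpace F]
    (c : ℝ≥0∞) (g : Ω → F) :
    ∫ w, g w ∂(c • Measure.count) = c.toReal • ∑ w, g w := by
  rw [integral_smul_measure, integral_count]

theorem eLpNorm_smul_count {Ω F : Type*} [Fintype Ω] [MeasurableSpace Ω]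
    [MeasurableSingletonClass Ω] [NormedAddCommGroup F] {p : ℝ} (hp : 0 < p)
    (c : ℝ≥0∞) (g : Ω → F) :
    eLpNorm g (ENNReal.ofReal p) (c • Measure.count)
      = (c * ENNReal.ofReal (∑ w, ‖g w‖ ^ p)) ^ (1 / p) := by
  rw [eLpNorm_eq_lintegral_rpow_enorm_toReal (by simpa using hp) (by simp),
    ENNReal.toReal_ofReal hp.le, lintegral_smul_measure, lintegral_count, tsum_fintype,
    ENNReal.ofReal_sum_of_nonneg (fun _ _ => by positivity)]
  simp only [smul_eq_mul]
  congr 2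
  refine Finset.sum_congr rfl fun w _ => ?_
  rw [← ENNReal.ofReal_rpow_of_nonneg (norm_nonneg _) hp.le, ofReal_norm]

/-- With the uniform distribution every function on `Ω` is integrable, so the UMD inequality
compares finite sums, from which the normalising factor `c` cancels. -/
theorem IsUMDBound.sum_le {F : Type*} [NormedAddCommGroup F] [NormedSpace ℝ F] [CompleteSpace F]
    {p : ℝ} (hp : 0 < p) {C : ℝ} (hC : 0 ≤ C) (hF : IsUMDBound p F (ENNReal.ofReal C))
    {Ω : Type} [Fintype Ω] {r : ℕ → Ω → Ω → Prop} {δ : ℕ → Ω → F} (h : IsMartingaleDiff r δ)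
    (N : ℕ) (ε : ℕ → ℝ) (hε : ∀ n, ε n = 1 ∨ ε n = -1) :
    ∑ w, ‖∑ k ∈ Finset.range N, ε k • δ k w‖ ^ p
      ≤ C ^ p * ∑ w, ‖∑ k ∈ Finset.range N, δ k w‖ ^ p := by
  classical
  cases isEmpty_or_nonempty Ω
  · simp
  let m : MeasurableSpace Ω := ⊤
  have : DiscreteMeasurableSpace Ω := ⟨fun _ => trivial⟩
  set c : ℝ≥0∞ := (Fintype.card Ω : ℝ≥0∞)⁻¹ with hc
  have hcard : (Fintype.card Ω : ℝ≥0∞) ≠ 0 := by simp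
  have hc0 : c ≠ 0 := by simp [hc]
  have hct : c ≠ ⊤ := by simp [hc]
  let μ : Measure Ω := c • Measure.count
  have hμ : IsProbabilityMeasure μ := ⟨by
    simp only [μ, Measure.smul_apply, Measure.count_univ, smul_eq_mul, hc]
    rw [ENat.card_eq_coe_fintype_card]
    simpa using ENNReal.inv_mul_cancel hcard (by simp)⟩
  let ℱ : Filtration ℕ m :=
    -- The partial sum at time `n` contains `δ n`, which is measurable only for `r (n + 1)`; hence
    -- the shift.
    { seq := fun n => satSpace (r (n + 1))
      mono' := monotone_nat_of_le_succ fun n s hs w w' hw => hs w w' (h.mono _ _ _ hw)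
      le' := fun n => le_top }
  have hmono : ∀ k l, k ≤ l → ∀ w w', r l w w' → r k w w' := fun k l hkl => by
    induction hkl with
    | refl => exact fun _ _ h => h
    | step _ ih => exact fun w w' hw => ih w w' (h.mono _ _ _ hw)
  have key := hF Ω m μ hμ ℱ δ ?_ ?_ N ε hε
  · rw [eLpNorm_smul_count hp, eLpNorm_smul_count hp] at key
    have key2 := ENNReal.rpow_le_rpow key hp.le
    rw [ENNReal.mul_rpow_of_nonneg _ _ hp.le, ← ENNReal.rpow_mul, ← ENNReal.rpow_mul,
      one_div_mul_cancel hp.ne', ENNReal.rpow_one, ENNReal.rpow_one, mul_left_comm,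
      ENNReal.mul_le_mul_iff_right hc0 hct, ENNReal.ofReal_rpow_of_nonneg hC hp.le,
      ← ENNReal.ofReal_mul (by positivity), ENNReal.ofReal_le_ofReal_iff (by positivity)] at key2
    simpa [Finset.sum_apply] using key2
  · refine martingale_of_setIntegral_eq_succ (fun n => ?_) (fun n => Integrable.of_finite) ?_
    · have : Sat (r (n + 1)) (∑ k ∈ Finset.range (n + 1), δ k) := fun w w' hw => by
        simp only [Finset.sum_apply]
        refine Finset.sum_congr rfl fun k hk => h.adapted k w w' (hmono _ _ ?_ w w' hw)
        simp at hk; omega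
      exact this.stronglyMeasurable
    · intro n s hs
      have hs' := measurableSet_satSpace.1 hs
      have h0 := h.orth (n + 1) (s.indicator 1) (fun w w' hw => by
        by_cases hw1 : w ∈ s
        · simp [hw1, (hs' w w' hw).1 hw1]
        · simp [hw1, mt (hs' w w' hw).2 hw1])
      rw [← integral_indicator (MeasurableSet.of_discrete), ← integral_indicator
        (MeasurableSet.of_discrete), integral_smul_count, integral_smul_count]
      congr 1
      rw [eq_comm, ← sub_eq_zero, ← Finset.sum_sub_distrib, ← h0]
      refine Finset.sum_congr rfl fun w _ => ?_
      by_cases hw1 : w ∈ s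
      · simp [hw1, Finset.sum_range_succ _ (n + 1)]
      · simp [hw1]
  · intro n
    exact MemLp.of_discrete

/-! ### Refined filtrations and predictable multipliers -/

/-- Alternation of two sequences. -/
def interleave {X : Type*} (a b : ℕ → X) (m : ℕ) : X := if m % 2 = 0 then a (m / 2) else b (m / 2)

@[simp] theorem interleave_two_mul {X : Type*} (a b : ℕ → X) (k : ℕ) :
    interleave a b (2 * k) = a k := by simp [interleave]

@[simp] theorem interleave_two_mul_add_one {X : Type*} (a b : ℕ → X) (k : ℕ) :
    interleave a b (2 * k + 1) = b k := by
  have : (2 * k + 1) / 2 = k := by omega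
  simp [interleave, Nat.add_mod, this]

@[simp] theorem interleave_two_mul_add_two {X : Type*} (a b : ℕ → X) (k : ℕ) :
    interleave a b (2 * k + 1 + 1) = a (k + 1) := interleave_two_mul a b (k + 1)

theorem forall_interleave {P : ℕ → Prop} (h0 : ∀ k, P (2 * k)) (h1 : ∀ k, P (2 * k + 1)) (m : ℕ) :
    P m := by
  obtain ⟨k, rfl | rfl⟩ := Nat.even_or_odd' m
  exacts [h0 k, h1 k]

theorem sum_range_two_mul {X : Type*} [AddCommMonoid X] (c : ℕ → X) (N : ℕ) :
    ∑ m ∈ Finset.range (2 * N), c m = ∑ k ∈ Finset.range N, (c (2 * k) + c (2 * k + 1)) := by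
  induction N with
  | zero => simp
  | succ N ih => rw [Nat.mul_succ, Finset.sum_range_succ, Finset.sum_range_succ, ih,
      Finset.sum_range_succ, add_assoc]

/-- Martingale differences `δ 0, δ' 0, δ 1, δ' 1, …` in which the σ-algebras are alternatingly
given by `r` and `r'`. -/
structure IsMartingaleDiffPair {Ω F : Type*} [Fintype Ω] [AddCommGroup F] [Module ℝ F]
    (r r' : ℕ → Ω → Ω → Prop) (δ δ' : ℕ → Ω → F) : Prop where
  mono : ∀ k w w', r' k w w' → r k w w'
  mono' : ∀ k w w', r (k + 1) w w' → r' k w w'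
  adapted : ∀ k, Sat (r' k) (δ k)
  adapted' : ∀ k, Sat (r (k + 1)) (δ' k)
  orth : ∀ k (φ : Ω → ℝ), Sat (r k) φ → ∑ w, φ w • δ k w = 0
  orth' : ∀ k (φ : Ω → ℝ), Sat (r' k) φ → ∑ w, φ w • δ' k w = 0

theorem IsMartingaleDiffPair.interleave {Ω F : Type*} [Fintype Ω] [AddCommGroup F] [Module ℝ F]
    {r r' : ℕ → Ω → Ω → Prop} {δ δ' : ℕ → Ω → F} (h : IsMartingaleDiffPair r r' δ δ') :
    IsMartingaleDiff (interleave r r') (interleave δ δ') where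
  mono := forall_interleave (by simpa using h.mono) (by simpa using h.mono')
  adapted := forall_interleave (by simpa using h.adapted) (by simpa using h.adapted')
  orth := forall_interleave (by simpa using h.orth) (by simpa using h.orth')

theorem norm_half_smul_add_rpow_le {F : Type*} [SeminormedAddCommGroup F] [NormedSpace ℝ F] {p : ℝ}
    (hp : 1 ≤ p) (x y : F) : ‖(1 / 2 : ℝ) • (x + y)‖ ^ p ≤ (1 / 2) * (‖x‖ ^ p + ‖y‖ ^ p) := by
  have h1 : ‖(1 / 2 : ℝ) • (x + y)‖ ≤ (1 / 2) * ‖x‖ + (1 / 2) * ‖y‖ := by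
    rw [norm_smul, Real.norm_of_nonneg (by norm_num), ← mul_add]
    gcongr
    exact norm_add_le x y
  have h2 := (convexOn_rpow hp).2 (Set.mem_Ici.2 (norm_nonneg x)) (Set.mem_Ici.2 (norm_nonneg y))
    (show (0 : ℝ) ≤ 1 / 2 by norm_num) (show (0 : ℝ) ≤ 1 / 2 by norm_num) (by norm_num)
  simp only [smul_eq_mul] at h2
  calc _ ≤ ((1 / 2) * ‖x‖ + (1 / 2) * ‖y‖) ^ p := by gcongr
    _ ≤ _ := by rw [mul_add]; exact h2

section Predictable

variable {F : Type*} [NormedAddCommGroup F] [NormedSpace ℝ F] [CompleteSpace F]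
    {p : ℝ} {C : ℝ} {Ω : Type} [Fintype Ω]

/-- The UMD inequality on a finite set, for predictable signs. -/
theorem IsUMDBound.sum_le_of_sign (hp : 0 < p) (hC : 0 ≤ C)
    (hF : IsUMDBound p F (ENNReal.ofReal C))
    {r : ℕ → Ω → Ω → Prop} {δ : ℕ → Ω → F} (h : IsMartingaleDiff r δ)
    (N : ℕ) (ε : ℕ → Ω → ℝ) (hε : ∀ n w, ε n w = 1 ∨ ε n w = -1) (hε' : ∀ n, Sat (r n) (ε n)) :
    ∑ w, ‖∑ k ∈ Finset.range N, ε k w • δ k w‖ ^ p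
      ≤ C ^ p * ∑ w, ‖∑ k ∈ Finset.range N, δ k w‖ ^ p := by
  classical
  -- Step `k` is split in two: the difference is revealed first where the sign is `1`, then where it
  -- is `-1`. Along this finer filtration the signs alternate deterministically, so no constant is
  -- lost.
  let a : ℕ → Ω → F := fun k w => if ε k w = 1 then δ k w else 0
  let a' : ℕ → Ω → F := fun k w => if ε k w = 1 then 0 else δ k w
  let r' : ℕ → Ω → Ω → Prop := fun k w w' => r k w w' ∧ (ε k w = 1 → r (k + 1) w w')
  have hpair : IsMartingaleDiffPair r r' a a' := by
    refine ⟨fun k w w' hw => hw.1, fun k w w' hw => ⟨h.mono _ _ _ hw, fun _ => hw⟩,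
      fun k w w' hw => ?_, fun k w w' hw => ?_, fun k φ hφ => ?_, fun k φ hφ => ?_⟩
    · simp only [a, ← hε' k w w' hw.1]
      split_ifs with h1
      · exact h.adapted k w w' (hw.2 h1)
      · rfl
    · simp only [a', ← hε' k w w' (h.mono _ _ _ hw), h.adapted k w w' hw]
    · rw [← h.orth k (fun w => if ε k w = 1 then φ w else 0) (fun w w' hw => by
        simp only [← hε' k w w' hw, hφ w w' hw])]
      refine Finset.sum_congr rfl fun w _ => ?_
      simp only [a]; split_ifs <;> simp
    · rw [← h.orth k (fun w => if ε k w = 1 then 0 else φ w) (fun w w' hw => by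
        simp only [← hε' k w w' hw]
        split_ifs with h1
        · rfl
        · exact hφ w w' ⟨hw, fun h2 => absurd h2 h1⟩)]
      refine Finset.sum_congr rfl fun w _ => ?_
      simp only [a']; split_ifs <;> simp
  have key := hF.sum_le hp hC hpair.interleave (2 * N) (interleave (fun _ => 1) (fun _ => -1))
    (forall_interleave (by simp) (by simp))
  simp only [sum_range_two_mul, interleave_two_mul, interleave_two_mul_add_one] at key
  convert key using 6 with w _ k _ w _ k _
  · rcases hε k w with h1 | h1
    · simp [a, a', h1]
    · simp [a, a', h1, show ¬ ((-1 : ℝ) = 1) by norm_num]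
  · simp only [a, a']; split_ifs <;> simp

/-- The UMD inequality on a finite set, for predictable multipliers in `{-1, 0, 1}`. -/
theorem IsUMDBound.sum_le_of_predictable (hp : 1 ≤ p) (hC : 0 ≤ C)
    (hF : IsUMDBound p F (ENNReal.ofReal C))
    {r : ℕ → Ω → Ω → Prop} {δ : ℕ → Ω → F} (h : IsMartingaleDiff r δ)
    (N : ℕ) (v : ℕ → Ω → ℝ) (hv : ∀ n w, v n w = 1 ∨ v n w = 0 ∨ v n w = -1)
    (hv' : ∀ n, Sat (r n) (v n)) :
    ∑ w, ‖∑ k ∈ Finset.range N, v k w • δ k w‖ ^ p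
      ≤ C ^ p * ∑ w, ‖∑ k ∈ Finset.range N, δ k w‖ ^ p := by
  classical
  -- A vanishing multiplier is the mean of the signs `1` and `-1`; convexity of the `p`-th power
  -- keeps the constant `C`.
  have key : ∀ s : ℝ, (s = 1 ∨ s = -1) →
      ∑ w, ‖∑ k ∈ Finset.range N, (if v k w = 0 then s else v k w) • δ k w‖ ^ p
      ≤ C ^ p * ∑ w, ‖∑ k ∈ Finset.range N, δ k w‖ ^ p := fun s hs =>
    hF.sum_le_of_sign (by linarith) hC h N (fun k w => if v k w = 0 then s else v k w)
      (fun k w => by rcases hv k w with h1 | h1 | h1 <;> simp [h1, hs])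
      (fun k w w' hw => by simp [hv' k w w' hw])
  calc _ ≤ ∑ w, (1 / 2) * (‖∑ k ∈ Finset.range N, (if v k w = 0 then 1 else v k w) • δ k w‖ ^ p
        + ‖∑ k ∈ Finset.range N, (if v k w = 0 then -1 else v k w) • δ k w‖ ^ p) := by
        refine Finset.sum_le_sum fun w _ => ?_
        refine le_trans (le_of_eq ?_) (norm_half_smul_add_rpow_le hp _ _)
        rw [← Finset.sum_add_distrib, Finset.smul_sum]
        congr 2
        refine Finset.sum_congr rfl fun k _ => ?_
        rw [← add_smul, smul_smul]
        congr 1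
        rcases hv k w with h1 | h1 | h1 <;> simp [h1] <;> norm_num
    _ ≤ _ := by
        rw [← Finset.mul_sum, Finset.sum_add_distrib]
        have h1 := key 1 (by simp)
        have h2 := key (-1) (by simp)
        linarith

theorem IsUMDBound.sum_pair_le (hp : 1 ≤ p) (hC : 0 ≤ C)
    (hF : IsUMDBound p F (ENNReal.ofReal C))
    {r r' : ℕ → Ω → Ω → Prop} {δ δ' : ℕ → Ω → F} (h : IsMartingaleDiffPair r r' δ δ')
    (N : ℕ) (v v' : ℕ → Ω → ℝ) (hv : ∀ n w, v n w = 1 ∨ v n w = 0 ∨ v n w = -1)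
    (hv' : ∀ n w, v' n w = 1 ∨ v' n w = 0 ∨ v' n w = -1)
    (hvr : ∀ n, Sat (r n) (v n)) (hvr' : ∀ n, Sat (r' n) (v' n)) :
    ∑ w, ‖∑ k ∈ Finset.range N, (v k w • δ k w + v' k w • δ' k w)‖ ^ p
      ≤ C ^ p * ∑ w, ‖∑ k ∈ Finset.range N, (δ k w + δ' k w)‖ ^ p := by
  have key := hF.sum_le_of_predictable hp hC h.interleave (2 * N) (interleave v v')
    (forall_interleave (by simpa using hv) (by simpa using hv'))
    (forall_interleave (by simpa using hvr) (by simpa using hvr'))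
  simpa only [sum_range_two_mul, interleave_two_mul, interleave_two_mul_add_one] using key

end Predictable

/-! ### The least UMD constant -/

/-- The infimum is attained: a finite nonzero norm on the right can be divided out, and if that norm
is zero, any admissible constant makes the left side vanish. -/
theorem IsUMD.isUMDBound_umdConst {F : Type*} [NormedAddCommGroup F] [NormedSpace ℝ F] {p : ℝ}
    (h : IsUMD p F) : IsUMDBound p F (umdConst p F) := by
  intro Ω m μ hμ ℱ δ hδ hmem N ε hε
  have hfin : eLpNorm (∑ n ∈ Finset.range N, δ n) (ENNReal.ofReal p) μ ≠ ⊤ :=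
    (memLp_finsetSum' _ fun n _ => hmem n).2.ne
  by_cases h0 : eLpNorm (∑ n ∈ Finset.range N, δ n) (ENNReal.ofReal p) μ = 0
  · obtain ⟨C, -, hC⟩ := h
    simpa [h0] using hC Ω m μ hμ ℱ δ hδ hmem N ε hε
  · rw [← ENNReal.div_le_iff_le_mul (Or.inl h0) (Or.inl hfin)]
    refine le_sInf fun C hC => ?_
    rw [ENNReal.div_le_iff_le_mul (Or.inl h0) (Or.inl hfin)]
    exact hC Ω m μ hμ ℱ δ hδ hmem N ε hε

theorem IsUMD.umdConst_ne_top {F : Type*} [NormedAddCommGroup F] [NormedSpace ℝ F] {p : ℝ}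
    (h : IsUMD p F) : umdConst p F ≠ ⊤ := by
  obtain ⟨C, hC, hC'⟩ := h
  exact ne_top_of_le_ne_top hC (sInf_le hC')

theorem IsUMD.isUMDBound_toReal {F : Type*} [NormedAddCommGroup F] [NormedSpace ℝ F] {p : ℝ}
    (h : IsUMD p F) : IsUMDBound p F (ENNReal.ofReal (umdConst p F).toReal) := by
  rw [ENNReal.ofReal_toReal h.umdConst_ne_top]
  exact h.isUMDBound_umdConst

/-! ### Averages on finite product sets -/

section Mix

variable {n : ℕ} {α : Type*}

/-- The point with the first `k` coordinates of `x` and the remaining coordinates of `z`. -/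
def mix (k : ℕ) (x z : Fin n → α) : Fin n → α := fun i => if (i : ℕ) < k then x i else z i

/-- `x` and `x'` agree in the first `k` coordinates. -/
def Agree (k : ℕ) (x x' : Fin n → α) : Prop := ∀ i : Fin n, (i : ℕ) < k → x i = x' i

theorem Agree.mono {k l : ℕ} (hkl : k ≤ l) {x x' : Fin n → α} (h : Agree l x x') : Agree k x x' :=
  fun i hi => h i (hi.trans_le hkl)

theorem agree_mix (k : ℕ) (x z : Fin n → α) : Agree k (mix k x z) x := fun i hi => by
  simp [mix, hi]

theorem mix_eq_of_agree {k : ℕ} {x x' : Fin n → α} (h : Agree k x x') (z : Fin n → α) :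
    mix k x z = mix k x' z := by
  funext i
  by_cases hi : (i : ℕ) < k
  · simp [mix, hi, h i hi]
  · simp [mix, hi]

theorem mix_mix {k l : ℕ} (h : k ≤ l) (x z z' : Fin n → α) :
    mix l (mix k x z) z' = mix k x (mix l z z') := by
  funext i
  by_cases hi : (i : ℕ) < k
  · simp [mix, hi, hi.trans_le h]
  · simp [mix, hi]

theorem Sat.mono {k l : ℕ} (hkl : k ≤ l) {X : Type*} {g : (Fin n → α) → X}
    (h : Sat (Agree k) g) : Sat (Agree l) g := fun w w' hw => h w w' (hw.mono hkl)

theorem Sat.mix {k l : ℕ} (hkl : k ≤ l) {X : Type*} {g : (Fin n → α) → X} (h : Sat (Agree k) g)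
    (x z : Fin n → α) : g (mix l x z) = g x := h _ _ ((agree_mix l x z).mono hkl)

theorem sat_agree_of_le {X : Type*} {k : ℕ} (h : n ≤ k) (g : (Fin n → α) → X) :
    Sat (Agree k) g := fun w w' hw => by
  rw [show w = w' from funext fun i => hw i (i.2.trans_le h)]

/-- Exchanging tails, `(x, z) ↦ (mix k x z, mix k z x)`, is an involution of the product, so `mix k
x z` is again uniformly distributed. -/
theorem sum_mix [Fintype α] {F : Type*} [AddCommMonoid F] (k : ℕ) (h : (Fin n → α) → F) :
    ∑ x, ∑ z, h (mix k x z) = Fintype.card (Fin n → α) • ∑ x, h x := by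
  have e : Function.Involutive (fun w : (Fin n → α) × (Fin n → α) =>
      (mix k w.1 w.2, mix k w.2 w.1)) := fun w => by
    ext i <;> by_cases hi : (i : ℕ) < k <;> simp [mix, hi]
  rw [← Fintype.sum_prod_type', e.bijective.sum_comp
    (fun w : (Fin n → α) × (Fin n → α) => h w.1), Fintype.sum_prod_type, Finset.smul_sum]
  simp

end Mix

section CondAvg

variable {n : ℕ} {α : Type*} [Fintype α] [Nonempty α]

/-- The average of `g` over all points with the same first `k` coordinates as `x`. -/
noncomputable def condAvg {F : Type*} [AddCommGroup F] [Module ℝ F] (k : ℕ) (g : (Fin n → α) → F)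
    (x : Fin n → α) : F :=
  (Fintype.card (Fin n → α) : ℝ)⁻¹ • ∑ z, g (mix k x z)

variable {F : Type*} [AddCommGroup F] [Module ℝ F]

theorem sat_condAvg (k : ℕ) (g : (Fin n → α) → F) : Sat (Agree k) (condAvg k g) :=
  fun w w' h => by simp only [condAvg, mix_eq_of_agree h]

theorem inv_card_smul_sum_const (v : F) :
    (Fintype.card (Fin n → α) : ℝ)⁻¹ • ∑ _z : Fin n → α, v = v := by
  rw [Finset.sum_const, Finset.card_univ, ← Nat.cast_smul_eq_nsmul ℝ, inv_smul_smul₀ (by simp)]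

theorem Sat.condAvg_eq {k l : ℕ} (hkl : k ≤ l) {g : (Fin n → α) → F} (h : Sat (Agree k) g)
    (x : Fin n → α) : condAvg l g x = g x := by
  simp only [condAvg, h.mix hkl, inv_card_smul_sum_const]

theorem condAvg_of_le {k : ℕ} (h : n ≤ k) (g : (Fin n → α) → F) (x : Fin n → α) :
    condAvg k g x = g x := (sat_agree_of_le h g).condAvg_eq le_rfl x

theorem condAvg_sub (k : ℕ) (g g' : (Fin n → α) → F) (x : Fin n → α) :
    condAvg k (fun z => g z - g' z) x = condAvg k g x - condAvg k g' x := by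
  simp [condAvg, smul_sub]

theorem condAvg_add (k : ℕ) (g g' : (Fin n → α) → F) (x : Fin n → α) :
    condAvg k (fun z => g z + g' z) x = condAvg k g x + condAvg k g' x := by
  simp [condAvg, smul_add, Finset.sum_add_distrib]

theorem condAvg_linear {G : Type*} [AddCommGroup G] [Module ℝ G] {k : ℕ}
    {L : (Fin n → α) → F →ₗ[ℝ] G} (hL : Sat (Agree k) L) (g : (Fin n → α) → F) (x : Fin n → α) :
    condAvg k (fun z => L z (g z)) x = L x (condAvg k g x) := by
  simp only [condAvg, hL.mix le_rfl, map_smul, map_sum]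

theorem condAvg_smul {k : ℕ} {φ : (Fin n → α) → ℝ} (hφ : Sat (Agree k) φ)
    (g : (Fin n → α) → F) (x : Fin n → α) :
    condAvg k (fun z => φ z • g z) x = φ x • condAvg k g x :=
  condAvg_linear (L := fun z => φ z • LinearMap.id) (fun w w' h => by simp [hφ w w' h]) g x

theorem sum_condAvg (k : ℕ) (g : (Fin n → α) → F) : ∑ x, condAvg k g x = ∑ x, g x := by
  simp only [condAvg]
  rw [← Finset.smul_sum, sum_mix, ← Nat.cast_smul_eq_nsmul ℝ, inv_smul_smul₀ (by simp)]

theorem sum_smul_condAvg {k : ℕ} {φ : (Fin n → α) → ℝ} (hφ : Sat (Agree k) φ)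
    (g : (Fin n → α) → F) : ∑ x, φ x • condAvg k g x = ∑ x, φ x • g x := by
  rw [← sum_condAvg k (fun x => φ x • g x)]
  exact Finset.sum_congr rfl fun x _ => (condAvg_smul hφ g x).symm

theorem sum_mul_condAvg {k : ℕ} {φ : (Fin n → α) → ℝ} (hφ : Sat (Agree k) φ)
    (g : (Fin n → α) → ℝ) : ∑ x, φ x * condAvg k g x = ∑ x, φ x * g x :=
  sum_smul_condAvg hφ g

theorem condAvg_condAvg {k l : ℕ} (h : k ≤ l) (g : (Fin n → α) → F) (x : Fin n → α) :
    condAvg k (condAvg l g) x = condAvg k g x := by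
  have h1 := sum_mix l (fun z => g (mix k x z))
  simp only [← mix_mix h] at h1
  rw [condAvg]
  simp only [condAvg]
  rw [← Finset.smul_sum, h1, ← Nat.cast_smul_eq_nsmul ℝ, inv_smul_smul₀ (by simp)]

/-- The counterpart on the tree of the fact that the average over a cube is the mean of the averages
over its children. -/
theorem condAvg_eq_inv_card_smul_sum {k : ℕ} (hk : k < n) (g : (Fin n → α) → F)
    (x : Fin n → α) :
    condAvg k g x
      = (Fintype.card α : ℝ)⁻¹ • ∑ a, condAvg (k + 1) g (Function.update x ⟨k, hk⟩ a) := by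
  set H : α → F := fun a => condAvg (k + 1) g (Function.update x ⟨k, hk⟩ a) with hH
  have h1 : ∀ z, condAvg (k + 1) g (mix k x z) = H (z ⟨k, hk⟩) := fun z => by
    refine sat_condAvg _ _ _ _ fun i hi => ?_
    rcases Nat.lt_succ_iff_lt_or_eq.1 hi with h | h
    · have : i ≠ ⟨k, hk⟩ := fun h' => by simp [h'] at h
      simp [mix, h, this]
    · have : i = ⟨k, hk⟩ := Fin.ext h
      subst this
      simp [mix]
  -- Exchanging `a` with the `k`-th coordinate of `z` shows that a function of this coordinate has
  -- the same mean over `z` as over `a`.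
  have e : Function.Involutive (fun w : α × (Fin n → α) =>
      (w.2 ⟨k, hk⟩, Function.update w.2 ⟨k, hk⟩ w.1)) := fun w => by simp
  have h2 := e.bijective.sum_comp (fun w : α × (Fin n → α) => H w.1)
  simp only [Fintype.sum_prod_type, Finset.sum_const, Finset.card_univ,
    ← Nat.cast_smul_eq_nsmul ℝ, ← Finset.smul_sum] at h2
  rw [← condAvg_condAvg k.le_succ]
  rw [condAvg]
  simp only [Nat.succ_eq_add_one, h1]
  rw [inv_smul_eq_iff₀ (by simp), smul_comm, ← h2, inv_smul_smul₀ (by simp)]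

theorem condAvg_mono (k : ℕ) {g g' : (Fin n → α) → ℝ} (h : ∀ x, g x ≤ g' x) (x : Fin n → α) :
    condAvg k g x ≤ condAvg k g' x := by
  simp only [condAvg, smul_eq_mul]
  gcongr
  exact h _

theorem condAvg_const (k : ℕ) (v : F) (x : Fin n → α) : condAvg k (fun _ => v) x = v :=
  inv_card_smul_sum_const v

theorem condAvg_nonneg (k : ℕ) {g : (Fin n → α) → ℝ} (h : ∀ x, 0 ≤ g x) (x : Fin n → α) :
    0 ≤ condAvg k g x := by
  simpa only [condAvg_const] using condAvg_mono k h x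

theorem norm_condAvg_le {F : Type*} [SeminormedAddCommGroup F] [NormedSpace ℝ F] (k : ℕ)
    (g : (Fin n → α) → F) (x : Fin n → α) : ‖condAvg k g x‖ ≤ condAvg k (fun z => ‖g z‖) x := by
  simp only [condAvg, norm_smul, smul_eq_mul, norm_inv, RCLike.norm_natCast]
  gcongr
  exact norm_sum_le _ _

/-- One nonnegative term is at most the sum over all children. This doubling property limits the
overshoot at a stopping time. -/
theorem condAvg_succ_le (k : ℕ) {g : (Fin n → α) → ℝ} (h : ∀ x, 0 ≤ g x) (x : Fin n → α) :
    condAvg (k + 1) g x ≤ Fintype.card α * condAvg k g x := by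
  rcases lt_or_ge k n with hk | hk
  · rw [condAvg_eq_inv_card_smul_sum hk, smul_eq_mul, mul_inv_cancel_left₀ (by simp)]
    refine le_trans (le_of_eq ?_) (Finset.single_le_sum (fun a _ => condAvg_nonneg _ h _)
      (Finset.mem_univ (x ⟨k, hk⟩)))
    simp
  · rw [condAvg_of_le hk, condAvg_of_le (by omega)]
    have : (1 : ℝ) ≤ Fintype.card α := by exact_mod_cast Fintype.card_pos
    nlinarith [h x]

end CondAvg

/-! ### Decoupling -/

/-- Martingale differences on a finite product set with its coordinate filtration. -/
structure IsCoordDiff {n : ℕ} {α F : Type*} [Fintype α] [AddCommGroup F] [Module ℝ F]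
    (e : ℕ → (Fin n → α) → F) : Prop where
  sat : ∀ k, Sat (Agree (k + 1)) (e k)
  condAvg_eq_zero : ∀ k x, condAvg k (e k) x = 0

section Decoupling

variable {n : ℕ} {α : Type} [Fintype α]

theorem isCoordDiff_condAvg_succ_sub [Nonempty α] {F : Type*} [AddCommGroup F] [Module ℝ F]
    (g : (Fin n → α) → F) :
    IsCoordDiff fun k x => condAvg (k + 1) g x - condAvg k g x where
  sat k w w' h := by
    beta_reduce
    rw [sat_condAvg _ _ _ _ h, sat_condAvg _ _ _ _ (h.mono k.le_succ)]
  condAvg_eq_zero k x := by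
    rw [condAvg_sub, condAvg_condAvg k.le_succ, condAvg_condAvg le_rfl, sub_self]

/-- Predictable linear maps commute with the conditional average, so they preserve mean zero. They
occur as scalar multipliers and as evaluation at `condAvg k f x`. -/
theorem IsCoordDiff.linear [Nonempty α] {F G : Type*} [AddCommGroup F] [Module ℝ F]
    [AddCommGroup G] [Module ℝ G]
    {e : ℕ → (Fin n → α) → F} (he : IsCoordDiff e) {L : ℕ → (Fin n → α) → F →ₗ[ℝ] G}
    (hL : ∀ k, Sat (Agree k) (L k)) : IsCoordDiff fun k x => L k x (e k x) where
  sat k w w' h := by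
    beta_reduce
    rw [he.sat k w w' h, hL k w w' (h.mono k.le_succ)]
  condAvg_eq_zero k x := by
    rw [condAvg_linear (hL k), he.condAvg_eq_zero, map_zero]

theorem IsCoordDiff.smul [Nonempty α] {F : Type*} [AddCommGroup F] [Module ℝ F]
    {e : ℕ → (Fin n → α) → F} (he : IsCoordDiff e) {φ : ℕ → (Fin n → α) → ℝ}
    (hφ : ∀ k, Sat (Agree k) (φ k)) : IsCoordDiff fun k x => φ k x • e k x :=
  he.linear (L := fun k x => φ k x • LinearMap.id) fun k w w' h => by simp [hφ k w w' h]

theorem IsCoordDiff.orth [Nonempty α] {F : Type*} [AddCommGroup F] [Module ℝ F]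
    {e : ℕ → (Fin n → α) → F} (he : IsCoordDiff e) {k : ℕ} {φ : (Fin n → α) → ℝ}
    (hφ : Sat (Agree k) φ) : ∑ x, φ x • e k x = 0 := by
  rw [← sum_smul_condAvg hφ]
  simp [he.condAvg_eq_zero]

/-- Both components agree in the first `k` coordinates. -/
def Agree₂ (k : ℕ) (w w' : (Fin n → α) × (Fin n → α)) : Prop :=
  Agree k w.1 w'.1 ∧ Agree k w.2 w'.2

/-- Both components agree in the first `k` coordinates, and in the next one up to their order. -/
def AgreeSymm (k : ℕ) (w w' : (Fin n → α) × (Fin n → α)) : Prop :=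
  Agree₂ k w w' ∧ ∀ i : Fin n, (i : ℕ) = k →
    (w.1 i = w'.1 i ∧ w.2 i = w'.2 i) ∨ (w.1 i = w'.2 i ∧ w.2 i = w'.1 i)

/-- Exchange of the `k`-th coordinates of the two components. -/
def swapAt (k : ℕ) (w : (Fin n → α) × (Fin n → α)) : (Fin n → α) × (Fin n → α) :=
  (fun i => if (i : ℕ) = k then w.2 i else w.1 i, fun i => if (i : ℕ) = k then w.1 i else w.2 i)

theorem swapAt_involutive (k : ℕ) : Function.Involutive (swapAt (n := n) (α := α) k) := fun w => by
  ext i <;> by_cases hi : (i : ℕ) = k <;> simp [swapAt, hi]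

/-- `(swapAt k w).1` and `mix k w.1 w.2` agree in the coordinates up to the `k`-th, and `e` sees no
others. The swap thus exchanges a difference with its decoupled copy. -/
theorem Sat.apply_swapAt_fst {X : Type*} {k : ℕ} {e : (Fin n → α) → X} (he : Sat (Agree (k + 1)) e)
    (w : (Fin n → α) × (Fin n → α)) : e (swapAt k w).1 = e (DyadicParaproduct.mix k w.1 w.2) :=
  he _ _ fun i hi => by
    rcases Nat.lt_succ_iff_lt_or_eq.1 hi with h | h
    · simp [swapAt, DyadicParaproduct.mix, h, h.ne]
    · simp [swapAt, DyadicParaproduct.mix, h]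

theorem Sat.apply_mix_swapAt {X : Type*} {k : ℕ} {e : (Fin n → α) → X} (he : Sat (Agree (k + 1)) e)
    (w : (Fin n → α) × (Fin n → α)) :
    e (DyadicParaproduct.mix k (swapAt k w).1 (swapAt k w).2) = e w.1 := by
  rw [← he.apply_swapAt_fst, swapAt_involutive]

theorem agree₂_swapAt (k : ℕ) (w : (Fin n → α) × (Fin n → α)) : Agree₂ k (swapAt k w) w :=
  ⟨fun i hi => by simp [swapAt, hi.ne], fun i hi => by simp [swapAt, hi.ne]⟩

theorem agreeSymm_swapAt (k : ℕ) (w : (Fin n → α) × (Fin n → α)) : AgreeSymm k (swapAt k w) w :=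
  ⟨agree₂_swapAt k w, fun i hi => Or.inr (by simp [swapAt, hi])⟩

variable [Nonempty α] {F : Type*} [AddCommGroup F] [Module ℝ F] {e : ℕ → (Fin n → α) → F}

theorem IsCoordDiff.sum_fst_eq_zero (he : IsCoordDiff e) {k : ℕ}
    {φ : (Fin n → α) × (Fin n → α) → ℝ} (hφ : ∀ y, Sat (Agree k) fun x => φ (x, y)) :
    ∑ w, φ w • e k w.1 = 0 := by
  rw [Fintype.sum_prod_type_right]
  exact Finset.sum_eq_zero fun y _ => he.orth (hφ y)

theorem IsCoordDiff.sum_mix_eq_zero (he : IsCoordDiff e) {k : ℕ}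
    {φ : (Fin n → α) × (Fin n → α) → ℝ} (hφ : Sat (Agree₂ k) φ) :
    ∑ w : (Fin n → α) × (Fin n → α), φ w • e k (mix k w.1 w.2) = 0 := by
  rw [← he.sum_fst_eq_zero (k := k) (φ := φ) fun y w w' h => hφ _ _ ⟨h, fun _ _ => rfl⟩,
    ← (swapAt_involutive k).bijective.sum_comp]
  refine Finset.sum_congr rfl fun w _ => ?_
  rw [(he.sat k).apply_mix_swapAt, hφ _ _ (agree₂_swapAt k w)]

/-- The decomposition of a martingale difference sequence and its decoupled version into parts
that are even and odd under the exchange of the two. -/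
theorem IsCoordDiff.pair (he : IsCoordDiff e) (c : ℝ) :
    IsMartingaleDiffPair (Ω := (Fin n → α) × (Fin n → α)) Agree₂ AgreeSymm
      (fun k w => (1 / 2 : ℝ) • (e k w.1 + e k (mix k w.1 w.2)))
      (fun k w => c • (e k w.1 - e k (mix k w.1 w.2))) where
  mono k w w' h := h.1
  mono' k w w' h := ⟨⟨h.1.mono k.le_succ, h.2.mono k.le_succ⟩, fun i hi =>
    Or.inl ⟨h.1 i (by omega), h.2 i (by omega)⟩⟩
  adapted k w w' h := by
    have hm : ∀ w w' : (Fin n → α) × (Fin n → α), Agree₂ k w w' →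
        (∀ i : Fin n, (i : ℕ) = k → w.1 i = w'.1 i ∧ w.2 i = w'.2 i) →
        e k w.1 = e k w'.1 ∧ e k (mix k w.1 w.2) = e k (mix k w'.1 w'.2) := fun w w' h1 h2 => by
      refine ⟨he.sat k _ _ fun i hi => ?_, he.sat k _ _ fun i hi => ?_⟩
      · rcases Nat.lt_succ_iff_lt_or_eq.1 hi with h | h
        exacts [h1.1 i h, (h2 i h).1]
      · rcases Nat.lt_succ_iff_lt_or_eq.1 hi with h | h
        · simp [mix, h, h1.1 i h]
        · simp [mix, h, (h2 i h).2]
    -- If the `k`-th coordinates come in opposite order, swapping those of `w'` restores the order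
    -- and merely exchanges the two summands of the even part.
    by_cases h2 : ∀ i : Fin n, (i : ℕ) = k → w.1 i = w'.1 i ∧ w.2 i = w'.2 i
    · beta_reduce
      rw [(hm w w' h.1 h2).1, (hm w w' h.1 h2).2]
    · have h3 := hm w (swapAt k w')
        ⟨fun i hi => by simp [swapAt, hi.ne, h.1.1 i hi],
          fun i hi => by simp [swapAt, hi.ne, h.1.2 i hi]⟩
        (fun i hi => by
          rcases h.2 i hi with h4 | h4
          · refine absurd (fun j hj => ?_) h2
            rw [show j = i from Fin.ext (hj.trans hi.symm)]
            exact h4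
          · simpa [swapAt, hi] using h4)
      beta_reduce
      rw [h3.1, h3.2, (he.sat k).apply_mix_swapAt, (he.sat k).apply_swapAt_fst, add_comm]
  adapted' k w w' h := by
    beta_reduce
    rw [he.sat k _ _ h.1, he.sat k (mix k w.1 w.2) (mix k w'.1 w'.2) fun i hi => ?_]
    by_cases hik : (i : ℕ) < k
    · simp [mix, hik, h.1 i hi]
    · simp [mix, hik, h.2 i hi]
  orth k φ hφ := by
    simp only [smul_comm _ (1 / 2 : ℝ), smul_add, Finset.sum_add_distrib, ← Finset.smul_sum]
    rw [he.sum_mix_eq_zero hφ,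
      he.sum_fst_eq_zero fun y w w' h => hφ _ _ ⟨h, fun _ _ => rfl⟩]
    simp
  orth' k φ hφ := by
    simp only [smul_comm _ c, smul_sub, Finset.sum_sub_distrib, ← Finset.smul_sum]
    -- The test function is invariant under the swap, while the odd part changes its sign.
    have h1 : ∑ w : (Fin n → α) × (Fin n → α), φ w • e k (mix k w.1 w.2) = ∑ w, φ w • e k w.1 := by
      rw [← (swapAt_involutive k).bijective.sum_comp]
      refine Finset.sum_congr rfl fun w _ => ?_
      rw [(he.sat k).apply_mix_swapAt, hφ _ _ (agreeSymm_swapAt k w)]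
    rw [h1]
    simp

end Decoupling

section DecouplingNorm

variable {n : ℕ} {α : Type} [Fintype α] [Nonempty α] {F : Type*} [NormedAddCommGroup F]
  [NormedSpace ℝ F] [CompleteSpace F] {e : ℕ → (Fin n → α) → F} {p C : ℝ}

/-- With `c = -1/2` the even and odd parts add up to the decoupled difference; reversing the sign of
the odd part gives the original one. -/
theorem IsUMDBound.sum_norm_le_decoupled (hp : 1 ≤ p) (hC : 0 ≤ C)
    (hF : IsUMDBound p F (ENNReal.ofReal C)) (he : IsCoordDiff e) (N : ℕ) :
    ∑ w : (Fin n → α) × (Fin n → α), ‖∑ k ∈ Finset.range N, e k w.1‖ ^ p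
      ≤ C ^ p * ∑ w : (Fin n → α) × (Fin n → α),
          ‖∑ k ∈ Finset.range N, e k (mix k w.1 w.2)‖ ^ p := by
  have key := hF.sum_pair_le hp hC (he.pair (-(1 / 2))) N (fun _ _ => 1) (fun _ _ => -1)
    (by simp) (by simp) (fun _ _ _ _ => rfl) (fun _ _ _ _ => rfl)
  convert key using 6 with w _ k _ w _ k _
  all_goals module

/-- With `c = 1/2` the roles are reversed, and the multiplier is absorbed into the signs at no cost.
-/
theorem IsUMDBound.sum_norm_decoupled_le (hp : 1 ≤ p) (hC : 0 ≤ C)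
    (hF : IsUMDBound p F (ENNReal.ofReal C)) (he : IsCoordDiff e) (N : ℕ)
    (v : ℕ → (Fin n → α) → ℝ) (hv : ∀ k x, v k x = 1 ∨ v k x = 0)
    (hv' : ∀ k, Sat (Agree k) (v k)) :
    ∑ w : (Fin n → α) × (Fin n → α),
        ‖∑ k ∈ Finset.range N, v k w.1 • e k (mix k w.1 w.2)‖ ^ p
      ≤ C ^ p * ∑ w : (Fin n → α) × (Fin n → α), ‖∑ k ∈ Finset.range N, e k w.1‖ ^ p := by
  have key := hF.sum_pair_le hp hC (he.pair (1 / 2)) N (fun k w => v k w.1) (fun k w => - v k w.1)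
    (fun k w => by rcases hv k w.1 with h | h <;> simp [h])
    (fun k w => by rcases hv k w.1 with h | h <;> simp [h])
    (fun k w w' h => hv' k _ _ h.1) (fun k w w' h => by beta_reduce; rw [hv' k _ _ h.1.1])
  convert key using 6 with w _ k _ w _ k _
  all_goals module

/-- The UMD-valued Stein inequality for decoupled martingale differences. -/
theorem IsUMDBound.sum_norm_condAvg_le {T E : Type*} [AddCommGroup T] [Module ℝ T]
    [AddCommGroup E] [Module ℝ E] (B : T →ₗ[ℝ] E →ₗ[ℝ] F) (hp : 1 ≤ p) (hC : 0 ≤ C)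
    (hF : IsUMDBound p F (ENNReal.ofReal C)) {c : ℕ → (Fin n → α) → T} (hc : IsCoordDiff c)
    (g : (Fin n → α) → E) :
    ∑ w : (Fin n → α) × (Fin n → α),
        ‖∑ k ∈ Finset.range n, B (c k (mix k w.1 w.2)) (condAvg k g w.1)‖ ^ p
      ≤ C ^ p * ∑ w : (Fin n → α) × (Fin n → α),
          ‖∑ k ∈ Finset.range n, B (c k (mix k w.1 w.2)) (g w.1)‖ ^ p := by
  have hcm : ∀ k (w w' : (Fin n → α) × (Fin n → α)), Agree k w.1 w'.1 → Agree (k + 1) w.2 w'.2 →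
      c k (mix k w.1 w.2) = c k (mix k w'.1 w'.2) := fun k w w' h1 h2 => by
    refine hc.sat k _ _ fun i hi => ?_
    by_cases hik : (i : ℕ) < k
    · simp [mix, hik, h1 i hik]
    · simp [mix, hik, h2 i hi]
  have hg := isCoordDiff_condAvg_succ_sub g
  -- In step `k` the `k`-th coordinate of `w.2` is revealed before that of `w.1`. The first
  -- difference is the wanted term, the second the change of the average of `g`, paired with all
  -- coefficients seen so far. The two can be separated because the decoupled coefficient does not
  -- depend on the `k`-th coordinate of `w.1`.
  have hpair : IsMartingaleDiffPair (Ω := (Fin n → α) × (Fin n → α)) Agree₂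
      (fun k w w' => Agree k w.1 w'.1 ∧ Agree (k + 1) w.2 w'.2)
      (fun k w => B (c k (mix k w.1 w.2)) (condAvg k g w.1))
      (fun k w => ∑ i ∈ Finset.range (k + 1),
        B (c i (mix i w.1 w.2)) (condAvg (k + 1) g w.1 - condAvg k g w.1)) := by
    refine ⟨fun k w w' h => ⟨h.1, h.2.mono k.le_succ⟩, fun k w w' h => ⟨h.1.mono k.le_succ, h.2⟩,
      fun k w w' h => ?_, fun k w w' h => ?_, fun k φ hφ => ?_, fun k φ hφ => ?_⟩
    · rw [hcm k w w' h.1 h.2, sat_condAvg k g _ _ h.1]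
    · refine Finset.sum_congr rfl fun i hi => ?_
      have hik : i + 1 ≤ k + 1 := Finset.mem_range.1 hi
      rw [hcm i w w' (h.1.mono (by omega)) (h.2.mono hik),
        sat_condAvg _ g _ _ h.1, sat_condAvg _ g _ _ (h.1.mono k.le_succ)]
    · have hBc : IsCoordDiff fun k x => B (c k x) (condAvg k g x) :=
        hc.linear (L := fun k x => B.flip (condAvg k g x)) fun k w w' h => by
          beta_reduce
          rw [sat_condAvg k g _ _ h]
      rw [← hBc.sum_mix_eq_zero hφ]
      refine Finset.sum_congr rfl fun w _ => ?_
      rw [(sat_condAvg k g).mix le_rfl]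
    · simp only [Finset.smul_sum]
      rw [Finset.sum_comm]
      refine Finset.sum_eq_zero fun i hi => ?_
      have hik : i ≤ k := Nat.lt_succ_iff.1 (Finset.mem_range.1 hi)
      rw [Fintype.sum_prod_type_right]
      refine Finset.sum_eq_zero fun y _ => ?_
      rw [← sum_condAvg k]
      refine Finset.sum_eq_zero fun x _ => ?_
      have := condAvg_linear (k := k) (L := fun x => φ (x, y) • B (c i (mix i x y)))
        (fun x x' h => by
          beta_reduce
          rw [hφ (x, y) (x', y) ⟨h, fun _ _ => rfl⟩,
            hcm i (x, y) (x', y) (h.mono hik) fun _ _ => rfl])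
        (fun x => condAvg (k + 1) g x - condAvg k g x) x
      simp only [LinearMap.smul_apply] at this
      rw [this, hg.condAvg_eq_zero k x]
      simp
  -- Retaining only the first kind of difference leaves the left side of the claim; by summation by
  -- parts (`htel`) the full sum is the one with `g` itself.
  have key := hF.sum_pair_le hp hC hpair n (fun _ _ => 1) (fun _ _ => 0)
    (by simp) (by simp) (fun _ _ _ _ => rfl) (fun _ _ _ _ => rfl)
  simp only [one_smul, zero_smul, add_zero] at key
  have htel : ∀ w : (Fin n → α) × (Fin n → α), ∀ N,
      ∑ k ∈ Finset.range N, (B (c k (mix k w.1 w.2)) (condAvg k g w.1)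
        + ∑ i ∈ Finset.range (k + 1),
          B (c i (mix i w.1 w.2)) (condAvg (k + 1) g w.1 - condAvg k g w.1))
      = ∑ k ∈ Finset.range N, B (c k (mix k w.1 w.2)) (condAvg N g w.1) := fun w N => by
    induction N with
    | zero => simp
    | succ N ih =>
      rw [Finset.sum_range_succ, ih, Finset.sum_range_succ, Finset.sum_range_succ,
        ← sub_eq_zero]
      simp only [map_sub, Finset.sum_sub_distrib]
      abel
  simp only [htel, condAvg_of_le le_rfl] at key
  exact key

end DecouplingNorm

/-! ### Stopping times -/

/-- The last stopping time up to time `k`: a new stopping time occurs whenever the process `m`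
exceeds twice its value at the previous one. -/
noncomputable def lastStop {Ω : Type*} (m : ℕ → Ω → ℝ) : ℕ → Ω → ℕ
  | 0, _ => 0
  | k + 1, x => if 2 * m (lastStop m k x) x < m (k + 1) x then k + 1 else lastStop m k x

section LastStop

variable {Ω : Type*} {m : ℕ → Ω → ℝ}

theorem lastStop_succ_of_lt {k : ℕ} {x : Ω} (h : 2 * m (lastStop m k x) x < m (k + 1) x) :
    lastStop m (k + 1) x = k + 1 := if_pos h

theorem lastStop_succ_of_le {k : ℕ} {x : Ω} (h : m (k + 1) x ≤ 2 * m (lastStop m k x) x) :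
    lastStop m (k + 1) x = lastStop m k x := if_neg h.not_gt

theorem lastStop_le (k : ℕ) (x : Ω) : lastStop m k x ≤ k := by
  induction k with
  | zero => simp [lastStop]
  | succ k ih => rw [lastStop]; split_ifs <;> omega

theorem lastStop_eq_of_le {j k i : ℕ} {x : Ω} (h : lastStop m k x = j) (hji : j ≤ i)
    (hik : i ≤ k) : lastStop m i x = j := by
  induction hik with
  | refl => exact h
  | @step k hik ih =>
    refine ih ?_
    rw [lastStop] at h
    simp only [Nat.le_eq] at hik
    split_ifs at h with h1
    · omega
    · exact h

theorem lastStop_ne_of_le {j k i : ℕ} {x : Ω} (h : lastStop m k x ≠ j) (hji : j ≤ k)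
    (hik : k ≤ i) : lastStop m i x ≠ j := fun h1 => h (lastStop_eq_of_le h1 hji hik)

theorem lastStop_self_of_eq {j k : ℕ} {x : Ω} (h : lastStop m k x = j) : lastStop m j x = j :=
  lastStop_eq_of_le h le_rfl (h ▸ lastStop_le k x)

theorem le_two_mul_lastStop (hm : ∀ k x, 0 ≤ m k x) (k : ℕ) (x : Ω) :
    m k x ≤ 2 * m (lastStop m k x) x := by
  have h0 : ∀ j, m j x ≤ 2 * m j x := fun j => by linarith [hm j x]
  cases k with
  | zero => exact h0 0
  | succ k =>
    rcases lt_or_ge (2 * m (lastStop m k x) x) (m (k + 1) x) with h | h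
    · rw [lastStop_succ_of_lt h]; exact h0 _
    · rwa [lastStop_succ_of_le h]

/-- Since `lastStop m k x ≤ k`, the value with which `m (k + 1)` is compared is already known at
time `k`. -/
theorem sat_lastStop {n : ℕ} {α : Type*} {m : ℕ → (Fin n → α) → ℝ}
    (hm : ∀ k, Sat (Agree k) (m k)) (k : ℕ) : Sat (Agree k) (lastStop m k) := by
  induction k with
  | zero => exact fun _ _ _ => rfl
  | succ k ih =>
    intro w w' h
    rw [lastStop, lastStop, ih w w' (h.mono k.le_succ), hm _ w w' h,
      (hm _).mono (lastStop_le k w') w w' (h.mono k.le_succ)]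

end LastStop

/-! ### Carleson embedding by a Bellman function -/

section Carleson

/-- Young's inequality for `h / u` and `t ^ (q - 1)`. It exhibits `h ^ q * u ^ (1 - q)` as a maximum
of functions linear in `(h, u)`, attained at `t = h / u`; this is the joint convexity behind
`carleson_embedding`. -/
theorem rpow_mul_rpow_one_sub_ge {q : ℝ} (hq : 1 < q) {h u t : ℝ} (hh : 0 ≤ h) (hu : 0 < u)
    (ht : 0 ≤ t) :
    q * t ^ (q - 1) * h - (q - 1) * t ^ q * u ≤ h ^ q * u ^ (1 - q) := by
  have hc : q.HolderConjugate (q / (q - 1)) := Real.HolderConjugate.conjExponent hq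
  have h1 := Real.young_inequality_of_nonneg (div_nonneg hh hu.le)
    (Real.rpow_nonneg ht (q - 1)) hc
  have h2 : (t ^ (q - 1)) ^ (q / (q - 1)) = t ^ q := by
    rw [← Real.rpow_mul ht, mul_div_cancel₀ _ (by linarith)]
  have h3 : h ^ q * u ^ (1 - q) = (h / u) ^ q * u := by
    rw [Real.div_rpow hh hu.le, Real.rpow_sub hu, Real.rpow_one]
    ring
  rw [h2] at h1
  have hq0 : 0 < q := by linarith
  have h4 : q * u * ((h / u) * t ^ (q - 1))
      ≤ q * u * ((h / u) ^ q / q + t ^ q / (q / (q - 1))) := by gcongr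
  have h5 : q * u * ((h / u) * t ^ (q - 1)) = q * t ^ (q - 1) * h := by field_simp
  have h6 : q * u * ((h / u) ^ q / q + t ^ q / (q / (q - 1)))
      = (h / u) ^ q * u + (q - 1) * t ^ q * u := by field_simp
  rw [h3]
  linarith

theorem rpow_mul_rpow_one_sub_eq {q : ℝ} (hq : 1 < q) {h u : ℝ} (hh : 0 ≤ h) (hu : 0 < u) :
    q * (h / u) ^ (q - 1) * h - (q - 1) * (h / u) ^ q * u = h ^ q * u ^ (1 - q) := by
  have h3 : h ^ q * u ^ (1 - q) = (h / u) ^ q * u := by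
    rw [Real.div_rpow hh hu.le, Real.rpow_sub hu, Real.rpow_one]
    ring
  have h4 : (h / u) ^ q = (h / u) ^ (q - 1) * (h / u) := by
    rcases (div_nonneg hh hu.le).eq_or_lt with h0 | h0
    · rw [← h0, Real.zero_rpow (by linarith)]; simp
    · rw [← Real.rpow_add_one h0.ne']; congr 1; ring
  rw [h3, h4]
  field_simp
  ring

variable {n : ℕ} {α : Type*} [Fintype α] [Nonempty α]

theorem sum_mul_condAvg_succ {k : ℕ} {φ : (Fin n → α) → ℝ} (hφ : Sat (Agree k) φ)
    (g : (Fin n → α) → ℝ) : ∑ x, φ x * condAvg (k + 1) g x = ∑ x, φ x * condAvg k g x := by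
  rw [sum_mul_condAvg hφ, sum_mul_condAvg (hφ.mono k.le_succ)]

/-- The Carleson embedding theorem for the stopping times of a nonnegative martingale. -/
theorem carleson_embedding {q : ℝ} (hq : 1 < q) {u h : (Fin n → α) → ℝ} (hu : ∀ x, 0 ≤ u x)
    (hh : ∀ x, 0 ≤ h x) :
    ∑ j ∈ Finset.range (n + 1), ∑ x,
        (if lastStop (fun k => condAvg k u) j x = j then (condAvg j h x) ^ q else 0)
      ≤ 2 * (q / (q - 1)) ^ q * ∑ x, h x ^ q := by
  set m : ℕ → (Fin n → α) → ℝ := fun k => condAvg k u with hm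
  have hm0 : ∀ k x, 0 ≤ m k x := fun k x => condAvg_nonneg k hu x
  have hms : ∀ k, Sat (Agree k) (m k) := fun k => sat_condAvg k u
  have hh0 : ∀ k x, 0 ≤ condAvg k h x := fun k x => condAvg_nonneg k hh x
  have hq0 : 0 < q := by linarith
  have hq1 : 0 < q - 1 := by linarith
  set κ : ℝ := 1 / (q - 1) with hκ
  have hκ0 : 0 < κ := by positivity
  have hκq : κ * (q - 1) = 1 := by rw [hκ]; field_simp
  have hκ1 : 1 + κ = q / (q - 1) := by rw [hκ]; field_simp; ring
  set c : ℕ → (Fin n → α) → ℝ := fun k x => m k x / (2 * m (lastStop m k x) x) with hc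
  set c' : ℕ → (Fin n → α) → ℝ := fun k x => m (k + 1) x / (2 * m (lastStop m k x) x) with hc'
  have hc0 : ∀ k x, 0 ≤ c k x := fun k x =>
    div_nonneg (hm0 _ _) (by linarith [hm0 (lastStop m k x) x])
  have hc'0 : ∀ k x, 0 ≤ c' k x := fun k x =>
    div_nonneg (hm0 _ _) (by linarith [hm0 (lastStop m k x) x])
  -- The Bellman function: `V k` after a possible stop at time `k`, `V' k` at time `k + 1` before
  -- one. Here `c` is the growth since the last stop relative to the threshold. It exceeds `1` just
  -- before a stop and is at most `1 / 2` after it; as the weight decreases in `c`, the reset leaves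
  -- a gain.
  let V : ℕ → (Fin n → α) → ℝ := fun k x => condAvg k h x ^ q * (1 + κ * c k x) ^ (1 - q)
  let V' : ℕ → (Fin n → α) → ℝ := fun k x =>
    condAvg (k + 1) h x ^ q * (1 + κ * min (c' k x) 1) ^ (1 - q)
  -- A lower bound for the gain of one stop; its inverse is the constant of the embedding.
  let A : ℝ := ((1 + κ) ^ q)⁻¹ / 2
  have h_last : ∀ k x, lastStop m k x = k →
      condAvg k h x ^ q * (1 + κ) ^ (1 - q) + A * condAvg k h x ^ q ≤ V k x := fun k x hs => by
    have h1 : c k x ≤ 1 / 2 := by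
      simp only [hc, hs]
      rcases (hm0 k x).eq_or_lt with h0 | h0
      · rw [← h0]; norm_num
      · rw [div_le_div_iff₀ (by positivity) (by norm_num)]; linarith
    have h2 : (1 + κ) ^ (1 - q) + A ≤ (1 + κ * c k x) ^ (1 - q) := by
      -- The tangent that touches the weight at `c = 1`, evaluated at `c = 1 / 2`.
      have h3 := rpow_mul_rpow_one_sub_ge hq (h := 1) (u := 1 + κ * (1 / 2)) (t := (1 + κ)⁻¹)
        zero_le_one (by positivity) (by positivity)
      have h4 : (1 + κ * (1 / 2)) ^ (1 - q) ≤ (1 + κ * c k x) ^ (1 - q) :=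
        Real.rpow_le_rpow_of_nonpos (by have := hc0 k x; positivity) (by gcongr) (by linarith)
      refine le_trans (le_of_eq ?_) ((h3.trans (by rw [Real.one_rpow, one_mul])).trans h4)
      have h5 : (1 + κ)⁻¹ ^ (q - 1) = (1 + κ)⁻¹ ^ q * (1 + κ) := by
        rw [Real.rpow_sub (by positivity), Real.rpow_one, div_inv_eq_mul]
      have h6 : (1 + κ) ^ (1 - q) = (1 + κ)⁻¹ ^ q * (1 + κ) := by
        rw [Real.rpow_sub (by positivity), Real.rpow_one, Real.inv_rpow (by positivity)]
        ring
      rw [h5, h6, show A = (1 + κ)⁻¹ ^ q / 2 by rw [Real.inv_rpow (by positivity)]]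
      linear_combination (-(1 + κ)⁻¹ ^ q / 2) * hκq
    calc _ = condAvg k h x ^ q * ((1 + κ) ^ (1 - q) + A) := by ring
      _ ≤ _ := mul_le_mul_of_nonneg_left h2 (Real.rpow_nonneg (hh0 k x) q)
  have hpost : ∀ k x, V' k x
      + A * (if lastStop m (k + 1) x = k + 1 then condAvg (k + 1) h x ^ q else 0)
        ≤ V (k + 1) x := fun k x => by
    rcases lt_or_ge (2 * m (lastStop m k x) x) (m (k + 1) x) with hs | hs
    · have hs' := lastStop_succ_of_lt hs
      rw [if_pos hs']
      -- If the value at the last stop is zero, the quotient `c'` is meaningless; but then `m k x =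
      -- 0`, so `m (k + 1) x = 0` by doubling and no new stop occurs.
      rcases (hm0 (lastStop m k x) x).eq_or_lt with h0 | h0
      · refine absurd hs (not_lt.2 ?_)
        have h1 : m k x = 0 := by
          have := le_two_mul_lastStop hm0 k x
          rw [← h0] at this
          linarith [hm0 k x]
        have h2 := condAvg_succ_le k hu x
        rw [show condAvg k u x = 0 from h1, mul_zero] at h2
        linarith [hm0 (lastStop m k x) x, show m (k + 1) x ≤ 0 from h2]
      · have h1 : min (c' k x) 1 = 1 := min_eq_right (by
          simp only [hc']; rw [one_le_div (by positivity)]; exact hs.le)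
        have := h_last (k + 1) x hs'
        simp only [V', h1, mul_one]
        exact this
    · have hs' := lastStop_succ_of_le hs
      have h2 : lastStop m (k + 1) x ≠ k + 1 := by
        rw [hs']; have := lastStop_le (m := m) k x; omega
      rw [if_neg h2, mul_zero, add_zero]
      have h1 : min (c' k x) 1 = c (k + 1) x := by
        simp only [hc', hc, hs']
        exact min_eq_left (div_le_one_of_le₀ hs (by linarith [hm0 (lastStop m k x) x]))
      simp only [V', V, h1, le_refl]
  have hpre : ∀ k, ∑ x, V k x ≤ ∑ x, V' k x := fun k => by
    -- The tangent chosen at time `k` has predictable coefficients, so by the martingale property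
    -- its sum is the same at times `k` and `k + 1`. The cut-off of `c'` at `1` only helps, since
    -- `u` enters with a negative sign.
    set t : (Fin n → α) → ℝ := fun x => condAvg k h x / (1 + κ * c k x) with ht
    have hu0 : ∀ x, 0 < 1 + κ * c k x := fun x => by have := hc0 k x; positivity
    have ht0 : ∀ x, 0 ≤ t x := fun x => div_nonneg (hh0 k x) (hu0 x).le
    have hsm : Sat (Agree k) fun x => m (lastStop m k x) x := fun w w' hw => by
      beta_reduce
      rw [sat_lastStop hms k w w' hw, (hms _).mono (lastStop_le k w') w w' hw]
    have htS : Sat (Agree k) t := fun w w' hw => by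
      simp only [ht, hc]
      rw [sat_condAvg k h w w' hw, hms k w w' hw, show m (lastStop m k w) w = _ from hsm w w' hw]
    have e1 := sum_mul_condAvg_succ (k := k) (φ := fun x => q * t x ^ (q - 1))
      (fun w w' hw => by beta_reduce; rw [htS w w' hw]) h
    have e2 := sum_mul_condAvg_succ (k := k)
      (φ := fun x => (q - 1) * t x ^ q * κ / (2 * m (lastStop m k x) x))
      (fun w w' hw => by
        beta_reduce; rw [htS w w' hw, show m (lastStop m k w) w = _ from hsm w w' hw]) u
    have e3 : ∑ x, V k x = ∑ x, q * t x ^ (q - 1) * condAvg k h x - ∑ x, (q - 1) * t x ^ q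
        - ∑ x, (q - 1) * t x ^ q * κ / (2 * m (lastStop m k x) x) * condAvg k u x := by
      rw [← Finset.sum_sub_distrib, ← Finset.sum_sub_distrib]
      refine Finset.sum_congr rfl fun x _ => ?_
      refine (rpow_mul_rpow_one_sub_eq hq (hh0 k x) (hu0 x)).symm.trans ?_
      simp only [hc, hm, ht]
      ring
    rw [e3, ← e1, ← e2, ← Finset.sum_sub_distrib, ← Finset.sum_sub_distrib]
    refine Finset.sum_le_sum fun x _ => ?_
    have hc'' : 0 ≤ min (c' k x) 1 := le_min (hc'0 k x) zero_le_one
    refine le_trans ?_ (rpow_mul_rpow_one_sub_ge hq (hh0 (k + 1) x) (u := 1 + κ * min (c' k x) 1)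
      (by positivity) (ht0 x))
    have : (q - 1) * t x ^ q * (1 + κ * min (c' k x) 1) ≤ (q - 1) * t x ^ q * (1 + κ * c' k x) := by
      have := Real.rpow_nonneg (ht0 x) q
      gcongr
      exact min_le_left _ _
    refine le_trans (le_of_eq ?_) (sub_le_sub_left this _)
    simp only [hc', hm]
    ring
  have hA0 : 0 < A := by positivity
  have main : ∀ K, A * ∑ j ∈ Finset.range (K + 1), ∑ x,
      (if lastStop m j x = j then (condAvg j h x) ^ q else 0) ≤ ∑ x, V K x := fun K => by
    induction K with
    | zero =>
      rw [zero_add, Finset.sum_range_one, Finset.mul_sum]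
      refine Finset.sum_le_sum fun x _ => ?_
      have h0 : lastStop m 0 x = 0 := rfl
      rw [if_pos h0]
      refine le_trans ?_ (h_last 0 x h0)
      have := Real.rpow_nonneg (hh0 0 x) q
      have : 0 ≤ condAvg 0 h x ^ q * (1 + κ) ^ (1 - q) := by positivity
      linarith
    | succ K ih =>
      rw [Finset.sum_range_succ, mul_add]
      calc _ ≤ ∑ x, V' K x + A * ∑ x,
            (if lastStop m (K + 1) x = K + 1 then (condAvg (K + 1) h x) ^ q else 0) := by
            gcongr; exact ih.trans (hpre K)
        _ ≤ _ := by
            rw [Finset.mul_sum, ← Finset.sum_add_distrib]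
            exact Finset.sum_le_sum fun x _ => hpost K x
  have hend : ∑ x, V n x ≤ ∑ x, h x ^ q := Finset.sum_le_sum fun x _ => by
    simp only [V]
    rw [condAvg_of_le le_rfl]
    refine mul_le_of_le_one_right (Real.rpow_nonneg (hh x) q)
      (Real.rpow_le_one_of_one_le_of_nonpos ?_ (by linarith))
    have := hc0 n x
    nlinarith
  have h2 := (main n).trans hend
  rw [mul_comm, ← le_div_iff₀ hA0] at h2
  refine h2.trans (le_of_eq ?_)
  rw [← hκ1]
  have : 0 < (1 + κ) ^ q := by positivity
  simp only [A]
  field_simp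

end Carleson

/-! ### Martingales stopped at the next stopping time -/

section Stopped

variable {n : ℕ} {α : Type*} [Fintype α] [Nonempty α] {F : Type*} [AddCommGroup F] [Module ℝ F]

/-- The martingale of `f` at time `N`, started at time `j` and stopped at the first stopping time
after `j`. -/
noncomputable def stopped (m : ℕ → (Fin n → α) → ℝ) (f : (Fin n → α) → F) (j N : ℕ)
    (x : Fin n → α) : F :=
  condAvg j f x + ∑ k ∈ Finset.Ico j N,
    if lastStop m k x = j then condAvg (k + 1) f x - condAvg k f x else 0

variable {m : ℕ → (Fin n → α) → ℝ}

theorem stopped_self (f : (Fin n → α) → F) (j : ℕ) (x : Fin n → α) :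
    stopped m f j j x = condAvg j f x := by simp [stopped]

theorem stopped_succ_eq_add (f : (Fin n → α) → F) {j N : ℕ} (h : j ≤ N) (x : Fin n → α) :
    stopped m f j (N + 1) x = stopped m f j N x
      + if lastStop m N x = j then condAvg (N + 1) f x - condAvg N f x else 0 := by
  rw [stopped, Finset.sum_Ico_succ_top h, ← add_assoc, stopped]

theorem stopped_of_lastStop_eq (f : (Fin n → α) → F) {j N : ℕ} {x : Fin n → α}
    (h : lastStop m N x = j) : stopped m f j N x = condAvg N f x := by
  have hj : j ≤ N := h ▸ lastStop_le N x
  have : ∀ M, j ≤ M → M ≤ N → stopped m f j M x = condAvg M f x := fun M hM => by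
    induction M, hM using Nat.le_induction with
    | base => exact fun _ => stopped_self f j x
    | succ M hM ih =>
      intro hMN
      rw [stopped_succ_eq_add f hM, ih (by omega),
        if_pos (lastStop_eq_of_le h hM (by omega))]
      abel
  exact this N hj le_rfl

theorem stopped_succ (f : (Fin n → α) → F) {j N : ℕ} (h : j ≤ N) (x : Fin n → α) :
    stopped m f j (N + 1) x
      = if lastStop m N x = j then condAvg (N + 1) f x else stopped m f j N x := by
  rw [stopped_succ_eq_add f h]
  split_ifs with h1
  · rw [stopped_of_lastStop_eq f h1]; abel
  · rw [add_zero]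

theorem sat_stopped (hm : ∀ k, Sat (Agree k) (m k)) (f : (Fin n → α) → F) {j N : ℕ} (h : j ≤ N) :
    Sat (Agree N) (stopped m f j N) := by
  induction N, h using Nat.le_induction with
  | base =>
    intro w w' hw
    rw [stopped_self, stopped_self, sat_condAvg j f w w' hw]
  | succ N hN ih =>
    intro w w' hw
    rw [stopped_succ f hN, stopped_succ f hN, ih w w' (hw.mono N.le_succ),
      sat_lastStop hm N w w' (hw.mono N.le_succ), sat_condAvg _ f w w' hw]

/-- Optional stopping: whether the increment after time `N` is kept is known at time `N`, so its
conditional mean vanishes. -/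
theorem condAvg_stopped (hm : ∀ k, Sat (Agree k) (m k)) (f : (Fin n → α) → F) {j k N : ℕ}
    (hjk : j ≤ k) (hkN : k ≤ N) (x : Fin n → α) :
    condAvg k (stopped m f j N) x = stopped m f j k x := by
  induction N, hkN using Nat.le_induction with
  | base => exact (sat_stopped hm f hjk).condAvg_eq le_rfl x
  | succ N hN ih =>
    have h1 : stopped m f j (N + 1) = fun z => stopped m f j N z
        + (if lastStop m N z = j then (1 : ℝ) else 0) • (condAvg (N + 1) f z - condAvg N f z) := by
      funext z
      rw [stopped_succ_eq_add f (hjk.trans hN)]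
      split_ifs <;> simp
    rw [h1, condAvg_add, ih, add_eq_left, ← condAvg_condAvg hN]
    have h2 : condAvg N (fun z => (if lastStop m N z = j then (1 : ℝ) else 0) •
        (condAvg (N + 1) f z - condAvg N f z)) = fun _ => 0 := by
      funext z
      rw [condAvg_smul (fun w w' hw => by rw [sat_lastStop hm N w w' hw]), condAvg_sub,
        condAvg_condAvg N.le_succ, condAvg_condAvg le_rfl, sub_self, smul_zero]
    rw [h2, condAvg_const]

/-- While `j` is the last stop, the average of `‖f‖` is at most twice its value at `j`; the single
step into the next stop costs at most the doubling factor. -/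
theorem norm_stopped_le {F : Type*} [SeminormedAddCommGroup F] [NormedSpace ℝ F]
    (f : (Fin n → α) → F) {j N : ℕ} (h : j ≤ N) {x : Fin n → α} :
    ‖stopped (fun k => condAvg k fun z => ‖f z‖) f j N x‖
      ≤ 2 * Fintype.card α * condAvg j (fun z => ‖f z‖) x := by
  have h0 : ∀ k x, 0 ≤ condAvg k (fun z => ‖f z‖) x := fun k x =>
    condAvg_nonneg k (fun _ => norm_nonneg _) x
  have h1 : (1 : ℝ) ≤ Fintype.card α := by exact_mod_cast Fintype.card_pos
  induction N, h using Nat.le_induction with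
  | base =>
    rw [stopped_self]
    refine (norm_condAvg_le j f x).trans ?_
    nlinarith [h0 j x]
  | succ N hN ih =>
    rw [stopped_succ f hN]
    split_ifs with h2
    · refine (norm_condAvg_le _ f x).trans ((condAvg_succ_le N (fun _ => norm_nonneg _) x).trans ?_)
      have := le_two_mul_lastStop h0 N x
      rw [h2] at this
      nlinarith
    · exact ih

theorem stopped_nonneg {h : (Fin n → α) → ℝ} (hh : ∀ x, 0 ≤ h x) {j N : ℕ} (hj : j ≤ N)
    (x : Fin n → α) : 0 ≤ stopped m h j N x := by
  induction N, hj using Nat.le_induction with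
  | base => rw [stopped_self]; exact condAvg_nonneg j hh x
  | succ N hN ih =>
    rw [stopped_succ h hN]
    split_ifs
    exacts [condAvg_nonneg _ hh x, ih]

/-- Each stop carries the value of `h` at its successor, or at time `N` if there is none; every stop
but the initial one is a successor exactly once. -/
theorem sum_stopped_rpow (h : (Fin n → α) → ℝ) (q : ℝ) (N : ℕ) (x : Fin n → α) :
    ∑ j ∈ Finset.range (N + 1), (if lastStop m j x = j then stopped m h j N x ^ q else 0)
      = condAvg N h x ^ q + ∑ j ∈ Finset.range N,
        (if lastStop m (j + 1) x = j + 1 then condAvg (j + 1) h x ^ q else 0) := by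
  induction N with
  | zero => simp [stopped_self, lastStop]
  | succ N ih =>
    have h1 : ∀ j ∈ Finset.range (N + 1),
        (if lastStop m j x = j then stopped m h j (N + 1) x ^ q else 0)
          = (if lastStop m j x = j then stopped m h j N x ^ q else 0)
            + (if lastStop m N x = j then condAvg (N + 1) h x ^ q - condAvg N h x ^ q else 0) := by
      intro j hj
      rw [stopped_succ h (Nat.lt_succ_iff.1 (Finset.mem_range.1 hj))]
      by_cases h2 : lastStop m N x = j
      · rw [if_pos (lastStop_self_of_eq h2), if_pos h2, if_pos h2, if_pos (lastStop_self_of_eq h2),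
          stopped_of_lastStop_eq h h2]
        ring
      · simp [h2]
    rw [Finset.sum_range_succ, stopped_self, Finset.sum_congr rfl h1, Finset.sum_add_distrib, ih,
      Finset.sum_ite_eq,
      if_pos (Finset.mem_range.2 (Nat.lt_succ_of_le (lastStop_le N x))), Finset.sum_range_succ _ N]
    ring

end Stopped

/-! ### The paraproduct on a finite tree -/

/-! ### Almost orthogonality of functions adapted to the stopping times -/

section Pythagoras

variable {n : ℕ} {α : Type*} [Fintype α] [Nonempty α]

/-- By `hg`, `g` is known at time `k` where the last stop is no longer `j`. Later increments of `h`
on that set are orthogonal to `g`, and these are the ones that `stopped` omits. -/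
theorem sum_mul_stopped {m : ℕ → (Fin n → α) → ℝ} {j N : ℕ} (hjN : j ≤ N)
    {g : (Fin n → α) → ℝ}
    (hg : ∀ k, j ≤ k → Sat (Agree k) fun x => if lastStop m k x = j then 0 else g x)
    (h : (Fin n → α) → ℝ) :
    ∑ x, g x * condAvg N h x = ∑ x, g x * stopped m h j N x := by
  induction N, hjN using Nat.le_induction with
  | base => simp only [stopped_self]
  | succ N hN ih =>
    have e := sum_mul_condAvg_succ (hg N hN) h
    rw [← sub_eq_zero, ← Finset.sum_sub_distrib] at e ih ⊢
    refine Eq.trans ?_ ((congrArg₂ (· + ·) e ih).trans (add_zero 0))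
    rw [← Finset.sum_add_distrib]
    refine Finset.sum_congr rfl fun x _ => ?_
    rw [stopped_succ_eq_add h hN]
    split_ifs <;> ring

/-- Raise to the power `p` and absorb `Y ^ (p - 1)`, using `p / q = p - 1`. -/
theorem le_mul_of_le_rpow_mul_rpow {p q X Y K : ℝ} (h : p.HolderConjugate q) (hX : 0 ≤ X)
    (hY : 0 ≤ Y) (hK : 0 ≤ K) (hle : Y ≤ X ^ (1 / p) * (K * Y) ^ (1 / q)) :
    Y ≤ K ^ (p - 1) * X := by
  rcases hY.eq_or_lt with h0 | h0
  · rw [← h0]; positivity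
  have hp := h.pos
  have h1 := Real.rpow_le_rpow hY hle hp.le
  have hpq : 1 / q * p = p - 1 := by
    rw [div_mul_eq_mul_div, one_mul]; exact h.div_conj_eq_sub_one
  rw [Real.mul_rpow (by positivity) (by positivity), ← Real.rpow_mul hX, ← Real.rpow_mul
    (by positivity), one_div_mul_cancel hp.ne', Real.rpow_one, hpq, Real.mul_rpow hK hY] at h1
  have h2 : Y ^ p = Y * Y ^ (p - 1) := by
    nth_rewrite 2 [← Real.rpow_one Y]
    rw [← Real.rpow_add h0]; congr 1; ring
  rw [h2, ← mul_assoc] at h1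
  have h3 := le_of_mul_le_mul_right h1 (by positivity)
  linarith

/-- The `L^p` variant of Pythagoras' theorem for functions adapted to stopping times. -/
theorem sum_rpow_sum_le {p : ℝ} (hp : 1 < p) {u : (Fin n → α) → ℝ} (hu : ∀ x, 0 ≤ u x)
    {g : ℕ → (Fin n → α) → ℝ} (hg0 : ∀ j x, 0 ≤ g j x)
    (hg1 : ∀ j x, lastStop (fun k => condAvg k u) j x ≠ j → g j x = 0)
    (hg : ∀ j k, j ≤ k →
      Sat (Agree k) fun x => if lastStop (fun k => condAvg k u) k x = j then 0 else g j x) :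
    ∑ x, (∑ j ∈ Finset.range n, g j x) ^ p
      ≤ 3 ^ (p - 1) * p ^ p * ∑ j ∈ Finset.range n, ∑ x, g j x ^ p := by
  set m : ℕ → (Fin n → α) → ℝ := fun k => condAvg k u
  set q : ℝ := p / (p - 1) with hq
  have hc : p.HolderConjugate q := Real.HolderConjugate.conjExponent hp
  have hq1 : 1 < q := hc.symm.lt
  have hp0 : 0 < p := by linarith
  have hp1 : 0 < p - 1 := by linarith
  set S : (Fin n → α) → ℝ := fun x => ∑ j ∈ Finset.range n, g j x with hS
  have hS0 : ∀ x, 0 ≤ S x := fun x => Finset.sum_nonneg fun j _ => hg0 j x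
  -- The extremal function of the duality between `L^p` and `L^q`; testing `S` with it makes a
  -- supremum unnecessary.
  set h : (Fin n → α) → ℝ := fun x => S x ^ (p - 1) with hh
  have hh0 : ∀ x, 0 ≤ h x := fun x => Real.rpow_nonneg (hS0 x) _
  have hhq : ∀ x, h x ^ q = S x ^ p := fun x => by
    rw [hh, ← Real.rpow_mul (hS0 x), hq, mul_div_cancel₀ _ hp1.ne']
  have hSh : ∀ x, S x * h x = S x ^ p := fun x => by
    rw [hh]
    rcases (hS0 x).eq_or_lt with h0 | h0
    · beta_reduce; rw [← h0, Real.zero_rpow hp0.ne', zero_mul]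
    · beta_reduce
      nth_rewrite 1 [← Real.rpow_one (S x)]
      rw [← Real.rpow_add h0]; congr 1; ring
  set P : ℕ → (Fin n → α) → ℝ := fun j x => if lastStop m j x = j then stopped m h j n x else 0
    with hP
  have hP0 : ∀ j ∈ Finset.range n, ∀ x, 0 ≤ P j x := fun j hj x => by
    simp only [hP]; split_ifs
    exacts [stopped_nonneg hh0 (Finset.mem_range.1 hj).le x, le_rfl]
  have h1 : ∑ x, S x ^ p = ∑ i ∈ Finset.range n ×ˢ Finset.univ, g i.1 i.2 * P i.1 i.2 := by
    rw [Finset.sum_product]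
    have e0 : ∀ x, S x ^ p = ∑ j ∈ Finset.range n, g j x * h x := fun x => by
      rw [← hSh, ← Finset.sum_mul]
    rw [Finset.sum_congr rfl fun x _ => e0 x, Finset.sum_comm]
    refine Finset.sum_congr rfl fun j hj => ?_
    have := sum_mul_stopped (m := m) (Finset.mem_range.1 hj).le (hg j) h
    simp only [condAvg_of_le le_rfl] at this
    rw [this]
    refine Finset.sum_congr rfl fun x _ => ?_
    simp only [hP]
    split_ifs with h2
    · rfl
    · simp [hg1 j x h2]
  have h2 := Real.inner_le_Lp_mul_Lq (Finset.range n ×ˢ Finset.univ)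
    (fun i : ℕ × (Fin n → α) => g i.1 i.2) (fun i => P i.1 i.2) hc
  rw [← h1] at h2
  -- The Carleson embedding for `q`, whose conjugate exponent is `p`, gives `2 * p ^ q`, and the
  -- values at the final time add `1 ≤ p ^ q`.
  have h3 : ∑ i ∈ Finset.range n ×ˢ (Finset.univ : Finset (Fin n → α)), |P i.1 i.2| ^ q
      ≤ 3 * p ^ q * ∑ x, S x ^ p := by
    have e1 : ∀ x, ∑ j ∈ Finset.range n, |P j x| ^ q
        ≤ h x ^ q + ∑ j ∈ Finset.range (n + 1),
          (if lastStop m j x = j then condAvg j h x ^ q else 0) := fun x => by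
      have e2 := sum_stopped_rpow (m := m) h q n x
      rw [condAvg_of_le le_rfl] at e2
      have e3 : ∑ j ∈ Finset.range n, |P j x| ^ q ≤ ∑ j ∈ Finset.range (n + 1),
          (if lastStop m j x = j then stopped m h j n x ^ q else 0) := by
        rw [Finset.sum_range_succ]
        refine le_add_of_le_of_nonneg (Finset.sum_le_sum fun j hj => ?_) ?_
        · rw [abs_of_nonneg (hP0 j hj x)]
          simp only [hP]
          split_ifs
          · rfl
          · rw [Real.zero_rpow (by linarith)]
        · split_ifs
          · exact Real.rpow_nonneg (stopped_nonneg hh0 le_rfl x) q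
          · rfl
      refine e3.trans ?_
      rw [e2, Finset.sum_range_succ' _ n]
      have : 0 ≤ (if lastStop m 0 x = 0 then condAvg 0 h x ^ q else 0) := by
        split_ifs
        · exact Real.rpow_nonneg (condAvg_nonneg 0 hh0 x) q
        · rfl
      linarith
    rw [Finset.sum_product_right]
    refine (Finset.sum_le_sum fun x _ => e1 x).trans ?_
    rw [Finset.sum_add_distrib, Finset.sum_comm (s := Finset.univ)]
    have e4 := carleson_embedding hq1 hu hh0
    rw [show q / (q - 1) = p by rw [hq]; field_simp; ring] at e4
    simp only [hhq] at e4 ⊢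
    have e5 : 0 ≤ ∑ x, S x ^ p := Finset.sum_nonneg fun x _ => Real.rpow_nonneg (hS0 x) p
    have e6 : 1 ≤ p ^ q := Real.one_le_rpow hp.le (by linarith)
    calc _ ≤ ∑ x, S x ^ p + 2 * p ^ q * ∑ x, S x ^ p := by gcongr
      _ ≤ _ := by nlinarith
  have h4 : ∑ i ∈ Finset.range n ×ˢ (Finset.univ : Finset (Fin n → α)), |g i.1 i.2| ^ p
      = ∑ j ∈ Finset.range n, ∑ x, g j x ^ p := by
    rw [Finset.sum_product]
    simp only [abs_of_nonneg (hg0 _ _)]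
  have hX : 0 ≤ ∑ j ∈ Finset.range n, ∑ x, g j x ^ p :=
    Finset.sum_nonneg fun j _ => Finset.sum_nonneg fun x _ => Real.rpow_nonneg (hg0 j x) p
  rw [h4] at h2
  have h5 := le_mul_of_le_rpow_mul_rpow hc hX
    (Finset.sum_nonneg fun x _ => Real.rpow_nonneg (hS0 x) p) (by positivity)
    (h2.trans (mul_le_mul_of_nonneg_left (Real.rpow_le_rpow (Finset.sum_nonneg fun i _ =>
      by positivity) h3 (by have := hc.symm.pos; positivity)) (by positivity)))
  refine h5.trans (le_of_eq ?_)
  rw [Real.mul_rpow (by norm_num) (by positivity), ← Real.rpow_mul hp0.le,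
    show q * (p - 1) = p by rw [hq]; field_simp]

end Pythagoras

/-! ### The estimate between two stops and the sum over all stops -/

section Paraproduct

variable {n : ℕ} {α : Type} [Fintype α] [Nonempty α]
  {E T F : Type*} [NormedAddCommGroup E] [NormedSpace ℝ E]
  [NormedAddCommGroup T] [NormedSpace ℝ T] [CompleteSpace T]
  [NormedAddCommGroup F] [NormedSpace ℝ F] [CompleteSpace F]
  {p CF CT β : ℝ} {b : (Fin n → α) → T} {f : (Fin n → α) → E} {v : ℕ → (Fin n → α) → ℝ}
  (B : T →ₗ[ℝ] E →ₗ[ℝ] F)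

/-- The estimate for the part of the paraproduct between a stopping time and the next one. -/
theorem sum_norm_paraproduct_stop_le (hp : 1 ≤ p) (hCF : 0 ≤ CF) (hCT : 0 ≤ CT) (hβ : 0 ≤ β)
    (hF : IsUMDBound p F (ENNReal.ofReal CF)) (hT : IsUMDBound p T (ENNReal.ofReal CT))
    (hB : ∀ t e, ‖B t e‖ ≤ ‖t‖ * ‖e‖)
    (hb : ∀ k x, condAvg k (fun z => ‖b z - condAvg k b z‖ ^ p) x ≤ β ^ p)
    (hv : ∀ k x, v k x = 1 ∨ v k x = 0) (hv' : ∀ k, Sat (Agree k) (v k)) {j : ℕ} (hj : j ≤ n) :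
    ∑ x, ‖∑ k ∈ Finset.range n,
        if lastStop (fun k => condAvg k fun z => ‖f z‖) k x = j then
          v k x • B (condAvg (k + 1) b x - condAvg k b x) (condAvg k f x) else 0‖ ^ p
      ≤ (2 * Fintype.card α * CF ^ 2 * CT * β) ^ p *
        ∑ x, if lastStop (fun k => condAvg k fun z => ‖f z‖) j x = j then
          condAvg j (fun z => ‖f z‖) x ^ p else 0 := by
  set m : ℕ → (Fin n → α) → ℝ := fun k => condAvg k fun z => ‖f z‖ with hm
  have hms : ∀ k, Sat (Agree k) (m k) := fun k => sat_condAvg k _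
  have hm0 : ∀ k x, 0 ≤ m k x := fun k x => condAvg_nonneg k (fun _ => norm_nonneg _) x
  have hσ := sat_lastStop hms
  have hp0 : 0 < p := by linarith
  set M : ℝ := (Fintype.card α : ℝ) with hM
  have hM0 : 0 ≤ M := by positivity
  set d : ℕ → (Fin n → α) → T := fun k x => condAvg (k + 1) b x - condAvg k b x with hd
  have hdc : IsCoordDiff d := isCoordDiff_condAvg_succ_sub b
  set V : ℕ → (Fin n → α) → ℝ := fun k x => if lastStop m k x = j then v k x else 0 with hV
  have hVs : ∀ k, Sat (Agree k) (V k) := fun k w w' h => by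
    simp only [hV, hσ k w w' h, hv' k w w' h]
  set c : ℕ → (Fin n → α) → T := fun k x => V k x • d k x with hcdef
  have hc : IsCoordDiff c := hdc.smul hVs
  have hBc : IsCoordDiff fun k x => B (c k x) (condAvg k f x) :=
    hc.linear (L := fun k x => B.flip (condAvg k f x)) fun k w w' h => by
      beta_reduce; rw [sat_condAvg k f w w' h]
  -- The coefficients vanish unless `j` is the last stop, and there `f` and its stopped version have
  -- the same averages.
  set ft : (Fin n → α) → E := stopped m f j n with hft
  have e1 := hF.sum_norm_le_decoupled hp hCF hBc n
  have e2 := hF.sum_norm_condAvg_le B hp hCF hc ft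
  have e3 : ∀ w : (Fin n → α) × (Fin n → α), ∀ k ∈ Finset.range n,
      B (c k (mix k w.1 w.2)) (condAvg k f (mix k w.1 w.2))
        = B (c k (mix k w.1 w.2)) (condAvg k ft w.1) := fun w k hk => by
    rw [(sat_condAvg k f).mix le_rfl]
    by_cases h : lastStop m k w.1 = j
    · have hjk : j ≤ k := h ▸ lastStop_le k w.1
      rw [hft, condAvg_stopped hms f hjk (Finset.mem_range.1 hk).le, stopped_of_lastStop_eq f h]
    · have : c k (mix k w.1 w.2) = 0 := by
        simp only [hcdef, hV, (hσ k).mix le_rfl, if_neg h, zero_smul]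
      simp [this]
  set ψ : (Fin n → α) → ℝ := fun x => if lastStop m j x = j then m j x else 0 with hψ
  have hψs : Sat (Agree j) ψ := fun w w' h => by simp only [hψ, hσ j w w' h, hms j w w' h]
  have hψ0 : ∀ x, 0 ≤ ψ x := fun x => by
    simp only [hψ]; split_ifs
    exacts [hm0 j x, le_rfl]
  -- The bound `ψ` for the stopped function is moved into the differences of `b`. It is known only
  -- from time `j` on, hence the cut-off, which loses nothing because `V k = 0` for `k < j`.
  set e : ℕ → (Fin n → α) → T := fun k x => (if j ≤ k then ψ x else 0) • d k x with he
  have hec : IsCoordDiff e := hdc.smul fun k w w' h => by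
    split_ifs with hjk
    · exact hψs.mono hjk w w' h
    · rfl
  have e4 := hT.sum_norm_decoupled_le hp hCT hec n V
    (fun k x => by simp only [hV]; split_ifs; exacts [hv k x, Or.inr rfl]) hVs
  -- The argument in `E` no longer depends on `k`, so the sum over `k` can be taken in `T`.
  have e5 : ∀ w : (Fin n → α) × (Fin n → α),
      ‖∑ k ∈ Finset.range n, B (c k (mix k w.1 w.2)) (ft w.1)‖
        ≤ 2 * M * ‖∑ k ∈ Finset.range n, V k w.1 • e k (mix k w.1 w.2)‖ := fun w => by
    have h1 : ∑ k ∈ Finset.range n, V k w.1 • e k (mix k w.1 w.2)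
        = ψ w.1 • ∑ k ∈ Finset.range n, c k (mix k w.1 w.2) := by
      rw [Finset.smul_sum]
      refine Finset.sum_congr rfl fun k _ => ?_
      simp only [hcdef, he, (hVs k).mix le_rfl]
      by_cases h : lastStop m k w.1 = j
      · have hjk : j ≤ k := h ▸ lastStop_le k w.1
        rw [if_pos hjk, hψs.mix hjk, smul_comm]
      · simp [hV, h]
    have h2 : ∑ k ∈ Finset.range n, B (c k (mix k w.1 w.2)) (ft w.1)
        = B (∑ k ∈ Finset.range n, c k (mix k w.1 w.2)) (ft w.1) := by
      rw [map_sum, LinearMap.sum_apply]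
    rw [h1, h2, norm_smul, Real.norm_of_nonneg (hψ0 _)]
    by_cases h : lastStop m j w.1 = j
    · refine (hB _ _).trans ?_
      have := norm_stopped_le f hj (x := w.1)
      simp only [hψ, if_pos h]
      calc _ ≤ ‖∑ k ∈ Finset.range n, c k (mix k w.1 w.2)‖ * (2 * M * m j w.1) := by gcongr
        _ = _ := by ring
    · have h3 : ∑ k ∈ Finset.range n, c k (mix k w.1 w.2) = 0 := Finset.sum_eq_zero fun k _ => by
        have : lastStop m k w.1 ≠ j := fun h' => h (lastStop_self_of_eq h')
        simp only [hcdef, hV, (hσ k).mix le_rfl, if_neg this, zero_smul]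
      simp [h3]
  have e6 : ∀ x, ∑ k ∈ Finset.range n, e k x = ψ x • (b x - condAvg j b x) := fun x => by
    have h1 : ∀ N, j ≤ N → ∑ k ∈ Finset.range N, e k x
        = ψ x • (condAvg N b x - condAvg j b x) := fun N hN => by
      induction N, hN using Nat.le_induction with
      | base =>
        rw [sub_self, smul_zero]
        refine Finset.sum_eq_zero fun k hk => ?_
        simp [he, not_le.2 (Finset.mem_range.1 hk)]
      | succ N hN ih =>
        rw [Finset.sum_range_succ, ih]
        simp only [he, if_pos hN, hd]
        rw [← smul_add]
        congr 1
        abel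
    rw [h1 n hj, condAvg_of_le le_rfl]
  have e7 : ∑ x, ‖∑ k ∈ Finset.range n, e k x‖ ^ p ≤ β ^ p * ∑ x, ψ x ^ p := by
    have h1 : ∀ x, ‖∑ k ∈ Finset.range n, e k x‖ ^ p = ψ x ^ p * ‖b x - condAvg j b x‖ ^ p :=
      fun x => by
        rw [e6, norm_smul, Real.norm_of_nonneg (hψ0 x), Real.mul_rpow (hψ0 x) (norm_nonneg _)]
    simp only [h1]
    rw [← sum_mul_condAvg (k := j) (φ := fun x => ψ x ^ p)
      (fun w w' h => by beta_reduce; rw [hψs w w' h]), Finset.mul_sum]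
    refine Finset.sum_le_sum fun x _ => ?_
    rw [mul_comm (β ^ p)]
    exact mul_le_mul_of_nonneg_left (hb j x) (Real.rpow_nonneg (hψ0 x) p)
  have e8 : ∀ x, ψ x ^ p
      = if lastStop m j x = j then condAvg j (fun z => ‖f z‖) x ^ p else 0 := fun x => by
    simp only [hψ]
    split_ifs
    · rfl
    · exact Real.zero_rpow hp0.ne'
  have e9 : ∀ x, (∑ k ∈ Finset.range n, if lastStop m k x = j then
      v k x • B (condAvg (k + 1) b x - condAvg k b x) (condAvg k f x) else 0)
      = ∑ k ∈ Finset.range n, B (c k x) (condAvg k f x) := fun x => by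
    refine Finset.sum_congr rfl fun k _ => ?_
    simp only [hcdef, hV, hd]
    split_ifs <;> simp
  simp only [e9]
  -- Doubling the probability space multiplies undecoupled sums by `Nc`, which cancels at the end.
  set Nc : ℝ := (Fintype.card (Fin n → α) : ℝ) with hNc
  have hNc0 : 0 < Nc := by rw [hNc]; exact_mod_cast Fintype.card_pos
  have e10 : ∀ g : (Fin n → α) → ℝ, ∑ w : (Fin n → α) × (Fin n → α), g w.1 = Nc * ∑ x, g x :=
    fun g => by
      rw [Fintype.sum_prod_type_right]
      simp [hNc]
  rw [e10 fun x => ‖∑ k ∈ Finset.range n, B (c k x) (condAvg k f x)‖ ^ p] at e1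
  rw [e10 fun x => ‖∑ k ∈ Finset.range n, e k x‖ ^ p] at e4
  have e11 : ∑ w : (Fin n → α) × (Fin n → α),
      ‖∑ k ∈ Finset.range n, B (c k (mix k w.1 w.2)) (condAvg k f (mix k w.1 w.2))‖ ^ p
      = ∑ w : (Fin n → α) × (Fin n → α),
        ‖∑ k ∈ Finset.range n, B (c k (mix k w.1 w.2)) (condAvg k ft w.1)‖ ^ p :=
    Finset.sum_congr rfl fun w _ => by rw [Finset.sum_congr rfl (e3 w)]
  rw [e11] at e1
  have e12 : ∑ w : (Fin n → α) × (Fin n → α),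
      ‖∑ k ∈ Finset.range n, B (c k (mix k w.1 w.2)) (ft w.1)‖ ^ p
      ≤ (2 * M) ^ p * ∑ w : (Fin n → α) × (Fin n → α),
        ‖∑ k ∈ Finset.range n, V k w.1 • e k (mix k w.1 w.2)‖ ^ p := by
    rw [Finset.mul_sum]
    refine Finset.sum_le_sum fun w _ => ?_
    rw [← Real.mul_rpow (by positivity) (norm_nonneg _)]
    exact Real.rpow_le_rpow (norm_nonneg _) (e5 w) hp0.le
  simp only [← e8]
  have hCFp : 0 ≤ CF ^ p := by positivity
  refine le_of_mul_le_mul_left (a := Nc) ?_ hNc0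
  calc _ ≤ CF ^ p * (CF ^ p * ((2 * M) ^ p * (CT ^ p * (Nc * (β ^ p * ∑ x, ψ x ^ p))))) := by
        refine e1.trans (mul_le_mul_of_nonneg_left (e2.trans (mul_le_mul_of_nonneg_left
          (e12.trans (mul_le_mul_of_nonneg_left (e4.trans ?_) (by positivity))) hCFp)) hCFp)
        gcongr
    _ = _ := by
        have hM2 : 0 ≤ 2 * M := by positivity
        rw [show 2 * M * CF ^ 2 * CT * β = 2 * M * (CF * (CF * (CT * β))) by ring]
        generalize 2 * M = K at hM2 ⊢
        rw [Real.mul_rpow hM2 (by positivity), Real.mul_rpow hCF (by positivity),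
          Real.mul_rpow hCF (by positivity), Real.mul_rpow hCT hβ]
        ring

/-- The estimate of the paraproduct on a finite tree. -/
theorem sum_norm_paraproduct_le (hp : 1 < p) (hCF : 0 ≤ CF) (hCT : 0 ≤ CT) (hβ : 0 ≤ β)
    (hF : IsUMDBound p F (ENNReal.ofReal CF)) (hT : IsUMDBound p T (ENNReal.ofReal CT))
    (hB : ∀ t e, ‖B t e‖ ≤ ‖t‖ * ‖e‖)
    (hb : ∀ k x, condAvg k (fun z => ‖b z - condAvg k b z‖ ^ p) x ≤ β ^ p)
    (hv : ∀ k x, v k x = 1 ∨ v k x = 0) (hv' : ∀ k, Sat (Agree k) (v k)) :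
    ∑ x, ‖∑ k ∈ Finset.range n,
        v k x • B (condAvg (k + 1) b x - condAvg k b x) (condAvg k f x)‖ ^ p
      ≤ (6 * Fintype.card α * p * (p / (p - 1)) * CF ^ 2 * CT * β) ^ p * ∑ x, ‖f x‖ ^ p := by
  set m : ℕ → (Fin n → α) → ℝ := fun k => condAvg k fun z => ‖f z‖ with hm
  have hms : ∀ k, Sat (Agree k) (m k) := fun k => sat_condAvg k _
  have hσ := sat_lastStop hms
  have hp0 : 0 < p := by linarith
  have hp1 : 0 < p - 1 := by linarith
  set M : ℝ := (Fintype.card α : ℝ) with hM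
  have hM0 : 0 ≤ M := by positivity
  set D : ℕ → (Fin n → α) → F := fun k x =>
    v k x • B (condAvg (k + 1) b x - condAvg k b x) (condAvg k f x) with hD
  have hDs : ∀ k, Sat (Agree (k + 1)) (D k) := fun k w w' h => by
    simp only [hD]
    rw [hv' k w w' (h.mono k.le_succ), sat_condAvg _ b w w' h,
      sat_condAvg _ b w w' (h.mono k.le_succ), sat_condAvg _ f w w' (h.mono k.le_succ)]
  set g : ℕ → (Fin n → α) → F := fun j x => ∑ k ∈ Finset.range n,
    if lastStop m k x = j then D k x else 0 with hg
  have h1 : ∀ x, ∑ k ∈ Finset.range n, D k x = ∑ j ∈ Finset.range n, g j x := fun x => by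
    simp only [hg]
    rw [Finset.sum_comm]
    refine Finset.sum_congr rfl fun k hk => ?_
    rw [Finset.sum_ite_eq, if_pos]
    exact Finset.mem_range.2 ((lastStop_le k x).trans_lt (Finset.mem_range.1 hk))
  have h2 := sum_rpow_sum_le hp (u := fun z => ‖f z‖) (fun _ => norm_nonneg _)
    (g := fun j x => ‖g j x‖) (fun _ _ => norm_nonneg _)
    (fun j x hj => by
      rw [norm_eq_zero]
      exact Finset.sum_eq_zero fun k _ => if_neg fun h => hj (lastStop_self_of_eq h))
    (fun j k hjk w w' h => by
      beta_reduce
      rw [hσ k w w' h]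
      split_ifs with hk
      · rfl
      · congr 1
        refine Finset.sum_congr rfl fun i _ => ?_
        rcases lt_or_ge i k with hik | hik
        · rw [hσ i w w' (h.mono hik.le), hDs i w w' (h.mono hik)]
        · have hk' : lastStop m k w ≠ j := by rw [hσ k w w' h]; exact hk
          rw [if_neg (lastStop_ne_of_le hk hjk hik), if_neg (lastStop_ne_of_le hk' hjk hik)])
  have h3 : ∀ j ∈ Finset.range n, ∑ x, ‖g j x‖ ^ p ≤ (2 * M * CF ^ 2 * CT * β) ^ p *
      ∑ x, if lastStop m j x = j then m j x ^ p else 0 := fun j hj =>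
    sum_norm_paraproduct_stop_le B hp.le hCF hCT hβ hF hT hB hb hv hv' (Finset.mem_range.1 hj).le
  have h4 := carleson_embedding hp (u := fun z => ‖f z‖) (h := fun z => ‖f z‖) (n := n)
    (fun _ => norm_nonneg _) (fun _ => norm_nonneg _)
  have h5 : ∑ j ∈ Finset.range n, ∑ x, (if lastStop m j x = j then m j x ^ p else 0)
      ≤ 2 * (p / (p - 1)) ^ p * ∑ x, ‖f x‖ ^ p := by
    refine le_trans ?_ h4
    rw [Finset.sum_range_succ]
    refine le_add_of_nonneg_right (Finset.sum_nonneg fun x _ => ?_)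
    split_ifs
    · exact Real.rpow_nonneg (condAvg_nonneg n (fun _ => norm_nonneg _) x) p
    · rfl
  have hK : 0 ≤ 2 * M * CF ^ 2 * CT * β := by positivity
  calc _ ≤ ∑ x, (∑ j ∈ Finset.range n, ‖g j x‖) ^ p := by
        refine Finset.sum_le_sum fun x _ => Real.rpow_le_rpow (norm_nonneg _) ?_ hp0.le
        rw [show (∑ k ∈ Finset.range n, v k x • B (condAvg (k + 1) b x - condAvg k b x)
          (condAvg k f x)) = _ from h1 x]
        exact norm_sum_le _ _
    _ ≤ 3 ^ (p - 1) * p ^ p * ∑ j ∈ Finset.range n, ∑ x, ‖g j x‖ ^ p := h2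
    _ ≤ 3 ^ (p - 1) * p ^ p * ((2 * M * CF ^ 2 * CT * β) ^ p *
          (2 * (p / (p - 1)) ^ p * ∑ x, ‖f x‖ ^ p)) := by
        refine mul_le_mul_of_nonneg_left ?_ (by positivity)
        refine (Finset.sum_le_sum h3).trans ?_
        rw [← Finset.mul_sum]
        exact mul_le_mul_of_nonneg_left h5 (by positivity)
    -- Here `2 * 3 ^ (p - 1) ≤ 3 ^ p`; the `3` and the `2` from the stopped function make up the `6`
    -- of the theorem.
    _ ≤ 3 ^ p * p ^ p * ((2 * M * CF ^ 2 * CT * β) ^ p *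
          ((p / (p - 1)) ^ p * ∑ x, ‖f x‖ ^ p)) := by
        have h6 : (3 : ℝ) ^ p = 3 ^ (p - 1) * 3 := by
          rw [← Real.rpow_add_one (by norm_num)]; congr 1; ring
        have h7 : 0 ≤ 3 ^ (p - 1) * p ^ p * ((2 * M * CF ^ 2 * CT * β) ^ p *
          ((p / (p - 1)) ^ p * ∑ x, ‖f x‖ ^ p)) := by
          have : 0 ≤ ∑ x, ‖f x‖ ^ p := Finset.sum_nonneg fun x _ => by positivity
          positivity
        rw [h6]
        linarith
    _ = _ := by
        rw [show 6 * M * p * (p / (p - 1)) * CF ^ 2 * CT * β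
          = 3 * p * (2 * M * CF ^ 2 * CT * β) * (p / (p - 1)) by ring]
        generalize 2 * M * CF ^ 2 * CT * β = K at hK ⊢
        rw [Real.mul_rpow (by positivity) (by positivity), Real.mul_rpow (by positivity) hK,
          Real.mul_rpow (by positivity) (by positivity)]
        ring

/-- The UMD inequality for multipliers of the martingale differences of a function. -/
theorem IsUMDBound.sum_norm_coordDiff_le (hp : 1 ≤ p) (hCF : 0 ≤ CF)
    (hF : IsUMDBound p F (ENNReal.ofReal CF)) (g : (Fin n → α) → F)
    (hv : ∀ k x, v k x = 1 ∨ v k x = 0) (hv' : ∀ k, Sat (Agree k) (v k)) :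
    ∑ x, ‖∑ k ∈ Finset.range n, v k x • (condAvg (k + 1) g x - condAvg k g x)‖ ^ p
      ≤ CF ^ p * ∑ x, ‖g x - condAvg 0 g x‖ ^ p := by
  have hd := isCoordDiff_condAvg_succ_sub g
  have key := hF.sum_le_of_predictable hp hCF (r := Agree) ⟨fun k w w' h => h.mono k.le_succ,
    hd.sat, fun k φ hφ => hd.orth hφ⟩ n v
    (fun k x => by rcases hv k x with h | h <;> simp [h]) hv'
  have htel : ∀ x, ∑ k ∈ Finset.range n, (condAvg (k + 1) g x - condAvg k g x)
      = g x - condAvg 0 g x := fun x => by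
    rw [Finset.sum_range_sub fun k => condAvg k g x, condAvg_of_le le_rfl]
  simpa only [htel] using key

end Paraproduct

/-! ### Geometry of the dyadic cubes -/

section Geometry

variable {d : ℕ} (ω : Shift d)

theorem summable_offset (k : ℤ) (i : Fin d) :
    Summable fun j : ℕ => (2 : ℝ) ^ (-(k + 1 + (j : ℤ))) * ((ω (k + 1 + (j : ℤ)) i).val : ℝ) := by
  refine Summable.of_nonneg_of_le (fun j => by positivity) (fun j => ?_)
    (summable_geometric_two.mul_left ((2 : ℝ) ^ (-(k + 1))))
  have h1 : ((ω (k + 1 + (j : ℤ)) i).val : ℝ) ≤ 1 := by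
    have := (ω (k + 1 + (j : ℤ)) i).isLt
    exact_mod_cast Nat.lt_succ_iff.1 this
  have h2 : (2 : ℝ) ^ (-(k + 1 + (j : ℤ))) = 2 ^ (-(k + 1)) * (1 / 2) ^ j := by
    rw [neg_add (k + 1), zpow_add₀ (by norm_num), zpow_neg _ (j : ℤ), zpow_natCast, one_div,
      inv_pow]
  rw [h2]
  exact mul_le_of_le_one_right (by positivity) h1

theorem offset_eq (k : ℤ) (i : Fin d) :
    ω.offset k i = (2 : ℝ) ^ (-(k + 1)) * ((ω (k + 1) i).val : ℝ) + ω.offset (k + 1) i := by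
  rw [Shift.offset, (summable_offset ω k i).tsum_eq_zero_add, Shift.offset]
  congr 1
  · simp
  · refine tsum_congr fun j => ?_
    rw [show k + 1 + ((j + 1 : ℕ) : ℤ) = k + 1 + 1 + (j : ℤ) by push_cast; ring]

/-- The position of `x` in the lattice of lower corners of the cubes of side length `2 ^ (-k)`. -/
noncomputable def latticePos (k : ℤ) (x : Fin d → ℝ) (i : Fin d) : ℝ :=
  (2 : ℝ) ^ k * (x i - ω.offset k i)

/-- The cube of side length `2 ^ (-k)` that contains `x`. -/
noncomputable def cubeAt (k : ℤ) (x : Fin d → ℝ) : DyadicCube d :=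
  ⟨k, fun i => ⌊latticePos ω k x i⌋⟩

variable {ω}

theorem mem_cube_iff_floor {Q : DyadicCube d} {x : Fin d → ℝ} :
    x ∈ cube ω Q ↔ ∀ i, ⌊latticePos ω Q.scale x i⌋ = Q.corner i := by
  refine forall_congr' fun i => ?_
  have h2 : (0 : ℝ) < 2 ^ (-Q.scale) := by positivity
  have h3 : x i = 2 ^ (-Q.scale) * latticePos ω Q.scale x i + ω.offset Q.scale i := by
    rw [latticePos, ← mul_assoc, ← zpow_add₀ (by norm_num)]; simp
  rw [Int.floor_eq_iff, h3, add_le_add_iff_right, add_lt_add_iff_right,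
    mul_le_mul_iff_right₀ h2, mul_lt_mul_iff_right₀ h2]

theorem mem_cube_iff {Q : DyadicCube d} {x : Fin d → ℝ} :
    x ∈ cube ω Q ↔ cubeAt ω Q.scale x = Q := by
  rw [mem_cube_iff_floor]
  cases Q
  simp [cubeAt, funext_iff]

theorem mem_cube_cubeAt (k : ℤ) (x : Fin d → ℝ) : x ∈ cube ω (cubeAt ω k x) := mem_cube_iff.2 rfl

theorem eq_of_mem_cube {Q Q' : DyadicCube d} (h : Q.scale = Q'.scale) {x : Fin d → ℝ}
    (hx : x ∈ cube ω Q) (hx' : x ∈ cube ω Q') : Q = Q' := by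
  rw [← mem_cube_iff.1 hx, ← mem_cube_iff.1 hx', h]

theorem latticePos_succ (k : ℤ) (x : Fin d → ℝ) (i : Fin d) :
    latticePos ω (k + 1) x i = 2 * latticePos ω k x i + (((ω (k + 1) i).val : ℤ) : ℝ) := by
  have h1 : (2 : ℝ) ^ (k + 1) = 2 * 2 ^ k := by rw [zpow_add_one₀ (by norm_num)]; ring
  have h2 : 2 * (2 : ℝ) ^ k * 2 ^ (-(k + 1)) = 1 := by
    rw [← h1, ← zpow_add₀ (by norm_num)]; simp
  simp only [latticePos]
  rw [offset_eq ω k i, Int.cast_natCast]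
  linear_combination (x i - ω.offset (k + 1) i) * h1 + ((ω (k + 1) i).val : ℝ) * h2

/-- The digit of `ω` enters both the lattice position and the corner of the child and cancels, which
leaves plain bisection. -/
theorem mem_cube_child_iff {Q : DyadicCube d} {η : Fin d → Fin 2} {x : Fin d → ℝ} :
    x ∈ cube ω (child ω Q η) ↔
      ∀ i, ⌊2 * latticePos ω Q.scale x i⌋ = 2 * Q.corner i + ((η i).val : ℤ) := by
  rw [mem_cube_iff_floor]
  refine forall_congr' fun i => ?_
  simp only [child, latticePos_succ, Int.floor_add_intCast]
  constructor <;> intro h <;> linarith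

theorem cube_child_subset (Q : DyadicCube d) (η : Fin d → Fin 2) :
    cube ω (child ω Q η) ⊆ cube ω Q := fun x hx => by
  rw [mem_cube_child_iff] at hx
  refine mem_cube_iff_floor.2 fun i => ?_
  have h1 := Int.floor_eq_iff.1 (hx i)
  have h2 : (((η i).val : ℤ) : ℝ) ≤ 1 := by
    have := (η i).isLt
    exact_mod_cast Nat.lt_succ_iff.1 this
  have h3 : (0 : ℝ) ≤ (((η i).val : ℤ) : ℝ) := by positivity
  push_cast at h1 h2 h3
  rw [Int.floor_eq_iff]
  constructor <;> linarith [h1.1, h1.2]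

theorem exists_mem_cube_child {Q : DyadicCube d} {x : Fin d → ℝ} (hx : x ∈ cube ω Q) :
    ∃ η, x ∈ cube ω (child ω Q η) := by
  have h1 : ∀ i, ∃ a : Fin 2, ⌊2 * latticePos ω Q.scale x i⌋ = 2 * Q.corner i + (a.val : ℤ) :=
    fun i => by
      have h2 := Int.floor_eq_iff.1 (mem_cube_iff_floor.1 hx i)
      rcases lt_or_ge (2 * latticePos ω Q.scale x i) (2 * Q.corner i + 1) with h | h
      · refine ⟨0, Int.floor_eq_iff.2 ?_⟩
        rw [show ((0 : Fin 2).val : ℤ) = 0 from rfl]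
        push_cast
        constructor <;> linarith [h2.1]
      · refine ⟨1, Int.floor_eq_iff.2 ?_⟩
        rw [show ((1 : Fin 2).val : ℤ) = 1 from rfl]
        push_cast
        constructor <;> linarith [h2.2]
  choose η hη using h1
  exact ⟨η, mem_cube_child_iff.2 hη⟩

theorem child_injective (Q : DyadicCube d) : Function.Injective (child ω Q) := fun η η' h => by
  have h1 := congrArg DyadicCube.corner h
  funext i
  have h2 := congrFun h1 i
  simp only [child, add_right_inj] at h2
  exact Fin.ext (by exact_mod_cast h2)

@[simp] theorem scale_child (Q : DyadicCube d) (η : Fin d → Fin 2) :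
    (child ω Q η).scale = Q.scale + 1 := rfl

theorem iUnion_cube_child (Q : DyadicCube d) : ⋃ η, cube ω (child ω Q η) = cube ω Q :=
  Set.Subset.antisymm (Set.iUnion_subset fun η => cube_child_subset Q η) fun _ hx =>
    Set.mem_iUnion.2 (exists_mem_cube_child hx)

theorem disjoint_cube {Q Q' : DyadicCube d} (h : Q.scale = Q'.scale) (hne : Q ≠ Q') :
    Disjoint (cube ω Q) (cube ω Q') :=
  Set.disjoint_left.2 fun _ hx hx' => hne (eq_of_mem_cube h hx hx')

theorem disjoint_cube_child (Q : DyadicCube d) :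
    Pairwise fun η η' => Disjoint (cube ω (child ω Q η)) (cube ω (child ω Q η')) :=
  fun _ _ h => disjoint_cube rfl fun h' => h (child_injective Q h')

theorem cube_eq_pi (Q : DyadicCube d) : cube ω Q = Set.pi Set.univ fun i =>
    Set.Ico ((2 : ℝ) ^ (-Q.scale) * (Q.corner i : ℝ) + ω.offset Q.scale i)
      ((2 : ℝ) ^ (-Q.scale) * ((Q.corner i : ℝ) + 1) + ω.offset Q.scale i) := by
  ext x; simp [cube, Set.mem_pi]

theorem measurableSet_cube (Q : DyadicCube d) : MeasurableSet (cube ω Q) := by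
  rw [cube_eq_pi]
  exact MeasurableSet.univ_pi fun i => measurableSet_Ico

theorem volume_cube (Q : DyadicCube d) :
    volume (cube ω Q) = ENNReal.ofReal (((2 : ℝ) ^ (-Q.scale)) ^ d) := by
  rw [cube_eq_pi, Real.volume_pi_Ico]
  have : ∀ i, (2 : ℝ) ^ (-Q.scale) * ((Q.corner i : ℝ) + 1) + ω.offset Q.scale i -
      ((2 : ℝ) ^ (-Q.scale) * (Q.corner i : ℝ) + ω.offset Q.scale i) = 2 ^ (-Q.scale) :=
    fun i => by ring
  simp only [this, Finset.prod_const, Finset.card_univ, Fintype.card_fin]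
  rw [ENNReal.ofReal_pow (by positivity)]

theorem volume_real_cube (Q : DyadicCube d) :
    volume.real (cube ω Q) = ((2 : ℝ) ^ (-Q.scale)) ^ d := by
  rw [Measure.real, volume_cube, ENNReal.toReal_ofReal (by positivity)]

theorem volume_real_cube_pos (Q : DyadicCube d) : 0 < volume.real (cube ω Q) := by
  rw [volume_real_cube]; positivity

theorem volume_cube_ne_top (Q : DyadicCube d) : volume (cube ω Q) ≠ ⊤ := by
  rw [volume_cube]; exact ENNReal.ofReal_ne_top

theorem volume_cube_ne_zero (Q : DyadicCube d) : volume (cube ω Q) ≠ 0 := by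
  rw [volume_cube]
  exact (ENNReal.ofReal_pos.2 (by positivity)).ne'

theorem volume_real_cube_child (Q : DyadicCube d) (η : Fin d → Fin 2) :
    volume.real (cube ω Q) = 2 ^ d * volume.real (cube ω (child ω Q η)) := by
  rw [volume_real_cube, volume_real_cube, scale_child, ← mul_pow]
  congr 1
  rw [neg_add, zpow_add₀ (by norm_num)]
  norm_num
  ring

instance (Q : DyadicCube d) : IsFiniteMeasure (volume.restrict (cube ω Q)) :=
  ⟨by simpa using (volume_cube_ne_top Q).lt_top⟩

theorem LocallyIntegrable.integrableOn_cube {F : Type*} [NormedAddCommGroup F]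
    {g : (Fin d → ℝ) → F} (hg : LocallyIntegrable g volume) (Q : DyadicCube d) :
    IntegrableOn g (cube ω Q) := by
  refine (hg.integrableOn_isCompact (isCompact_univ_pi fun i => isCompact_Icc
    (a := (2 : ℝ) ^ (-Q.scale) * (Q.corner i : ℝ) + ω.offset Q.scale i)
    (b := (2 : ℝ) ^ (-Q.scale) * ((Q.corner i : ℝ) + 1) + ω.offset Q.scale i))).mono_set ?_
  rw [cube_eq_pi]
  exact Set.pi_mono fun i _ => Set.Ico_subset_Icc_self

end Geometry

/-! ### Averages and Haar projections on cubes -/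

section Averages

variable {d : ℕ} {ω : Shift d} {F : Type*} [NormedAddCommGroup F] [NormedSpace ℝ F]
  [CompleteSpace F]

theorem avg_eq (Q : DyadicCube d) (g : (Fin d → ℝ) → F) :
    avg ω Q g = (volume.real (cube ω Q))⁻¹ • ∫ x in cube ω Q, g x := by
  rw [avg, setAverage_eq]

theorem avg_eq_sum_child {Q : DyadicCube d} {g : (Fin d → ℝ) → F}
    (hg : IntegrableOn g (cube ω Q)) :
    avg ω Q g = (Fintype.card (Fin d → Fin 2) : ℝ)⁻¹ • ∑ η, avg ω (child ω Q η) g := by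
  have h1 : ∫ x in cube ω Q, g x = ∑ η, ∫ x in cube ω (child ω Q η), g x := by
    rw [← iUnion_cube_child (ω := ω) Q, integral_iUnion_fintype
      (fun η => measurableSet_cube _) (disjoint_cube_child Q)
      fun η => hg.mono_set (cube_child_subset Q η)]
  rw [avg_eq, h1, Finset.smul_sum, Finset.smul_sum]
  refine Finset.sum_congr rfl fun η _ => ?_
  rw [avg_eq, smul_smul, volume_real_cube_child Q η, mul_inv]
  simp

theorem avg_congr {Q : DyadicCube d} {g g' : (Fin d → ℝ) → F}
    (h : ∀ x ∈ cube ω Q, g x = g' x) : avg ω Q g = avg ω Q g' := by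
  rw [avg_eq, avg_eq, setIntegral_congr_fun (measurableSet_cube Q) h]

theorem avg_const (Q : DyadicCube d) (v : F) : avg ω Q (fun _ => v) = v := by
  rw [avg_eq, setIntegral_const, inv_smul_smul₀ (volume_real_cube_pos Q).ne']

theorem avg_sub {Q : DyadicCube d} {g g' : (Fin d → ℝ) → F} (hg : IntegrableOn g (cube ω Q))
    (hg' : IntegrableOn g' (cube ω Q)) :
    avg ω Q (fun x => g x - g' x) = avg ω Q g - avg ω Q g' := by
  rw [avg_eq, avg_eq, avg_eq, integral_sub hg hg', smul_sub]

theorem avg_add {Q : DyadicCube d} {g g' : (Fin d → ℝ) → F} (hg : IntegrableOn g (cube ω Q))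
    (hg' : IntegrableOn g' (cube ω Q)) :
    avg ω Q (fun x => g x + g' x) = avg ω Q g + avg ω Q g' := by
  rw [avg_eq, avg_eq, avg_eq, integral_add hg hg', smul_add]

theorem avg_clm {G : Type*} [NormedAddCommGroup G] [NormedSpace ℝ G] [CompleteSpace G]
    (L : F →L[ℝ] G) {Q : DyadicCube d} {g : (Fin d → ℝ) → F} (hg : IntegrableOn g (cube ω Q)) :
    avg ω Q (fun x => L (g x)) = L (avg ω Q g) := by
  rw [avg_eq, avg_eq, L.integral_comp_comm hg, map_smul]

theorem avg_mono {Q : DyadicCube d} {g g' : (Fin d → ℝ) → ℝ} (hg : IntegrableOn g (cube ω Q))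
    (hg' : IntegrableOn g' (cube ω Q)) (h : ∀ x ∈ cube ω Q, g x ≤ g' x) :
    avg ω Q g ≤ avg ω Q g' := by
  rw [avg_eq, avg_eq]
  exact smul_le_smul_of_nonneg_left (setIntegral_mono_on hg hg' (measurableSet_cube Q) h)
    (by positivity)

theorem integrableOn_norm_rpow {p : ℝ} (hp : 0 < p) {Q : DyadicCube d} {g : (Fin d → ℝ) → F}
    (hg : MemLp g (ENNReal.ofReal p) (volume.restrict (cube ω Q))) :
    IntegrableOn (fun x => ‖g x‖ ^ p) (cube ω Q) := by
  have := hg.integrable_norm_rpow (by simpa using hp) (by simp)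
  rwa [ENNReal.toReal_ofReal hp.le] at this

theorem MemLp.integrableOn_cube {p : ℝ} (hp : 1 ≤ p) {Q : DyadicCube d} {g : (Fin d → ℝ) → F}
    (hg : MemLp g (ENNReal.ofReal p) (volume.restrict (cube ω Q))) : IntegrableOn g (cube ω Q) :=
  hg.integrable (by simpa using hp)

/-- Jensen's inequality for averages over cubes. -/
theorem norm_avg_rpow_le {p : ℝ} (hp : 1 ≤ p) {Q : DyadicCube d} {g : (Fin d → ℝ) → F}
    (hg : MemLp g (ENNReal.ofReal p) (volume.restrict (cube ω Q))) :
    ‖avg ω Q g‖ ^ p ≤ avg ω Q fun x => ‖g x‖ ^ p := by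
  have hgi := MemLp.integrableOn_cube hp hg
  have h1 : ‖avg ω Q g‖ ≤ avg ω Q fun x => ‖g x‖ := by
    rw [avg_eq, avg_eq, norm_smul, norm_inv, Real.norm_of_nonneg (volume_real_cube_pos Q).le,
      smul_eq_mul]
    gcongr
    exact norm_integral_le_integral_norm _
  have : NeZero (volume.restrict (cube ω Q)) := ⟨by
    rw [Ne, Measure.restrict_eq_zero]; exact volume_cube_ne_zero Q⟩
  have h2 := (convexOn_rpow hp).map_average_le (μ := volume.restrict (cube ω Q))
    (f := fun x => ‖g x‖) ((Real.continuous_rpow_const (by linarith)).continuousOn) isClosed_Ici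
    (Eventually.of_forall fun x => Set.mem_Ici.2 (norm_nonneg _)) hgi.norm
    (integrableOn_norm_rpow (by linarith) hg)
  exact (Real.rpow_le_rpow (norm_nonneg _) h1 (by linarith)).trans h2

theorem haarProj_of_mem {Q : DyadicCube d} {η : Fin d → Fin 2} (g : (Fin d → ℝ) → F)
    {x : Fin d → ℝ} (hx : x ∈ cube ω (child ω Q η)) :
    haarProj ω Q g x = avg ω (child ω Q η) g - avg ω Q g := by
  rw [haarProj, Set.indicator_of_mem (cube_child_subset Q η hx), Finset.sum_eq_single η,
    Set.indicator_of_mem hx]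
  · intro η' _ hne
    refine Set.indicator_of_notMem (fun hx' => hne ?_) _
    exact child_injective Q (eq_of_mem_cube rfl hx' hx)
  · simp

theorem haarProj_of_notMem {Q : DyadicCube d} (g : (Fin d → ℝ) → F)
    {x : Fin d → ℝ} (hx : x ∉ cube ω Q) : haarProj ω Q g x = 0 := by
  rw [haarProj, Set.indicator_of_notMem hx, sub_zero]
  exact Finset.sum_eq_zero fun η _ =>
    Set.indicator_of_notMem (fun h => hx (cube_child_subset Q η h)) _

theorem memLp_haarProj (Q : DyadicCube d) (g : (Fin d → ℝ) → F) (q : ℝ≥0∞) :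
    MemLp (haarProj ω Q g) q volume := by
  have h1 : ∀ (Q : DyadicCube d) (v : F), MemLp ((cube ω Q).indicator fun _ => v) q volume :=
    fun Q v => memLp_indicator_const q (measurableSet_cube Q) v (Or.inr (volume_cube_ne_top Q))
  have h2 : MemLp (fun x => ∑ η, (cube ω (child ω Q η)).indicator
      (fun _ => avg ω (child ω Q η) g) x) q volume := memLp_finsetSum _ fun η _ => h1 _ _
  exact h2.sub (h1 _ _)

theorem haarProj_clm {G : Type*} [NormedAddCommGroup G] [NormedSpace ℝ G] [CompleteSpace G]
    (L : F →L[ℝ] G) {Q : DyadicCube d} {g : (Fin d → ℝ) → F} (hg : IntegrableOn g (cube ω Q))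
    (x : Fin d → ℝ) : haarProj ω Q (fun x => L (g x)) x = L (haarProj ω Q g x) := by
  by_cases hx : x ∈ cube ω Q
  · obtain ⟨η, hη⟩ := exists_mem_cube_child hx
    rw [haarProj_of_mem _ hη, haarProj_of_mem _ hη, avg_clm L hg,
      avg_clm L (hg.mono_set (cube_child_subset Q η)), map_sub]
  · rw [haarProj_of_notMem _ hx, haarProj_of_notMem _ hx, map_zero]

theorem haarProj_congr {Q : DyadicCube d} {g g' : (Fin d → ℝ) → F}
    (h : ∀ x ∈ cube ω Q, g x = g' x) : haarProj ω Q g = haarProj ω Q g' := by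
  funext x
  by_cases hx : x ∈ cube ω Q
  · obtain ⟨η, hη⟩ := exists_mem_cube_child hx
    rw [haarProj_of_mem _ hη, haarProj_of_mem _ hη, avg_congr h,
      avg_congr fun y hy => h y (cube_child_subset Q η hy)]
  · rw [haarProj_of_notMem _ hx, haarProj_of_notMem _ hx]

end Averages

/-! ### The tree of descendants of a cube -/

section Tree

variable {d n : ℕ} (ω : Shift d) (R : DyadicCube d)

/-- The descendants of `R` along the path `w`. -/
def desc (w : Fin n → Fin d → Fin 2) : ℕ → DyadicCube d
  | 0 => R
  -- Beyond depth `n` the path continues by the default child `0`; the sums use only cubes up to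
  -- depth `n`.
  | k + 1 => child ω (desc w k) (if h : k < n then w ⟨k, h⟩ else 0)

@[simp] theorem desc_zero (w : Fin n → Fin d → Fin 2) : desc ω R w 0 = R := rfl

theorem desc_succ (w : Fin n → Fin d → Fin 2) {k : ℕ} (h : k < n) :
    desc ω R w (k + 1) = child ω (desc ω R w k) (w ⟨k, h⟩) := by rw [desc, dif_pos h]

@[simp] theorem scale_desc (w : Fin n → Fin d → Fin 2) (k : ℕ) :
    (desc ω R w k).scale = R.scale + k := by
  induction k with
  | zero => simp
  | succ k ih => rw [desc, scale_child, ih]; push_cast; ring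

theorem sat_desc (k : ℕ) : Sat (Agree k) fun w : Fin n → Fin d → Fin 2 => desc ω R w k := by
  induction k with
  | zero => exact fun _ _ _ => rfl
  | succ k ih =>
    intro w w' h
    have h1 := ih w w' (h.mono k.le_succ)
    simp only [desc] at h1 ⊢
    rw [h1]
    congr 1
    split_ifs with hk
    · exact h _ k.lt_succ_self
    · rfl

variable {ω R}

theorem desc_subset (w : Fin n → Fin d → Fin 2) {k l : ℕ} (h : k ≤ l) :
    cube ω (desc ω R w l) ⊆ cube ω (desc ω R w k) := by
  induction l, h using Nat.le_induction with
  | base => exact subset_rfl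
  | succ l _ ih => exact (cube_child_subset _ _).trans ih

theorem exists_mem_desc {x : Fin d → ℝ} (hx : x ∈ cube ω R) (n : ℕ) :
    ∃ w : Fin n → Fin d → Fin 2, x ∈ cube ω (desc ω R w n) := by
  have h1 : ∀ k : ℕ, ∃ η, x ∈ cube ω (child ω (cubeAt ω (R.scale + k) x) η) := fun k =>
    exists_mem_cube_child (mem_cube_cubeAt _ _)
  choose η hη using h1
  refine ⟨fun i => η i, ?_⟩
  have h2 : ∀ k, k ≤ n → desc ω R (fun i : Fin n => η i) k = cubeAt ω (R.scale + k) x := fun k => by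
    induction k with
    | zero => intro _; simpa using (mem_cube_iff.1 hx).symm
    | succ k ih =>
      intro hk
      rw [desc_succ ω R _ hk, ih (by omega)]
      refine eq_of_mem_cube ?_ (hη k) (mem_cube_cubeAt _ _)
      simp [cubeAt]; ring
  rw [h2 n le_rfl]
  exact mem_cube_cubeAt _ _

/-- At a point of a leaf, the cubes of these scales that contain it are exactly those along the path
to the leaf. -/
theorem sum_eq_sum_desc [DecidableEq (DyadicCube d)] {X : Type*} [AddCommMonoid X]
    {w : Fin n → Fin d → Fin 2}
    {x : Fin d → ℝ} (hx : x ∈ cube ω (desc ω R w n)) {A : Finset (DyadicCube d)}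
    (hA : ∀ Q ∈ A, R.scale ≤ Q.scale ∧ Q.scale < R.scale + n) {H : DyadicCube d → X}
    (hH : ∀ Q, x ∉ cube ω Q → H Q = 0) :
    ∑ Q ∈ A, H Q = ∑ k ∈ Finset.range n,
      if desc ω R w k ∈ A then H (desc ω R w k) else 0 := by
  have hxk : ∀ k, k ≤ n → x ∈ cube ω (desc ω R w k) := fun k hk => desc_subset w hk hx
  have h1 : ∀ Q ∈ A, H Q = ∑ k ∈ Finset.range n,
      if desc ω R w k = Q then H (desc ω R w k) else 0 := fun Q hQ => by
    by_cases hxQ : x ∈ cube ω Q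
    · obtain ⟨k, hk⟩ := Int.eq_ofNat_of_zero_le (sub_nonneg.2 (hA Q hQ).1)
      have hkn : k < n := by have := (hA Q hQ).2; omega
      have hkQ : desc ω R w k = Q :=
        eq_of_mem_cube (by rw [scale_desc]; omega) (hxk k hkn.le) hxQ
      rw [Finset.sum_eq_single k, if_pos hkQ, hkQ]
      · intro l _ hl
        rw [if_neg]
        intro hlQ
        have := congrArg DyadicCube.scale (hlQ.trans hkQ.symm)
        simp only [scale_desc] at this
        omega
      · intro h; exact absurd (Finset.mem_range.2 hkn) h
    · rw [hH Q hxQ, eq_comm]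
      refine Finset.sum_eq_zero fun k hk => if_neg fun h => hxQ ?_
      rw [← h]
      exact hxk k (Finset.mem_range.1 hk).le
  rw [Finset.sum_congr rfl h1, Finset.sum_comm]
  refine Finset.sum_congr rfl fun k _ => ?_
  rw [Finset.sum_ite_eq]

variable {F : Type*} [NormedAddCommGroup F] [NormedSpace ℝ F] [CompleteSpace F]

/-- Induction from the leaves upwards: both sides obey the mean-over-children recursion. This is the
dictionary between cubes and tree. -/
theorem condAvg_avg_desc {g : (Fin d → ℝ) → F} (hg : IntegrableOn g (cube ω R)) {k : ℕ}
    (hk : k ≤ n) (w : Fin n → Fin d → Fin 2) :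
    condAvg k (fun z => avg ω (desc ω R z n) g) w = avg ω (desc ω R w k) g := by
  induction hk using Nat.decreasingInduction generalizing w with
  | self => exact condAvg_of_le le_rfl _ w
  | of_succ k hk ih =>
    rw [condAvg_eq_inv_card_smul_sum hk,
      avg_eq_sum_child (hg.mono_set (desc_subset w (Nat.zero_le k)))]
    congr 1
    refine Finset.sum_congr rfl fun a _ => ?_
    have h1 : desc ω R (Function.update w ⟨k, hk⟩ a) k = desc ω R w k :=
      sat_desc ω R k _ w fun i hi => Function.update_of_ne (fun h => by simp [h] at hi) _ _
    rw [ih, desc_succ ω R _ hk, Function.update_self, h1]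

end Tree

/-! ### Transfer of the estimates from trees to cubes -/

section Transfer

variable {d n : ℕ} {ω : Shift d} {R : DyadicCube d} {p : ℝ}
  {F : Type*} [NormedAddCommGroup F] [NormedSpace ℝ F] [CompleteSpace F]

theorem condAvg_zero {α : Type*} [Fintype α] (g : (Fin n → α) → F) (x : Fin n → α) :
    condAvg 0 g x = (Fintype.card (Fin n → α) : ℝ)⁻¹ • ∑ z, g z := by
  have h : ∀ z, mix 0 x z = z := fun z => by funext i; simp [mix]
  simp only [condAvg, h]

theorem condAvg_congr {α : Type*} [Fintype α] {k : ℕ} {g g' : (Fin n → α) → F} {x : Fin n → α}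
    (h : ∀ z, g (mix k x z) = g' (mix k x z)) : condAvg k g x = condAvg k g' x := by
  simp only [condAvg, h]

theorem avg_eq_sum_desc {G : (Fin d → ℝ) → F} (hG : IntegrableOn G (cube ω R))
    {γ : (Fin n → Fin d → Fin 2) → F} (h : ∀ w, ∀ x ∈ cube ω (desc ω R w n), G x = γ w) :
    avg ω R G = (Fintype.card (Fin n → Fin d → Fin 2) : ℝ)⁻¹ • ∑ w, γ w := by
  have h1 := condAvg_avg_desc hG (Nat.zero_le n) 0
  rw [desc_zero] at h1
  rw [← h1, condAvg_zero]
  congr 1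
  refine Finset.sum_congr rfl fun w _ => ?_
  rw [avg_congr (h w), avg_const]

theorem sum_norm_avg_desc_rpow_le (hp : 1 ≤ p) {g : (Fin d → ℝ) → F}
    (hg : MemLp g (ENNReal.ofReal p) (volume.restrict (cube ω R))) :
    (Fintype.card (Fin n → Fin d → Fin 2) : ℝ)⁻¹ * ∑ w : Fin n → Fin d → Fin 2,
        ‖avg ω (desc ω R w n) g‖ ^ p
      ≤ avg ω R fun x => ‖g x‖ ^ p := by
  have h1 := condAvg_avg_desc (n := n) (integrableOn_norm_rpow (by linarith) hg) (Nat.zero_le n) 0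
  rw [desc_zero] at h1
  rw [← h1, condAvg_zero, smul_eq_mul]
  gcongr with w
  exact norm_avg_rpow_le hp (hg.mono_measure (Measure.restrict_mono (desc_subset w (Nat.zero_le n))
    le_rfl))

/-- By Jensen, replacing `b` by its averages over the leaves does not increase its oscillation, so
the BMO bound passes to the tree. -/
theorem condAvg_norm_avg_desc_sub_le (hp : 1 ≤ p) {β : ℝ} (hβ : 0 ≤ β) {b : (Fin d → ℝ) → F}
    (hb : ∀ Q, MemLp b (ENNReal.ofReal p) (volume.restrict (cube ω Q)))
    (hb' : ∀ Q, avg ω Q (fun x => ‖b x - avg ω Q b‖ ^ p) ≤ β ^ p) (k : ℕ)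
    (w : Fin n → Fin d → Fin 2) :
    condAvg k (fun z => ‖avg ω (desc ω R z n) b
      - condAvg k (fun z => avg ω (desc ω R z n) b) z‖ ^ p) w ≤ β ^ p := by
  have hp0 : 0 < p := by linarith
  have hbi : ∀ Q, IntegrableOn b (cube ω Q) := fun Q => MemLp.integrableOn_cube hp (hb Q)
  rcases le_total k n with hk | hk
  · set c := avg ω (desc ω R w k) b with hc
    have hbc : ∀ Q, MemLp (fun x => b x - c) (ENNReal.ofReal p) (volume.restrict (cube ω Q)) :=
      fun Q => (hb Q).sub (memLp_const c)
    calc _ ≤ condAvg k (fun z => avg ω (desc ω R z n) fun x => ‖b x - c‖ ^ p) w := by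
          rw [condAvg_congr (g' := fun z => ‖avg ω (desc ω R z n) b - c‖ ^ p) fun z => ?_]
          · refine condAvg_mono k (fun z => ?_) w
            rw [← avg_const (ω := ω) (desc ω R z n) c, ← avg_sub (hbi _)
              (integrable_const c)]
            rw [avg_const]
            exact norm_avg_rpow_le hp (hbc _)
          · rw [condAvg_avg_desc (hbi R) hk, hc,
              show desc ω R (mix k w z) k = desc ω R w k from
                sat_desc ω R k _ _ (agree_mix k w z)]
      _ = avg ω (desc ω R w k) fun x => ‖b x - c‖ ^ p :=
          condAvg_avg_desc (integrableOn_norm_rpow hp0 (hbc R)) hk w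
      _ ≤ β ^ p := hb' _
  · rw [condAvg_of_le hk, condAvg_of_le hk, sub_self, norm_zero, Real.zero_rpow hp0.ne']
    positivity

theorem haarProj_desc_eq {g : (Fin d → ℝ) → F} (hg : IntegrableOn g (cube ω R))
    {w : Fin n → Fin d → Fin 2} {x : Fin d → ℝ} (hx : x ∈ cube ω (desc ω R w n)) {k : ℕ}
    (hk : k < n) :
    haarProj ω (desc ω R w k) g x = condAvg (k + 1) (fun z => avg ω (desc ω R z n) g) w
      - condAvg k (fun z => avg ω (desc ω R z n) g) w := by
  have h1 := desc_subset w (Nat.succ_le_of_lt hk) hx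
  rw [Nat.succ_eq_add_one, desc_succ ω R w hk] at h1
  rw [haarProj_of_mem g h1, condAvg_avg_desc hg hk, condAvg_avg_desc hg hk.le, desc_succ ω R w hk]

/-- The constant `c` is free because Haar projections do not see constants; replacing the mean of
`g` by `c` costs the factor `2`. In `eLpNorm_sum_haarProj_le`, `c` is the value of a step function.
-/
theorem avg_norm_sum_haarProj_le (hp : 1 ≤ p) {C : ℝ} (hC : 0 ≤ C)
    (hF : IsUMDBound p F (ENNReal.ofReal C)) {A : Finset (DyadicCube d)}
    (hA : ∀ Q ∈ A, R.scale ≤ Q.scale ∧ Q.scale < R.scale + n) {g : (Fin d → ℝ) → F}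
    (hg : MemLp g (ENNReal.ofReal p) (volume.restrict (cube ω R))) (c : F) :
    avg ω R (fun x => ‖∑ Q ∈ A, haarProj ω Q g x‖ ^ p)
      ≤ (2 * C) ^ p * avg ω R fun x => ‖g x - c‖ ^ p := by
  classical
  have hp0 : 0 < p := by linarith
  have hgi := MemLp.integrableOn_cube hp hg
  have hgc : ∀ c, MemLp (fun x => g x - c) (ENNReal.ofReal p) (volume.restrict (cube ω R)) :=
    fun c => hg.sub (memLp_const c)
  set γ : (Fin n → Fin d → Fin 2) → F := fun z => avg ω (desc ω R z n) g with hγ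
  have h1 := hF.sum_norm_coordDiff_le hp hC γ
    (v := fun k w => if desc ω R w k ∈ A then 1 else 0)
    (fun k w => by split_ifs <;> simp)
    (fun k w w' h => by
      beta_reduce
      rw [show desc ω R w k = desc ω R w' k from sat_desc ω R k _ _ h])
  have h2 : avg ω R (fun x => ‖∑ Q ∈ A, haarProj ω Q g x‖ ^ p)
      = (Fintype.card (Fin n → Fin d → Fin 2) : ℝ)⁻¹ * ∑ w, ‖∑ k ∈ Finset.range n,
        (if desc ω R w k ∈ A then (1 : ℝ) else 0) • (condAvg (k + 1) γ w - condAvg k γ w)‖ ^ p := by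
    refine avg_eq_sum_desc (integrableOn_norm_rpow hp0
      ((memLp_finsetSum A fun Q _ => memLp_haarProj Q g _).restrict _)) fun w x hx => ?_
    rw [sum_eq_sum_desc hx hA fun Q hQ => haarProj_of_notMem g hQ]
    congr 2
    refine Finset.sum_congr rfl fun k hk => ?_
    rw [haarProj_desc_eq hgi hx (Finset.mem_range.1 hk)]
    split_ifs <;> simp [hγ]
  have h3 : ∀ w, γ w - condAvg 0 γ w = avg ω (desc ω R w n) fun x => g x - avg ω R g := fun w => by
    rw [hγ, condAvg_avg_desc hgi (Nat.zero_le n), desc_zero, avg_sub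
      (hgi.mono_set (desc_subset w (Nat.zero_le n))) (integrable_const _), avg_const]
  have h4 := sum_norm_avg_desc_rpow_le (n := n) hp (hgc (avg ω R g))
  have h5 : avg ω R (fun x => ‖g x - avg ω R g‖ ^ p) ≤ 2 ^ p * avg ω R fun x => ‖g x - c‖ ^ p := by
    have e1 : ‖c - avg ω R g‖ ^ p ≤ avg ω R fun x => ‖g x - c‖ ^ p := by
      rw [norm_sub_rev]
      have := norm_avg_rpow_le hp (hgc c)
      rwa [avg_sub hgi (integrable_const _), avg_const] at this
    have e2 : avg ω R (fun x => ‖g x - avg ω R g‖ ^ p)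
        ≤ avg ω R fun x => 2 ^ p * (1 / 2) * ‖g x - c‖ ^ p
          + 2 ^ p * (1 / 2) * ‖c - avg ω R g‖ ^ p := by
      refine avg_mono (integrableOn_norm_rpow hp0 (hgc _))
        (((integrableOn_norm_rpow hp0 (hgc c)).const_mul _).add (integrable_const _)) fun x _ => ?_
      have := norm_half_smul_add_rpow_le hp (g x - c) (c - avg ω R g)
      rw [sub_add_sub_cancel, norm_smul, Real.norm_of_nonneg (by norm_num),
        Real.mul_rpow (by norm_num) (norm_nonneg _), one_div, Real.inv_rpow (by norm_num),
        inv_mul_le_iff₀ (by positivity)] at this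
      linarith
    refine e2.trans ?_
    rw [avg_add ((integrableOn_norm_rpow hp0 (hgc c)).const_mul _) (integrable_const _), avg_const]
    have e3 : avg ω R (fun x => 2 ^ p * (1 / 2) * ‖g x - c‖ ^ p)
        = 2 ^ p * (1 / 2) * avg ω R fun x => ‖g x - c‖ ^ p := by
      rw [avg_eq, avg_eq, integral_const_mul, smul_eq_mul, smul_eq_mul]
      ring
    rw [e3]
    have : (0 : ℝ) ≤ 2 ^ p * (1 / 2) := by positivity
    nlinarith
  rw [h2]
  simp only [h3] at h1
  calc _ ≤ (Fintype.card (Fin n → Fin d → Fin 2) : ℝ)⁻¹ * (C ^ p * ∑ w,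
        ‖avg ω (desc ω R w n) fun x => g x - avg ω R g‖ ^ p) := by gcongr
    _ ≤ C ^ p * avg ω R fun x => ‖g x - avg ω R g‖ ^ p := by
        rw [mul_left_comm]
        gcongr
    _ ≤ C ^ p * (2 ^ p * avg ω R fun x => ‖g x - c‖ ^ p) := by gcongr
    _ = _ := by rw [Real.mul_rpow (by norm_num) hC]; ring

end Transfer

/-! ### The paraproduct below one cube -/

section Term

variable {d n : ℕ} {ω : Shift d} {R : DyadicCube d} {p : ℝ}
  {T E : Type*} [NormedAddCommGroup T] [NormedSpace ℝ T] [CompleteSpace T]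
  [NormedAddCommGroup E] [NormedSpace ℝ E] [CompleteSpace E] {B : T →L[ℝ] E →L[ℝ] E}

/-- The term `B (D_Q b) ⟨f⟩_Q` of the paraproduct with respect to a bilinear map `B`. -/
noncomputable def bilinTerm (ω : Shift d) (B : T →L[ℝ] E →L[ℝ] E) (b : (Fin d → ℝ) → T)
    (f : (Fin d → ℝ) → E) (Q : DyadicCube d) (x : Fin d → ℝ) : E :=
  B (haarProj ω Q b x) (avg ω Q f)

theorem memLp_bilinTerm (b : (Fin d → ℝ) → T) (f : (Fin d → ℝ) → E) (Q : DyadicCube d)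
    (q : ℝ≥0∞) : MemLp (bilinTerm ω B b f Q) q volume :=
  (B.flip (avg ω Q f)).comp_memLp' (memLp_haarProj Q b q)

theorem bilinTerm_of_notMem (b : (Fin d → ℝ) → T) (f : (Fin d → ℝ) → E)
    {Q : DyadicCube d} {x : Fin d → ℝ} (hx : x ∉ cube ω Q) : bilinTerm ω B b f Q x = 0 := by
  simp [bilinTerm, haarProj_of_notMem b hx]

/-- The tree estimate with the indicator of `A` as multiplier; it is predictable because the cube of
generation `k` depends on the first `k` letters only. The factor `2 ^ d` is the number of letters.
-/
theorem avg_norm_sum_bilinTerm_le (hp : 1 < p) {CE CT β : ℝ} (hCE : 0 ≤ CE) (hCT : 0 ≤ CT)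
    (hβ : 0 ≤ β) (hE : IsUMDBound p E (ENNReal.ofReal CE))
    (hT : IsUMDBound p T (ENNReal.ofReal CT)) (hB : ∀ t e, ‖B t e‖ ≤ ‖t‖ * ‖e‖)
    {b : (Fin d → ℝ) → T}
    (hb : ∀ Q, MemLp b (ENNReal.ofReal p) (volume.restrict (cube ω Q)))
    (hb' : ∀ Q, avg ω Q (fun x => ‖b x - avg ω Q b‖ ^ p) ≤ β ^ p) {A : Finset (DyadicCube d)}
    (hA : ∀ Q ∈ A, R.scale ≤ Q.scale ∧ Q.scale < R.scale + n) {f : (Fin d → ℝ) → E}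
    (hf : MemLp f (ENNReal.ofReal p) (volume.restrict (cube ω R))) :
    avg ω R (fun x => ‖∑ Q ∈ A, bilinTerm ω B b f Q x‖ ^ p)
      ≤ (6 * 2 ^ d * p * (p / (p - 1)) * CE ^ 2 * CT * β) ^ p * avg ω R fun x => ‖f x‖ ^ p := by
  classical
  have hp0 : 0 < p := by linarith
  have hp1 : 0 < p - 1 := by linarith
  have hbi : IntegrableOn b (cube ω R) := MemLp.integrableOn_cube hp.le (hb R)
  have hfi : IntegrableOn f (cube ω R) := MemLp.integrableOn_cube hp.le hf
  have h1 := sum_norm_paraproduct_le (n := n) (α := Fin d → Fin 2)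
    ((ContinuousLinearMap.coeLM ℝ).comp B.toLinearMap) hp hCE hCT hβ hE hT
    hB
    (f := fun z => avg ω (desc ω R z n) f)
    (condAvg_norm_avg_desc_sub_le (R := R) hp.le hβ hb hb')
    (v := fun k w => if desc ω R w k ∈ A then 1 else 0)
    (fun k w => by split_ifs <;> simp)
    (fun k w w' h => by
      beta_reduce
      rw [show desc ω R w k = desc ω R w' k from sat_desc ω R k _ _ h])
  rw [show (Fintype.card (Fin d → Fin 2) : ℝ) = 2 ^ d by simp] at h1
  set β' : (Fin n → Fin d → Fin 2) → T := fun z => avg ω (desc ω R z n) b with hβ'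
  set φ : (Fin n → Fin d → Fin 2) → E := fun z => avg ω (desc ω R z n) f with hφ
  have h2 := avg_eq_sum_desc (n := n) (R := R) (integrableOn_norm_rpow hp0
    ((memLp_finsetSum A fun Q _ => memLp_bilinTerm (ω := ω) (B := B) b f Q
      (ENNReal.ofReal p)).restrict _)) (γ := fun w => ‖∑ k ∈ Finset.range n,
        (if desc ω R w k ∈ A then (1 : ℝ) else 0) •
          B (condAvg (k + 1) β' w - condAvg k β' w) (condAvg k φ w)‖ ^ p) fun w x hx => by
      rw [sum_eq_sum_desc hx hA fun Q hQ => bilinTerm_of_notMem b f hQ]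
      congr 2
      refine Finset.sum_congr rfl fun k hk => ?_
      have hk' := Finset.mem_range.1 hk
      rw [hφ, condAvg_avg_desc hfi hk'.le]
      split_ifs
      · rw [one_smul, bilinTerm, haarProj_desc_eq hbi hx hk']
      · rw [zero_smul]
  rw [h2, smul_eq_mul]
  have h3 := sum_norm_avg_desc_rpow_le (n := n) hp.le hf
  have hK : 0 ≤ (6 * 2 ^ d * p * (p / (p - 1)) * CE ^ 2 * CT * β) ^ p := by positivity
  refine le_trans ?_ (mul_le_mul_of_nonneg_left h3 hK)
  rw [mul_left_comm]
  gcongr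
  exact h1

end Term

/-! ### Summation over the cubes of one scale -/

section Global

variable {d : ℕ} {ω : Shift d} {p : ℝ}
  {F G : Type*} [NormedAddCommGroup F] [NormedSpace ℝ F] [CompleteSpace F]
  [NormedAddCommGroup G] [NormedSpace ℝ G] [CompleteSpace G]

theorem lintegral_enorm_rpow_cube (hp : 0 < p) {Q : DyadicCube d} {g : (Fin d → ℝ) → F}
    (hg : MemLp g (ENNReal.ofReal p) (volume.restrict (cube ω Q))) :
    ∫⁻ x in cube ω Q, ‖g x‖ₑ ^ p
      = volume (cube ω Q) * ENNReal.ofReal (avg ω Q fun x => ‖g x‖ ^ p) := by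
  rw [avg_eq, smul_eq_mul, ENNReal.ofReal_mul (by positivity), ← mul_assoc,
    ENNReal.ofReal_inv_of_pos (volume_real_cube_pos Q), ofReal_measureReal (volume_cube_ne_top Q),
    ENNReal.mul_inv_cancel (volume_cube_ne_zero Q) (volume_cube_ne_top Q), one_mul,
    ofReal_integral_eq_lintegral_ofReal (integrableOn_norm_rpow hp hg)
      (Eventually.of_forall fun x => by positivity)]
  refine lintegral_congr fun x => ?_
  rw [← ENNReal.ofReal_rpow_of_nonneg (norm_nonneg _) hp.le, ofReal_norm]

/-- The cubes of scale `k` tile the space, so local estimates with a common constant add up. -/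
theorem eLpNorm_le_of_avg_le (hp : 0 < p) {K : ℝ} (hK : 0 ≤ K) {k : ℤ} {u : (Fin d → ℝ) → F}
    {v : (Fin d → ℝ) → G} (hu : MemLp u (ENNReal.ofReal p) volume)
    (hv : MemLp v (ENNReal.ofReal p) volume)
    (h : ∀ R : DyadicCube d, R.scale = k →
      avg ω R (fun x => ‖u x‖ ^ p) ≤ K ^ p * avg ω R fun x => ‖v x‖ ^ p) :
    eLpNorm u (ENNReal.ofReal p) volume
      ≤ ENNReal.ofReal K * eLpNorm v (ENNReal.ofReal p) volume := by
  have hU : ⋃ m : Fin d → ℤ, cube ω ⟨k, m⟩ = Set.univ :=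
    Set.eq_univ_of_forall fun x => Set.mem_iUnion.2 ⟨_, mem_cube_cubeAt k x⟩
  have hD : Pairwise (Function.onFun Disjoint fun m : Fin d → ℤ => cube ω ⟨k, m⟩) :=
    fun m m' hm => disjoint_cube rfl fun h' => hm (congrArg DyadicCube.corner h')
  have h1 : ∀ {H : Type _} [NormedAddCommGroup H] (g : (Fin d → ℝ) → H), ∫⁻ x, ‖g x‖ₑ ^ p
      = ∑' m : Fin d → ℤ, ∫⁻ x in cube ω ⟨k, m⟩, ‖g x‖ₑ ^ p := fun g => by
    rw [← lintegral_iUnion (fun m => measurableSet_cube _) hD, hU, Measure.restrict_univ]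
  have h1' : ∀ {H : Type _} [NormedAddCommGroup H] (g : (Fin d → ℝ) → H), ∫⁻ x, ‖g x‖ₑ ^ p
      = ∑' m : Fin d → ℤ, ∫⁻ x in cube ω ⟨k, m⟩, ‖g x‖ₑ ^ p := fun g => by
    rw [← lintegral_iUnion (fun m => measurableSet_cube _) hD, hU, Measure.restrict_univ]
  have h2 : ∫⁻ x, ‖u x‖ₑ ^ p ≤ ENNReal.ofReal K ^ p * ∫⁻ x, ‖v x‖ₑ ^ p := by
    rw [h1 u, h1' v, ← ENNReal.tsum_mul_left]
    refine ENNReal.tsum_le_tsum fun m => ?_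
    rw [lintegral_enorm_rpow_cube hp (hu.restrict _), lintegral_enorm_rpow_cube hp (hv.restrict _),
      mul_left_comm, ENNReal.ofReal_rpow_of_nonneg hK hp.le, ← ENNReal.ofReal_mul (by positivity)]
    gcongr
    exact h _ rfl
  rw [eLpNorm_eq_lintegral_rpow_enorm_toReal (by simpa using hp) (by simp),
    eLpNorm_eq_lintegral_rpow_enorm_toReal (by simpa using hp) (by simp),
    ENNReal.toReal_ofReal hp.le]
  refine (ENNReal.rpow_le_rpow h2 (by positivity)).trans (le_of_eq ?_)
  rw [ENNReal.mul_rpow_of_nonneg _ _ (by positivity), ← ENNReal.rpow_mul,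
    mul_one_div_cancel hp.ne', ENNReal.rpow_one]

theorem exists_scale_lt (A : Finset (DyadicCube d)) {k : ℤ} (hA : ∀ Q ∈ A, k ≤ Q.scale) :
    ∃ n : ℕ, ∀ Q ∈ A, k ≤ Q.scale ∧ Q.scale < k + n := by
  refine ⟨A.sup (fun Q => (Q.scale - k).toNat) + 1, fun Q hQ => ⟨hA Q hQ, ?_⟩⟩
  have h1 : (Q.scale - k).toNat ≤ A.sup (fun Q => (Q.scale - k).toNat) :=
    Finset.le_sup (f := fun Q : DyadicCube d => (Q.scale - k).toNat) hQ
  push_cast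
  omega

theorem exists_le_scale (A : Finset (DyadicCube d)) : ∃ k : ℤ, ∀ Q ∈ A, k ≤ Q.scale := by
  classical
  obtain ⟨k, hk⟩ := (A.image DyadicCube.scale).bddBelow
  exact ⟨k, fun Q hQ => hk (by simpa using ⟨Q, hQ, rfl⟩)⟩

/-- Multipliers of the Haar expansion of a function that is `L^p`-close to a function which is
constant on cubes of a given scale. -/
theorem eLpNorm_sum_haarProj_le (hp : 1 ≤ p) {C : ℝ} (hC : 0 ≤ C)
    (hF : IsUMDBound p F (ENNReal.ofReal C)) {A : Finset (DyadicCube d)} {k : ℤ}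
    (hA : ∀ Q ∈ A, k ≤ Q.scale) {g s : (Fin d → ℝ) → F}
    (hg : MemLp g (ENNReal.ofReal p) volume) (hs : MemLp s (ENNReal.ofReal p) volume)
    (hs' : ∀ R : DyadicCube d, R.scale = k → ∃ c, ∀ x ∈ cube ω R, s x = c) :
    eLpNorm (fun x => ∑ Q ∈ A, haarProj ω Q g x) (ENNReal.ofReal p) volume
      ≤ ENNReal.ofReal (2 * C) * eLpNorm (g - s) (ENNReal.ofReal p) volume := by
  obtain ⟨n, hn⟩ := exists_scale_lt A hA
  refine eLpNorm_le_of_avg_le (ω := ω) (k := k) (by linarith) (by positivity)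
    (memLp_finsetSum A fun Q _ => memLp_haarProj Q g _) (hg.sub hs) fun R hR => ?_
  obtain ⟨c, hc⟩ := hs' R hR
  refine (avg_norm_sum_haarProj_le hp hC hF (hR ▸ hn) (hg.restrict _) c).trans (le_of_eq ?_)
  congr 1
  exact avg_congr fun x hx => by rw [Pi.sub_apply, hc x hx]

end Global

/-! ### Uniform bounds for the partial sums -/

section Uniform

variable {d : ℕ} {ω : Shift d} {p : ℝ}
  {T E : Type*} [NormedAddCommGroup T] [NormedSpace ℝ T] [CompleteSpace T]
  [NormedAddCommGroup E] [NormedSpace ℝ E] [CompleteSpace E] {B : T →L[ℝ] E →L[ℝ] E}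

theorem lintegral_cube_le_of_memBMO (hp : 0 < p) {b : (Fin d → ℝ) → T} (Q : DyadicCube d) :
    ∫⁻ x in cube ω Q, ‖b x - avg ω Q b‖ₑ ^ p ≤ volume (cube ω Q) * bmoNorm ω p b ^ p := by
  have h1 := ENNReal.rpow_le_rpow (le_iSup (fun Q : DyadicCube d =>
    ((volume (cube ω Q))⁻¹ * ∫⁻ x in cube ω Q, ‖b x - avg ω Q b‖ₑ ^ p) ^ (1 / p)) Q) hp.le
  rw [← ENNReal.rpow_mul, one_div_mul_cancel hp.ne', ENNReal.rpow_one] at h1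
  rwa [ENNReal.inv_mul_le_iff (volume_cube_ne_zero Q) (volume_cube_ne_top Q)] at h1

theorem MemBMO.memLp_sub_avg (hp : 0 < p) {b : (Fin d → ℝ) → T} (hb : MemBMO ω p b)
    (Q : DyadicCube d) :
    MemLp (fun x => b x - avg ω Q b) (ENNReal.ofReal p) (volume.restrict (cube ω Q)) := by
  refine ⟨(LocallyIntegrable.integrableOn_cube hb.1 Q).aestronglyMeasurable.sub
    aestronglyMeasurable_const, ?_⟩
  rw [eLpNorm_lt_top_iff_lintegral_rpow_enorm_lt_top (by simpa using hp) (by simp),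
    ENNReal.toReal_ofReal hp.le]
  exact (lintegral_cube_le_of_memBMO hp Q).trans_lt (ENNReal.mul_lt_top
    (volume_cube_ne_top Q).lt_top (ENNReal.rpow_lt_top_of_nonneg hp.le hb.2.ne))

theorem MemBMO.memLp (hp : 0 < p) {b : (Fin d → ℝ) → T} (hb : MemBMO ω p b)
    (Q : DyadicCube d) : MemLp b (ENNReal.ofReal p) (volume.restrict (cube ω Q)) := by
  convert (hb.memLp_sub_avg hp Q).add (memLp_const (avg ω Q b)) using 1
  funext x
  exact (sub_add_cancel _ _).symm

theorem MemBMO.avg_le (hp : 0 < p) {b : (Fin d → ℝ) → T} (hb : MemBMO ω p b)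
    (Q : DyadicCube d) :
    avg ω Q (fun x => ‖b x - avg ω Q b‖ ^ p) ≤ (bmoNorm ω p b).toReal ^ p := by
  have h1 := lintegral_cube_le_of_memBMO (ω := ω) (b := b) hp Q
  rw [lintegral_enorm_rpow_cube hp (hb.memLp_sub_avg hp Q),
    ENNReal.mul_le_mul_iff_right (volume_cube_ne_zero Q) (volume_cube_ne_top Q)] at h1
  rw [← ENNReal.ofReal_toReal hb.2.ne, ENNReal.ofReal_rpow_of_nonneg ENNReal.toReal_nonneg hp.le,
    ENNReal.ofReal_le_ofReal_iff (by positivity)] at h1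
  exact h1

/-- The constant in the estimate of the paraproduct. -/
noncomputable def paraproductConst (d : ℕ) (p CE CT β : ℝ) : ℝ :=
  6 * 2 ^ d * p * (p / (p - 1)) * CE ^ 2 * CT * β

theorem paraproductConst_nonneg (hp : 1 < p) {CE CT β : ℝ} (hCT : 0 ≤ CT) (hβ : 0 ≤ β) :
    0 ≤ paraproductConst d p CE CT β := by
  have : 0 < p - 1 := by linarith
  rw [paraproductConst]
  positivity

/-- The uniform bound for the partial sums of the paraproduct. -/
theorem eLpNorm_sum_bilinTerm_le (hp : 1 < p) {CE CT : ℝ} (hCE : 0 ≤ CE) (hCT : 0 ≤ CT)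
    (hE : IsUMDBound p E (ENNReal.ofReal CE)) (hT : IsUMDBound p T (ENNReal.ofReal CT))
    (hB : ∀ t e, ‖B t e‖ ≤ ‖t‖ * ‖e‖)
    {b : (Fin d → ℝ) → T} (hb : MemBMO ω p b) (A : Finset (DyadicCube d)) {f : (Fin d → ℝ) → E}
    (hf : MemLp f (ENNReal.ofReal p) volume) :
    eLpNorm (fun x => ∑ Q ∈ A, bilinTerm ω B b f Q x) (ENNReal.ofReal p) volume
      ≤ ENNReal.ofReal (paraproductConst d p CE CT (bmoNorm ω p b).toReal)
        * eLpNorm f (ENNReal.ofReal p) volume := by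
  have hp0 : 0 < p := by linarith
  obtain ⟨k, hk⟩ := exists_le_scale A
  obtain ⟨n, hn⟩ := exists_scale_lt A hk
  exact eLpNorm_le_of_avg_le (ω := ω) (k := k) hp0
    (paraproductConst_nonneg hp hCT ENNReal.toReal_nonneg)
    (memLp_finsetSum A fun Q _ => memLp_bilinTerm b f Q _) hf fun R hR =>
    avg_norm_sum_bilinTerm_le hp hCE hCT ENNReal.toReal_nonneg hE hT hB (hb.memLp hp0)
      (hb.avg_le hp0) (hR ▸ hn) (hf.restrict _)

end Uniform

/-! ### Approximation by step functions -/

section Step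

variable {d : ℕ} {ω : Shift d} {p : ℝ}
  {F : Type*} [NormedAddCommGroup F] [NormedSpace ℝ F]

/-- The step function with the values `c Q` on the cubes `Q ∈ S`. -/
noncomputable def stepFun (ω : Shift d) (S : Finset (DyadicCube d)) (c : DyadicCube d → F)
    (x : Fin d → ℝ) : F :=
  ∑ Q ∈ S, (cube ω Q).indicator (fun _ => c Q) x

theorem stepFun_eq [DecidableEq (DyadicCube d)] {S : Finset (DyadicCube d)} {c : DyadicCube d → F}
    {k : ℤ} (hS : ∀ Q ∈ S, Q.scale = k) {Q : DyadicCube d} (hQ : Q.scale = k) {x : Fin d → ℝ}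
    (hx : x ∈ cube ω Q) : stepFun ω S c x = if Q ∈ S then c Q else 0 := by
  have h1 : ∀ Q' ∈ S, (cube ω Q').indicator (fun _ => c Q') x = if Q' = Q then c Q else 0 :=
    fun Q' hQ' => by
      split_ifs with h
      · rw [h, Set.indicator_of_mem hx]
      · exact Set.indicator_of_notMem
          (fun hx' => h (eq_of_mem_cube ((hS Q' hQ').trans hQ.symm) hx' hx)) _
  rw [stepFun, Finset.sum_congr rfl h1, Finset.sum_ite_eq']

theorem memLp_stepFun (S : Finset (DyadicCube d)) (c : DyadicCube d → F) (q : ℝ≥0∞) :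
    MemLp (stepFun ω S c) q volume :=
  memLp_finsetSum _ fun Q _ =>
    memLp_indicator_const q (measurableSet_cube Q) _ (Or.inr (volume_cube_ne_top Q))

theorem dist_le_of_mem_cube {Q : DyadicCube d} {x y : Fin d → ℝ} (hx : x ∈ cube ω Q)
    (hy : y ∈ cube ω Q) : dist x y ≤ 2 ^ (-Q.scale) := by
  refine (dist_pi_le_iff (by positivity)).2 fun i => ?_
  have h1 := hx i
  have h2 := hy i
  rw [Real.dist_eq, abs_le]
  constructor <;> linarith

theorem exists_mem_cube (Q : DyadicCube d) : ∃ x, x ∈ cube ω Q :=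
  Set.nonempty_iff_ne_empty.2 fun h => volume_cube_ne_zero (ω := ω) Q (by rw [h, measure_empty])

theorem exists_finset_cubeAt_mem {M : Set (Fin d → ℝ)} (hM : Bornology.IsBounded M) (k : ℤ) :
    ∃ S : Finset (DyadicCube d), (∀ Q ∈ S, Q.scale = k) ∧ ∀ x ∈ M, cubeAt ω k x ∈ S := by
  classical
  obtain ⟨r, hr⟩ := hM.exists_norm_le
  refine ⟨(Finset.Icc (fun i => ⌊(2 : ℝ) ^ k * (-r - ω.offset k i)⌋)
    (fun i => ⌊(2 : ℝ) ^ k * (r - ω.offset k i)⌋)).image (DyadicCube.mk k), fun Q hQ => ?_,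
    fun x hx => ?_⟩
  · obtain ⟨m, -, rfl⟩ := Finset.mem_image.1 hQ
    rfl
  · refine Finset.mem_image.2 ⟨_, Finset.mem_Icc.2 ⟨fun i => ?_, fun i => ?_⟩, rfl⟩ <;>
    · have h1 := abs_le.1 ((norm_le_pi_norm x i).trans (hr x hx))
      refine Int.floor_le_floor (mul_le_mul_of_nonneg_left ?_ (by positivity))
      linarith

/-- Step functions over the cubes of one scale are dense in `L^p`. -/
theorem MemLp.exists_stepFun (hp : 1 ≤ p) {g : (Fin d → ℝ) → F}
    (hg : MemLp g (ENNReal.ofReal p) volume) {ε : ℝ≥0∞} (hε : ε ≠ 0) :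
    ∃ (k : ℤ) (S : Finset (DyadicCube d)) (c : DyadicCube d → F), (∀ Q ∈ S, Q.scale = k) ∧
      eLpNorm (g - stepFun ω S c) (ENNReal.ofReal p) volume ≤ ε := by
  classical
  have hp0 : 0 < p := by linarith
  obtain ⟨h, hh, h1, hhc, hhm⟩ := hg.exists_hasCompactSupport_eLpNorm_sub_le (by simp)
    (ENNReal.half_pos hε).ne'
  -- Cubes of side at most `1` that meet the support of `h` lie in this thickening, whose finite
  -- measure turns a uniform error into an `L^p` error.
  have hM : IsCompact (Metric.cthickening 1 (tsupport h)) := hh.isCompact.cthickening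
  set V := volume (Metric.cthickening 1 (tsupport h)) ^ (1 / p) with hV
  have hV' : V ≠ ⊤ := ENNReal.rpow_ne_top_of_nonneg (by positivity) hM.measure_lt_top.ne
  obtain ⟨δ, hδ0, hδ⟩ : ∃ δ : ℝ, 0 < δ ∧ ENNReal.ofReal δ * V ≤ ε / 2 := by
    obtain ⟨δ, hδ0, hδ⟩ := ENNReal.exists_nnreal_pos_mul_lt hV' (ENNReal.half_pos hε).ne'
    exact ⟨δ, hδ0, by simpa using hδ.le⟩
  obtain ⟨η, hη0, hη⟩ := Metric.uniformContinuous_iff.1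
    (hh.uniformContinuous_of_continuous hhc) δ hδ0
  obtain ⟨k, hk⟩ : ∃ k : ℕ, (2 : ℝ) ^ (-(k : ℤ)) < η := by
    obtain ⟨k, hk⟩ := exists_pow_lt_of_lt_one hη0 (show (1 / 2 : ℝ) < 1 by norm_num)
    exact ⟨k, by simpa using hk⟩
  have hk1 : (2 : ℝ) ^ (-(k : ℤ)) ≤ 1 := by
    rw [zpow_neg, zpow_natCast]
    exact inv_le_one_of_one_le₀ (one_le_pow₀ (by norm_num))
  obtain ⟨S, hS, hS'⟩ := exists_finset_cubeAt_mem (ω := ω) hh.isCompact.isBounded (k : ℤ)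
  choose pt hpt using exists_mem_cube (d := d) (ω := ω)
  refine ⟨k, S, fun Q => h (pt Q), hS, ?_⟩
  set s := stepFun ω S fun Q => h (pt Q) with hs
  have h2 : ∀ x, ‖(h - s) x‖ ≤
      ‖(Metric.cthickening 1 (tsupport h)).indicator (fun _ => δ) x‖ := fun x => by
    have hx := mem_cube_cubeAt (ω := ω) (k : ℤ) x
    have hd : dist x (pt (cubeAt ω k x)) ≤ 2 ^ (-(k : ℤ)) := dist_le_of_mem_cube hx (hpt _)
    rw [Pi.sub_apply, hs, stepFun_eq hS rfl hx]
    split_ifs with hQ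
    · by_cases hxM : x ∈ Metric.cthickening 1 (tsupport h)
      · rw [Set.indicator_of_mem hxM, Real.norm_of_nonneg hδ0.le, ← dist_eq_norm]
        exact (hη (hd.trans_lt hk)).le
      · have e1 : x ∉ tsupport h := fun hx' => hxM (Metric.self_subset_cthickening _ hx')
        have e2 : pt (cubeAt ω k x) ∉ tsupport h := fun hx' =>
          hxM (Metric.mem_cthickening_of_dist_le x _ 1 _ hx' (hd.trans hk1))
        rw [image_eq_zero_of_notMem_tsupport e1, image_eq_zero_of_notMem_tsupport e2]
        simp
    · rw [image_eq_zero_of_notMem_tsupport fun hx' => hQ (hS' x hx')]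
      simp
  have h3 : eLpNorm (h - s) (ENNReal.ofReal p) volume ≤ ε / 2 := by
    refine (eLpNorm_mono h2).trans ((eLpNorm_indicator_const_le _ _).trans ?_)
    rwa [Real.enorm_of_nonneg hδ0.le, ENNReal.toReal_ofReal hp0.le]
  calc eLpNorm (g - s) (ENNReal.ofReal p) volume
      = eLpNorm ((g - h) + (h - s)) (ENNReal.ofReal p) volume := by rw [sub_add_sub_cancel]
    _ ≤ eLpNorm (g - h) (ENNReal.ofReal p) volume + eLpNorm (h - s) (ENNReal.ofReal p) volume :=
        eLpNorm_add_le (hg.1.sub hhm.1) (hhm.1.sub (memLp_stepFun S _ (ENNReal.ofReal p)).1)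
          (by simpa using hp)
    _ ≤ ε / 2 + ε / 2 := add_le_add h1 h3
    _ = ε := ENNReal.add_halves ε

end Step

/-! ### Unconditional convergence -/

section Tails

variable {d : ℕ} {q : ℝ≥0∞} {ι F : Type*} [NormedAddCommGroup F]

/-- The sums of `H` over finite sets of indices outside a large finite set are small in `L^q`. -/
def SmallTails (q : ℝ≥0∞) (H : ι → (Fin d → ℝ) → F) : Prop :=
  ∀ ε : ℝ≥0∞, ε ≠ 0 → ∃ s : Finset ι, ∀ t : Finset ι, Disjoint t s →
    eLpNorm (fun x => ∑ i ∈ t, H i x) q volume ≤ ε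

theorem SmallTails.add [DecidableEq ι] (hq : 1 ≤ q) {H H' : ι → (Fin d → ℝ) → F}
    (hm : ∀ i, MemLp (H i) q volume) (hm' : ∀ i, MemLp (H' i) q volume)
    (h : SmallTails q H) (h' : SmallTails q H') : SmallTails q fun i x => H i x + H' i x := by
  intro ε hε
  obtain ⟨s, hs⟩ := h (ε / 2) (ENNReal.half_pos hε).ne'
  obtain ⟨s', hs'⟩ := h' (ε / 2) (ENNReal.half_pos hε).ne'
  refine ⟨s ∪ s', fun t ht => ?_⟩
  rw [Finset.disjoint_union_right] at ht
  simp only [Finset.sum_add_distrib]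
  calc _ ≤ _ := eLpNorm_add_le (memLp_finsetSum t fun i _ => hm i).1
        (memLp_finsetSum t fun i _ => hm' i).1 hq
    _ ≤ ε / 2 + ε / 2 := add_le_add (hs t ht.1) (hs' t ht.2)
    _ = ε := ENNReal.add_halves ε

theorem smallTails_zero : SmallTails q fun (_ : ι) (_ : Fin d → ℝ) => (0 : F) :=
  fun ε _ => ⟨∅, fun t _ => by simp⟩

theorem smallTails_of_tsum_ne_top (hq : 1 ≤ q) {H : ι → (Fin d → ℝ) → F}
    (hm : ∀ i, MemLp (H i) q volume) (h : ∑' i, eLpNorm (H i) q volume ≠ ⊤) :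
    SmallTails q H := by
  intro ε hε
  obtain ⟨s, hs⟩ := ((ENNReal.tendsto_tsum_compl_atTop_zero h).eventually
    (gt_mem_nhds hε.bot_lt)).exists
  refine ⟨s, fun t ht => le_trans ?_ hs.le⟩
  have h1 : eLpNorm (fun x => ∑ i ∈ t, H i x) q volume ≤ ∑ i ∈ t, eLpNorm (H i) q volume := by
    have := eLpNorm_sum_le (f := H) (s := t) (fun i _ => (hm i).1) hq
    rwa [Finset.sum_fn] at this
  refine h1.trans ?_
  rw [← Finset.tsum_subtype]
  exact ENNReal.tsum_mono_subtype (fun i => eLpNorm (H i) q volume) (s := {i | i ∈ t})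
    (t := {i | i ∉ s}) fun i hi hi' => Finset.disjoint_left.1 ht hi hi'

end Tails

/-! ### Nestedness of dyadic cubes -/

section Nested

variable {d : ℕ} {ω : Shift d} {F : Type*} [NormedAddCommGroup F] [NormedSpace ℝ F]

theorem cube_subset_of_mem {Q R : DyadicCube d} (h : R.scale ≤ Q.scale) {x : Fin d → ℝ}
    (hx : x ∈ cube ω Q) (hx' : x ∈ cube ω R) : cube ω Q ⊆ cube ω R := by
  obtain ⟨n, hn⟩ := Int.le.dest h
  obtain ⟨w, hw⟩ := exists_mem_desc hx' n
  rw [eq_of_mem_cube (by rw [scale_desc, hn]) hx hw]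
  exact desc_subset w (Nat.zero_le n)

theorem isBounded_cube (Q : DyadicCube d) : Bornology.IsBounded (cube ω Q) :=
  Metric.isBounded_iff.2 ⟨_, fun _ hx _ hy => dist_le_of_mem_cube hx hy⟩

theorem avg_zero (Q : DyadicCube d) : avg ω Q (fun _ => (0 : F)) = 0 := by
  simp [avg]

theorem haarProj_zero (Q : DyadicCube d) (x : Fin d → ℝ) :
    haarProj ω Q (fun _ => (0 : F)) x = 0 := by
  simp [haarProj, avg_zero]

end Nested

/-! ### Tails over small cubes -/

section Fine

variable {d : ℕ} {ω : Shift d} {p : ℝ}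
  {F : Type*} [NormedAddCommGroup F] [NormedSpace ℝ F] [CompleteSpace F]

/-- The Haar expansion of an `L^p`-function supported in a cube, restricted to the cubes that are
not larger than a given size, has small tails. -/
theorem smallTails_haarProj (hp : 1 ≤ p) {C : ℝ} (hC : 0 ≤ C)
    (hF : IsUMDBound p F (ENNReal.ofReal C)) {g : (Fin d → ℝ) → F}
    (hg : MemLp g (ENNReal.ofReal p) volume) {R : DyadicCube d} (hR : ∀ x ∉ cube ω R, g x = 0) :
    SmallTails (ENNReal.ofReal p) fun (Q : DyadicCube d) x =>
      if R.scale ≤ Q.scale then haarProj ω Q g x else 0 := by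
  classical
  intro ε hε
  obtain ⟨δ, hδ0, hδ⟩ := ENNReal.exists_nnreal_pos_mul_lt
    (ENNReal.ofReal_ne_top (r := 2 * C)) hε
  obtain ⟨k, S, c, hS, hc⟩ := MemLp.exists_stepFun (ω := ω) hp hg
    (ENNReal.coe_ne_zero.2 hδ0.ne')
  choose U hU hU' using fun l => exists_finset_cubeAt_mem (ω := ω) (isBounded_cube (ω := ω) R) l
  -- Of the cubes not larger than `R`, those outside this set either miss `R` and contribute
  -- nothing, or have scale at least `k`, where the Haar projections annihilate the step function.
  refine ⟨(Finset.Ico R.scale k).biUnion U, fun t ht => ?_⟩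
  have h1 : ∀ x, ∑ Q ∈ t, (if R.scale ≤ Q.scale then haarProj ω Q g x else 0)
      = ∑ Q ∈ t with R.scale ≤ Q.scale ∧ k ≤ Q.scale, haarProj ω Q g x := fun x => by
    rw [Finset.sum_filter]
    refine Finset.sum_congr rfl fun Q hQ => ?_
    by_cases h2 : R.scale ≤ Q.scale
    · by_cases h3 : k ≤ Q.scale
      · rw [if_pos h2, if_pos ⟨h2, h3⟩]
      · rw [if_pos h2, if_neg fun h => h3 h.2, haarProj_congr (g' := fun _ => 0), haarProj_zero]
        refine fun y hy => hR y fun hy' => Finset.disjoint_left.1 ht hQ ?_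
        refine Finset.mem_biUnion.2 ⟨Q.scale, Finset.mem_Ico.2 ⟨h2, not_le.1 h3⟩, ?_⟩
        have := hU' Q.scale y hy'
        rwa [mem_cube_iff.1 hy] at this
    · rw [if_neg h2, if_neg fun h => h2 h.1]
  simp only [h1]
  refine (eLpNorm_sum_haarProj_le hp hC hF (k := k) (fun Q hQ => (Finset.mem_filter.1 hQ).2.2) hg
    (memLp_stepFun (ω := ω) S c _) fun Q hQ => ⟨_, fun x hx => stepFun_eq hS hQ hx⟩).trans ?_
  calc _ ≤ ENNReal.ofReal (2 * C) * δ := by gcongr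
    _ ≤ ε := by rw [mul_comm]; exact hδ.le

end Fine

/-! ### Tails of the paraproduct -/

section Paraproduct

variable {d : ℕ} {ω : Shift d} {p : ℝ}
  {T E : Type*} [NormedAddCommGroup T] [NormedSpace ℝ T] [CompleteSpace T]
  [NormedAddCommGroup E] [NormedSpace ℝ E] [CompleteSpace E] {B : T →L[ℝ] E →L[ℝ] E}

theorem bilinTerm_add (hp : 1 ≤ p) (b : (Fin d → ℝ) → T) {f f' : (Fin d → ℝ) → E}
    (hf : MemLp f (ENNReal.ofReal p) volume) (hf' : MemLp f' (ENNReal.ofReal p) volume)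
    (Q : DyadicCube d) (x : Fin d → ℝ) :
    bilinTerm ω B b (fun x => f x + f' x) Q x = bilinTerm ω B b f Q x + bilinTerm ω B b f' Q x := by
  rw [bilinTerm, avg_add (MemLp.integrableOn_cube hp (hf.restrict _))
    (MemLp.integrableOn_cube hp (hf'.restrict _)), map_add, bilinTerm, bilinTerm]

theorem memLp_indicator_cube (Q : DyadicCube d) (v : E) (q : ℝ≥0∞) :
    MemLp ((cube ω Q).indicator fun _ => v) q volume :=
  memLp_indicator_const q (measurableSet_cube Q) v (Or.inr (volume_cube_ne_top Q))

/-- On cubes not larger than `R`, the paraproduct of an indicator is a Haar expansion. -/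
theorem bilinTerm_indicator_eq_haarProj {b : (Fin d → ℝ) → T}
    (hb : LocallyIntegrable b volume) {R Q : DyadicCube d} (h : R.scale ≤ Q.scale) (v : E)
    (x : Fin d → ℝ) :
    bilinTerm ω B b ((cube ω R).indicator fun _ => v) Q x
      = haarProj ω Q ((cube ω R).indicator fun y => B.flip v (b y)) x := by
  by_cases hd : Disjoint (cube ω Q) (cube ω R)
  · have h1 : ∀ y ∈ cube ω Q, y ∉ cube ω R := fun y hy => Set.disjoint_left.1 hd hy
    rw [bilinTerm, avg_congr (g' := fun _ => 0) fun y hy => Set.indicator_of_notMem (h1 y hy) _,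
      avg_zero, map_zero, haarProj_congr (g' := fun _ => 0)
        fun y hy => Set.indicator_of_notMem (h1 y hy) _, haarProj_zero]
  · obtain ⟨z, hz, hz'⟩ := Set.not_disjoint_iff.1 hd
    have h1 := cube_subset_of_mem h hz hz'
    rw [bilinTerm, avg_congr (g' := fun _ => v) fun y hy => Set.indicator_of_mem (h1 hy) _,
      avg_const, haarProj_congr (g' := fun y => B.flip v (b y))
        fun y hy => Set.indicator_of_mem (h1 hy) _,
      haarProj_clm _ (LocallyIntegrable.integrableOn_cube hb Q), ContinuousLinearMap.flip_apply]

/-- All cubes are then the same single point. The case is separate because the geometric decay in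
`smallTails_bilinTerm_coarse` needs `2 ^ d > 1`. -/
theorem bilinTerm_of_dim_eq_zero (hd : d = 0) (b : (Fin d → ℝ) → T) (f : (Fin d → ℝ) → E)
    (Q : DyadicCube d) (x : Fin d → ℝ) : bilinTerm ω B b f Q x = 0 := by
  subst hd
  have h1 : ∀ Q : DyadicCube 0, cube ω Q = Set.univ := fun Q =>
    Set.eq_univ_of_forall fun y i => i.elim0
  obtain ⟨η, hη⟩ := exists_mem_cube_child (ω := ω) (Q := Q) (x := x) (h1 Q ▸ Set.mem_univ x)
  rw [bilinTerm, haarProj_of_mem b hη, avg, avg, h1, h1, sub_self, map_zero,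
    zero_apply]

/-- The bound for a single term of the paraproduct. -/
theorem eLpNorm_bilinTerm_le (hp : 1 < p) {CE CT : ℝ} (hCE : 0 ≤ CE) (hCT : 0 ≤ CT)
    (hE : IsUMDBound p E (ENNReal.ofReal CE)) (hT : IsUMDBound p T (ENNReal.ofReal CT))
    (hB : ∀ t e, ‖B t e‖ ≤ ‖t‖ * ‖e‖) {b : (Fin d → ℝ) → T} (hb : MemBMO ω p b)
    (f : (Fin d → ℝ) → E) (Q : DyadicCube d) :
    eLpNorm (bilinTerm ω B b f Q) (ENNReal.ofReal p) volume
      ≤ ENNReal.ofReal (paraproductConst d p CE CT (bmoNorm ω p b).toReal)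
        * ENNReal.ofReal (‖avg ω Q f‖ * volume.real (cube ω Q) ^ (1 / p)) := by
  -- The term sees only the average of `f` over `Q`, so `f` may be replaced by that constant on `Q`.
  have h1 := eLpNorm_sum_bilinTerm_le hp hCE hCT hE hT hB hb {Q}
    (memLp_indicator_cube (ω := ω) Q (avg ω Q f) (ENNReal.ofReal p))
  have h2 : bilinTerm ω B b ((cube ω Q).indicator fun _ => avg ω Q f) Q = bilinTerm ω B b f Q := by
    funext x
    rw [bilinTerm, avg_congr (g' := fun _ => avg ω Q f) fun y hy => Set.indicator_of_mem hy _,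
      avg_const, bilinTerm]
  simp only [Finset.sum_singleton] at h1
  rw [h2] at h1
  refine h1.trans (mul_le_mul_right ((eLpNorm_indicator_const_le _ _).trans (le_of_eq ?_)) _)
  rw [ENNReal.toReal_ofReal (by linarith), ENNReal.ofReal_mul (norm_nonneg _), ofReal_norm,
    ← ENNReal.ofReal_rpow_of_nonneg measureReal_nonneg (by positivity),
    ofReal_measureReal (volume_cube_ne_top Q)]

/-- The large cubes contribute a small tail to the paraproduct of an indicator. -/
theorem smallTails_bilinTerm_coarse (hp : 1 < p) {CE CT : ℝ} (hCE : 0 ≤ CE) (hCT : 0 ≤ CT)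
    (hE : IsUMDBound p E (ENNReal.ofReal CE)) (hT : IsUMDBound p T (ENNReal.ofReal CT))
    (hB : ∀ t e, ‖B t e‖ ≤ ‖t‖ * ‖e‖) {b : (Fin d → ℝ) → T} (hb : MemBMO ω p b)
    (R : DyadicCube d) (v : E) :
    SmallTails (ENNReal.ofReal p) fun (Q : DyadicCube d) x => if R.scale ≤ Q.scale then 0 else
      bilinTerm ω B b ((cube ω R).indicator fun _ => v) Q x := by
  have hp0 : 0 < p := by linarith
  rcases Nat.eq_zero_or_pos d with hd | hd
  · simp only [bilinTerm_of_dim_eq_zero hd, ite_self]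
    exact smallTails_zero
  obtain ⟨z, hz⟩ := exists_mem_cube (ω := ω) R
  set f : (Fin d → ℝ) → E := (cube ω R).indicator fun _ => v with hf
  -- The chain of ancestors of `R`, including `R` itself, where `H` is zero; all other larger cubes
  -- miss `R`.
  set P : ℕ → DyadicCube d := fun i => cubeAt ω (R.scale - i) z with hP
  have hPs : ∀ i, (P i).scale = R.scale - i := fun i => rfl
  have hPinj : Function.Injective P := fun i j h => by
    have := congrArg DyadicCube.scale h
    rw [hPs, hPs] at this
    omega
  set H : DyadicCube d → (Fin d → ℝ) → E := fun Q x => if R.scale ≤ Q.scale then 0 else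
    bilinTerm ω B b f Q x with hH
  have hHm : ∀ Q, MemLp (H Q) (ENNReal.ofReal p) volume := fun Q => by
    by_cases h : R.scale ≤ Q.scale
    · simp only [hH, if_pos h]; exact MemLp.zero'
    · simp only [hH, if_neg h]; exact memLp_bilinTerm b f Q _
  have hH0 : ∀ Q ∉ Set.range P, H Q = 0 := fun Q hQ => by
    funext x
    by_cases h : R.scale ≤ Q.scale
    · simp only [hH, if_pos h]; rfl
    · simp only [hH, if_neg h]
      have h1 : ∀ y ∈ cube ω Q, y ∉ cube ω R := fun y hy hy' => by
        have h2 := cube_subset_of_mem (not_le.1 h).le hy' hy hz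
        refine hQ ⟨(R.scale - Q.scale).toNat, ?_⟩
        rw [hP]
        beta_reduce
        rw [Int.toNat_of_nonneg (by omega), sub_sub_cancel, mem_cube_iff.1 h2]
      rw [bilinTerm, avg_congr (g' := fun _ => 0) fun y hy => Set.indicator_of_notMem (h1 y hy) _,
        avg_zero, map_zero]
      rfl
  set K := paraproductConst d p CE CT (bmoNorm ω p b).toReal with hK
  have hK0 : 0 ≤ K := paraproductConst_nonneg hp hCT ENNReal.toReal_nonneg
  -- The average of `f` over `P i` decays like the inverse volume, while the indicator has norm
  -- volume to the power `1 / p`; `p > 1` makes the ratio less than `1`.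
  set r : ℝ := ((2 : ℝ) ^ d) ^ (1 / p - 1) with hr
  have hr1 : r < 1 := by
    refine Real.rpow_lt_one_of_one_lt_of_neg (one_lt_pow₀ (by norm_num) hd.ne') ?_
    rw [sub_neg, div_lt_one hp0]
    exact hp
  set W := volume.real (cube ω R) with hW
  have hW0 : 0 < W := volume_real_cube_pos R
  have hPv : ∀ i, volume.real (cube ω (P i)) = (2 ^ d) ^ i * W := fun i => by
    rw [hW, volume_real_cube, volume_real_cube, hPs, ← pow_mul, mul_comm d i, pow_mul, ← mul_pow]
    congr 1
    rw [neg_sub, sub_eq_add_neg, zpow_add₀ (by norm_num), zpow_natCast]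
  have hPa : ∀ i, avg ω (P i) f = (W / volume.real (cube ω (P i))) • v := fun i => by
    have h1 : cube ω R ⊆ cube ω (P i) := cube_subset_of_mem (by rw [hPs]; omega) hz
      (mem_cube_cubeAt _ z)
    rw [avg_eq, hf, setIntegral_indicator (measurableSet_cube R), Set.inter_eq_right.2 h1,
      setIntegral_const, smul_smul]
    congr 1
    rw [div_eq_inv_mul]
  have hb1 : ∀ i, eLpNorm (H (P i)) (ENNReal.ofReal p) volume
      ≤ ENNReal.ofReal (K * (‖v‖ * W ^ (1 / p)) * r ^ i) := fun i => by
    have h1 : eLpNorm (H (P i)) (ENNReal.ofReal p) volume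
        ≤ eLpNorm (bilinTerm ω B b f (P i)) (ENNReal.ofReal p) volume := by
      refine eLpNorm_mono fun x => ?_
      simp only [hH]
      split_ifs
      · simp
      · exact le_rfl
    refine h1.trans ((eLpNorm_bilinTerm_le hp hCE hCT hE hT hB hb f (P i)).trans (le_of_eq ?_))
    rw [← ENNReal.ofReal_mul hK0, hPa, hPv, norm_smul, Real.norm_of_nonneg (by positivity)]
    congr 1
    have h2 : r ^ i = (((2 : ℝ) ^ d) ^ i) ^ (1 / p) / ((2 : ℝ) ^ d) ^ i := by
      rw [hr, Real.rpow_sub_one (by positivity), div_pow, Real.rpow_pow_comm (by positivity)]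
    rw [h2, Real.mul_rpow (by positivity) hW0.le]
    field_simp
  refine smallTails_of_tsum_ne_top (by simpa using hp.le) hHm ?_
  rw [← hPinj.tsum_eq (f := fun Q => eLpNorm (H Q) (ENNReal.ofReal p) volume) ?_]
  · refine ne_top_of_le_ne_top ?_ (ENNReal.tsum_le_tsum hb1)
    exact (((summable_geometric_of_lt_one (by positivity) hr1).mul_left _).tsum_ofReal_ne_top)
  · intro Q hQ
    by_contra h
    exact hQ (by simp [hH0 Q h])

/-- Split at the size of `R`: the small cubes give a Haar expansion of the `E`-valued function `B (b
y) v` on `R`, the large ones a geometric series. -/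
theorem smallTails_bilinTerm_indicator (hp : 1 < p) {CE CT : ℝ} (hCE : 0 ≤ CE) (hCT : 0 ≤ CT)
    (hE : IsUMDBound p E (ENNReal.ofReal CE)) (hT : IsUMDBound p T (ENNReal.ofReal CT))
    (hB : ∀ t e, ‖B t e‖ ≤ ‖t‖ * ‖e‖) {b : (Fin d → ℝ) → T} (hb : MemBMO ω p b)
    (R : DyadicCube d) (v : E) :
    SmallTails (ENNReal.ofReal p)
      (bilinTerm ω B b ((cube ω R).indicator fun _ => v)) := by
  classical
  have hp0 : 0 < p := by linarith
  have hg : MemLp ((cube ω R).indicator fun y => B.flip v (b y)) (ENNReal.ofReal p) volume :=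
    (memLp_indicator_iff_restrict (measurableSet_cube R)).2
      ((B.flip v).comp_memLp' (hb.memLp hp0 R))
  have h1 := (smallTails_haarProj hp.le hCE hE hg
    (fun x hx => Set.indicator_of_notMem hx _)).add (by simpa using hp.le)
    (fun Q => ?_) (fun Q => ?_) (smallTails_bilinTerm_coarse hp hCE hCT hE hT hB hb R v)
  · convert h1 using 3 with Q x
    split_ifs with h
    · rw [bilinTerm_indicator_eq_haarProj hb.1 h, add_zero]
    · rw [zero_add]
  · split_ifs
    · exact memLp_haarProj Q _ _
    · exact MemLp.zero'
  · split_ifs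
    · exact MemLp.zero'
    · exact memLp_bilinTerm b _ Q _

theorem smallTails_bilinTerm_stepFun (hp : 1 < p) {CE CT : ℝ} (hCE : 0 ≤ CE) (hCT : 0 ≤ CT)
    (hE : IsUMDBound p E (ENNReal.ofReal CE)) (hT : IsUMDBound p T (ENNReal.ofReal CT))
    (hB : ∀ t e, ‖B t e‖ ≤ ‖t‖ * ‖e‖) {b : (Fin d → ℝ) → T} (hb : MemBMO ω p b)
    (S : Finset (DyadicCube d)) (c : DyadicCube d → E) :
    SmallTails (ENNReal.ofReal p) (bilinTerm ω B b (stepFun ω S c)) := by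
  classical
  have hp1 : (1 : ℝ≥0∞) ≤ ENNReal.ofReal p := by simpa using hp.le
  induction S using Finset.induction_on with
  | empty =>
    have : bilinTerm ω B b (stepFun ω ∅ c) = fun _ _ => 0 := by
      funext Q x
      have : stepFun ω ∅ c = fun _ => 0 := by funext y; simp [stepFun]
      rw [bilinTerm, this, avg_zero, map_zero]
    rw [this]
    exact smallTails_zero
  | insert R S hR ih =>
    have h1 : stepFun ω (insert R S) c
        = fun x => (cube ω R).indicator (fun _ => c R) x + stepFun ω S c x := by
      funext x
      rw [stepFun, Finset.sum_insert hR, stepFun]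
    have h2 := (smallTails_bilinTerm_indicator hp hCE hCT hE hT hB hb R (c R)).add hp1
      (fun Q => memLp_bilinTerm b _ Q _) (fun Q => memLp_bilinTerm b _ Q _) ih
    have h3 : bilinTerm ω B b (stepFun ω (insert R S) c) = fun Q x =>
        bilinTerm ω B b ((cube ω R).indicator fun _ => c R) Q x
          + bilinTerm ω B b (stepFun ω S c) Q x := by
      funext Q x
      rw [h1]
      exact bilinTerm_add hp.le b (memLp_indicator_cube R (c R) _) (memLp_stepFun S c _) Q x
    rw [h3]
    exact h2

/-- The tails of the paraproduct are small. -/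
theorem smallTails_bilinTerm (hp : 1 < p) {CE CT : ℝ} (hCE : 0 ≤ CE) (hCT : 0 ≤ CT)
    (hE : IsUMDBound p E (ENNReal.ofReal CE)) (hT : IsUMDBound p T (ENNReal.ofReal CT))
    (hB : ∀ t e, ‖B t e‖ ≤ ‖t‖ * ‖e‖) {b : (Fin d → ℝ) → T} (hb : MemBMO ω p b)
    {f : (Fin d → ℝ) → E} (hf : MemLp f (ENNReal.ofReal p) volume) :
    SmallTails (ENNReal.ofReal p) (bilinTerm ω B b f) := by
  have hp1 : (1 : ℝ≥0∞) ≤ ENNReal.ofReal p := by simpa using hp.le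
  intro ε hε
  obtain ⟨δ, hδ0, hδ⟩ := ENNReal.exists_nnreal_pos_mul_lt (ENNReal.ofReal_ne_top
    (r := paraproductConst d p CE CT (bmoNorm ω p b).toReal)) (ENNReal.half_pos hε).ne'
  obtain ⟨k, S, c, hS, hc⟩ := MemLp.exists_stepFun (ω := ω) hp.le hf
    (ENNReal.coe_ne_zero.2 hδ0.ne')
  have hsm := memLp_stepFun (ω := ω) S c (ENNReal.ofReal p)
  obtain ⟨s, hs⟩ := smallTails_bilinTerm_stepFun hp hCE hCT hE hT hB hb S c (ε / 2)
    (ENNReal.half_pos hε).ne'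
  refine ⟨s, fun t ht => ?_⟩
  have h1 : (fun x => ∑ Q ∈ t, bilinTerm ω B b f Q x)
      = (fun x => ∑ Q ∈ t, bilinTerm ω B b (f - stepFun ω S c) Q x)
        + fun x => ∑ Q ∈ t, bilinTerm ω B b (stepFun ω S c) Q x := by
    funext x
    rw [Pi.add_apply, ← Finset.sum_add_distrib]
    refine Finset.sum_congr rfl fun Q _ => ?_
    rw [← bilinTerm_add hp.le b (hf.sub hsm) hsm]
    simp only [Pi.sub_apply, sub_add_cancel]
  have h2 := eLpNorm_sum_bilinTerm_le hp hCE hCT hE hT hB hb t (hf.sub hsm)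
  have h3 := mul_le_mul_right hc
    (ENNReal.ofReal (paraproductConst d p CE CT (bmoNorm ω p b).toReal))
  have h4 := fun g => (memLp_finsetSum t fun Q _ =>
    memLp_bilinTerm (ω := ω) (B := B) b g Q (ENNReal.ofReal p)).aestronglyMeasurable
  have h5 := eLpNorm_add_le (h4 (f - stepFun ω S c)) (h4 (stepFun ω S c)) hp1
  have h6 := hs t ht
  have h7 : ENNReal.ofReal (paraproductConst d p CE CT (bmoNorm ω p b).toReal) * δ ≤ ε / 2 := by
    rw [mul_comm]
    exact hδ.le
  rw [h1]
  calc _ ≤ _ := h5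
    _ ≤ ε / 2 + ε / 2 := add_le_add (h2.trans (h3.trans h7)) h6
    _ = ε := ENNReal.add_halves ε

end Paraproduct

/-! ### Convergence and the main theorem -/

/-- A family in `L^q` with small tails is unconditionally summable. -/
theorem SmallTails.exists_tendsto {d : ℕ} {q : ℝ≥0∞} (hq : 1 ≤ q) {ι F : Type*}
    [NormedAddCommGroup F] [CompleteSpace F] {H : ι → (Fin d → ℝ) → F}
    (hm : ∀ i, MemLp (H i) q volume) (h : SmallTails q H) :
    ∃ g : (Fin d → ℝ) → F, MemLp g q volume ∧ Tendsto (fun s : Finset ι =>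
      eLpNorm ((∑ i ∈ s, H i) - g) q volume) atTop (𝓝 0) := by
  have : Fact (1 ≤ q) := ⟨hq⟩
  have hsum : ∀ t : Finset ι, (memLp_finsetSum' t fun i _ => hm i).toLp _
      = ∑ i ∈ t, (hm i).toLp (H i) := fun t => by
    classical
    induction t using Finset.induction_on with
    | empty => simp
    | insert i t hi ih =>
      rw [Finset.sum_insert (f := fun i => (hm i).toLp (H i)) hi, ← ih, ← MemLp.toLp_add]
      exact MemLp.toLp_congr _ _ (EventuallyEq.of_eq (Finset.sum_insert hi))
  have h1 : Summable fun i => (hm i).toLp (H i) := by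
    rw [summable_iff_vanishing_norm]
    intro ε hε
    obtain ⟨s, hs⟩ := h (ENNReal.ofReal (ε / 2)) (by simpa using hε)
    refine ⟨s, fun t ht => ?_⟩
    rw [← hsum, Lp.norm_toLp]
    have h2 := hs t ht
    rw [← Finset.sum_fn] at h2
    have h3 := ENNReal.toReal_mono ENNReal.ofReal_ne_top h2
    rw [ENNReal.toReal_ofReal (by positivity)] at h3
    linarith
  obtain ⟨G, hG⟩ := h1
  refine ⟨G, Lp.memLp G, ?_⟩
  have h2 : Tendsto (fun s : Finset ι => ∑ i ∈ s, (hm i).toLp (H i)) atTop (𝓝 G) := hG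
  rw [tendsto_iff_edist_tendsto_0] at h2
  refine h2.congr fun s => ?_
  rw [← hsum, Lp.edist_def]
  exact eLpNorm_congr_ae ((MemLp.coeFn_toLp _).sub (ae_eq_refl _))

theorem exists_tendsto_sum_bilinTerm {d : ℕ} {ω : Shift d} {p : ℝ}
    {T E : Type*} [NormedAddCommGroup T] [NormedSpace ℝ T] [CompleteSpace T]
    [NormedAddCommGroup E] [NormedSpace ℝ E] [CompleteSpace E] {B : T →L[ℝ] E →L[ℝ] E}
    (hp : 1 < p) {CE CT : ℝ} (hCE : 0 ≤ CE) (hCT : 0 ≤ CT)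
    (hE : IsUMDBound p E (ENNReal.ofReal CE)) (hT : IsUMDBound p T (ENNReal.ofReal CT))
    (hB : ∀ t e, ‖B t e‖ ≤ ‖t‖ * ‖e‖) {b : (Fin d → ℝ) → T} (hb : MemBMO ω p b)
    {f : (Fin d → ℝ) → E} (hf : MemLp f (ENNReal.ofReal p) volume) :
    ∃ g : (Fin d → ℝ) → E, MemLp g (ENNReal.ofReal p) volume ∧
      Tendsto (fun s : Finset (DyadicCube d) =>
        eLpNorm ((∑ Q ∈ s, bilinTerm ω B b f Q) - g) (ENNReal.ofReal p) volume) atTop (𝓝 0) ∧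
      eLpNorm g (ENNReal.ofReal p) volume
        ≤ ENNReal.ofReal (paraproductConst d p CE CT (bmoNorm ω p b).toReal)
          * eLpNorm f (ENNReal.ofReal p) volume := by
  have hq : (1 : ℝ≥0∞) ≤ ENNReal.ofReal p := by simpa using hp.le
  have hm := fun Q => memLp_bilinTerm (ω := ω) (B := B) b f Q (ENNReal.ofReal p)
  obtain ⟨g, hg, hlim⟩ :=
    (smallTails_bilinTerm hp hCE hCT hE hT hB hb hf).exists_tendsto hq hm
  -- The norm of `g` exceeds the uniform bound for a partial sum at most by the error of that sum,
  -- which tends to zero.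
  refine ⟨g, hg, hlim, ge_of_tendsto' (by simpa using hlim.const_add _) fun s => ?_⟩
  have hs := memLp_finsetSum' s fun Q _ => hm Q
  have h1 := eLpNorm_sum_bilinTerm_le hp hCE hCT hE hT hB hb s hf
  rw [← Finset.sum_fn] at h1
  calc eLpNorm g (ENNReal.ofReal p) volume
      = eLpNorm ((∑ Q ∈ s, bilinTerm ω B b f Q) - ((∑ Q ∈ s, bilinTerm ω B b f Q) - g))
          (ENNReal.ofReal p) volume := by rw [sub_sub_cancel]
    _ ≤ _ := eLpNorm_sub_le hs.1 (hs.1.sub hg.1) hq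
    _ ≤ _ := by gcongr

end DyadicParaproduct

theorem mainTheorem4 {d : ℕ} {E : Type*} [NormedAddCommGroup E] [NormedSpace ℝ E]
    [CompleteSpace E] (𝒯 : Submodule ℝ (E →L[ℝ] E)) (h𝒯 : IsClosed (𝒯 : Set (E →L[ℝ] E)))
    (p : ℝ) (hp : 1 < p)
    (hE_umd : DyadicParaproduct.IsUMD p E) (h𝒯_umd : DyadicParaproduct.IsUMD p 𝒯)
    (ω : DyadicParaproduct.Shift d)
    (b : (Fin d → ℝ) → 𝒯) (hb : DyadicParaproduct.MemBMO ω p b)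
    (f : (Fin d → ℝ) → E) (hf : MemLp f (ENNReal.ofReal p) volume) :
    ∃ g : (Fin d → ℝ) → E, DyadicParaproduct.IsParaproduct ω p b f g ∧
      eLpNorm g (ENNReal.ofReal p) volume ≤
        ENNReal.ofReal (6 * 2 ^ d * p * (p / (p - 1))) *
          DyadicParaproduct.umdConst p E ^ 2 * DyadicParaproduct.umdConst p 𝒯 *
          DyadicParaproduct.bmoNorm ω p b * eLpNorm f (ENNReal.ofReal p) volume := by
  have : CompleteSpace 𝒯 := h𝒯.completeSpace_coe
  have hp0 : 0 < p - 1 := by linarith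
  -- With the inclusion of `𝒯` as bilinear map, `bilinTerm` unfolds to `paraproductTerm`.
  obtain ⟨g, hg, hlim, hle⟩ := DyadicParaproduct.exists_tendsto_sum_bilinTerm
    (B := 𝒯.subtypeL) hp ENNReal.toReal_nonneg ENNReal.toReal_nonneg hE_umd.isUMDBound_toReal
    h𝒯_umd.isUMDBound_toReal (fun t e => (t : E →L[ℝ] E).le_opNorm e) hb hf
  refine ⟨g, ⟨hg, hlim⟩, hle.trans (le_of_eq ?_)⟩
  congr 1
  rw [DyadicParaproduct.paraproductConst, ENNReal.ofReal_mul (by positivity),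
    ENNReal.ofReal_mul (by positivity), ENNReal.ofReal_mul (by positivity),
    ENNReal.ofReal_pow ENNReal.toReal_nonneg, ENNReal.ofReal_toReal hE_umd.umdConst_ne_top,
    ENNReal.ofReal_toReal h𝒯_umd.umdConst_ne_top, ENNReal.ofReal_toReal hb.2.ne]
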